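/- **Conventions.** A rooted Kripke model is $\mathcal M=(W,R,\eta,r)$ with a non-empty set $W$ of worlds, a total relation $R\subseteq W\times W$, an assignment $\eta:W\to 2^{\mathrm{PROP}}$ and a root $r\in W$; $\mathcal M\models\varphi$ means that the CTL formula $\varphi$ holds at $r$, path quantifiers ranging over infinite paths. A connected submodel of $\mathcal M$ is a structure $(W',R',\eta{\upharpoonright}_{W'},r)$ with $r\in W'\subseteq W$ and $R'\subseteq R\cap (W'\times W')$ total on $W'$, such that every world of $W'$ lies on an $R'$-path from $r$. For a set of deletions $D=(D_W,D_R)$ with $r\notin D_W$, $\mathcal M-D$ is the structure with worlds $W\setminus D_W$ and the transitions of $R\setminus D_R$ between them (not necessarily total). An $\{\mathsf{AF},\mathsf{AG}\}$-formula is a formula built from an atom ($\top$ or a proposition) with the operators $\mathsf{AF}$, $\mathsf{AG}$ and no Boolean connectors. An enumeration problem is in $\mathsf{DelP}$ if some random access machine (logarithmic cost) with an oracle in $\mathsf P$ and some polynomial $p$ are such that on every instance $x$ the machine terminates, outputs exactly the solutions of $x$ without repetition, takes time at most $p(|x|)$ before the first output, between consecutive outputs and after the last output, and makes only oracle calls of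 size at most $p(|x|)$. **Theorem.** 1. The following problem is in $\mathsf{DelP}$: given a finite rooted Kripke model $\mathcal M$ and an $\{\mathsf{AF},\mathsf{AG}\}$-formula $\varphi$, output all connected submodels $\mathcal M'$ of $\mathcal M$ with $\mathcal M'\models\varphi$. 2. Every $\{\mathsf{AF},\mathsf{AG}\}$-formula that is not an atom is equivalent, over all rooted Kripke models, to one of $\mathsf{AF}\,a$, $\mathsf{AG}\,a$, $\mathsf{AF}\,\mathsf{AG}\,a$, $\mathsf{AG}\,\mathsf{AF}\,a$ for some atom $a$. 3. Let $\mathcal M$ be a finite rooted Kripke model, $D$ a set of deletions with $r\notin D_W$, and $a$ an atom. Write $\mathrm{Ext}(\varphi)$ for: there are deletions $D'=(D'_W,D'_R)$ with $D_W\subseteq D'_W$ and $D_R\subseteq D'_R$ such that $\mathcal M-D'$ is a connected submodel of $\mathcal M$ and $\mathcal M-D'\models\varphi$. Then - $\mathrm{Ext}(\mathsf{AF}\,a)$ iff $\mathcal M-D\models\mathsf{EF}\,a$; - $\mathrm{Ext}(\mathsf{AG}\,a)$ iff $\mathcal M-D\models\mathsf{EG}\,a$; - $\mathrm{Ext}(\mathsf{AF}\,\mathsf{AG}\,a)$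 iff $\mathcal M-D\models\mathsf{EF}\,\mathsf{EG}\,a$; - $\mathrm{Ext}(\mathsf{AG}\,\mathsf{AF}\,a)$ iff in $\mathcal M-D$ some world satisfying $a$ is reachable from $r$ and lies on a cycle. -/

import Mathlib

universe u

/-! ## CTL: syntax, Kripke structures, semantics -/

/-- Path quantifiers. -/
inductive PathQuant
  | E
  | A

/-- Unary temporal modalities. -/
inductive UnaryTemp
  | X
  | F
  | G

/-- Binary temporal modalities. -/
inductive BinaryTemp
  | U
  | R

/-- CTL formulas; the propositions are the natural numbers. -/
inductive CTL
  | top : CTL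
  | prop (p : ℕ) : CTL
  | neg (φ : CTL) : CTL
  | or (φ ψ : CTL) : CTL
  | and (φ ψ : CTL) : CTL
  | un (q : PathQuant) (t : UnaryTemp) (φ : CTL) : CTL
  | bin (q : PathQuant) (t : BinaryTemp) (φ ψ : CTL) : CTL

namespace CTL

abbrev EF (φ : CTL) : CTL := un PathQuant.E UnaryTemp.F φ
abbrev AF (φ : CTL) : CTL := un PathQuant.A UnaryTemp.F φ
abbrev EG (φ : CTL) : CTL := un PathQuant.E UnaryTemp.G φ
abbrev AG (φ : CTL) : CTL := un PathQuant.A UnaryTemp.G φ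

/-- The symbols a fragment of CTL may or may not allow: Boolean connectors and CTL operators. -/
inductive Op
  | neg
  | or
  | and
  | un (q : PathQuant) (t : UnaryTemp)
  | bin (q : PathQuant) (t : BinaryTemp)

/-- The connectors and operators that occur in a formula. -/
def ops : CTL → Set Op
  | top => ∅
  | prop _ => ∅
  | neg φ => insert Op.neg φ.ops
  | or φ ψ => insert Op.or (φ.ops ∪ ψ.ops)
  | and φ ψ => insert Op.and (φ.ops ∪ ψ.ops)
  | un q t φ => insert (Op.un q t) φ.ops
  | bin q t φ ψ => insert (Op.bin q t) (φ.ops ∪ ψ.ops)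

/-- The fragment of all formulas built from `⊤` and propositions with symbols from `O` only. -/
def Fragment (O : Set Op) : Set CTL := {φ | φ.ops ⊆ O}

/-- Atomic formulas: `⊤` and the propositions. -/
def IsAtom (φ : CTL) : Prop := φ = top ∨ ∃ p, φ = prop p

/-- The two operators `AF` and `AG`, and no Boolean connector. -/
def opsAFAG : Set Op := {Op.un PathQuant.A UnaryTemp.F, Op.un PathQuant.A UnaryTemp.G}

end CTL

/-- The data `(R, η, r)` of a rooted Kripke structure on the set of worlds `W`. It is a rooted
Kripke model if moreover the relation is total, see `Kripke.Total`. -/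
structure Kripke (W : Type u) where
  /-- transition relation -/
  R : W → W → Prop
  /-- assignment of propositions to worlds -/
  η : W → Set ℕ
  /-- root -/
  r : W

namespace Kripke

variable {W : Type u}

/-- The transition relation is total. -/
def Total (M : Kripke W) : Prop := ∀ w, ∃ v, M.R w v

/-- The infinite paths of `M` that start in `w`; the first world has index `0`. -/
def paths (M : Kripke W) (w : W) : Set (ℕ → W) :=
  {π | π 0 = w ∧ ∀ i, M.R (π i) (π (i + 1))}

/-- The CTL satisfaction relation at a world. -/
def Sat (M : Kripke W) : CTL → W → Prop
  | .top, _ => True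
  | .prop p, w => p ∈ M.η w
  | .neg φ, w => ¬ M.Sat φ w
  | .or φ ψ, w => M.Sat φ w ∨ M.Sat ψ w
  | .and φ ψ, w => M.Sat φ w ∧ M.Sat ψ w
  | .un .E .X φ, w => ∃ π ∈ M.paths w, M.Sat φ (π 1)
  | .un .A .X φ, w => ∀ π ∈ M.paths w, M.Sat φ (π 1)
  | .un .E .F φ, w => ∃ π ∈ M.paths w, ∃ k, M.Sat φ (π k)
  | .un .A .F φ, w => ∀ π ∈ M.paths w, ∃ k, M.Sat φ (π k)
  | .un .E .G φ, w => ∃ π ∈ M.paths w, ∀ k, M.Sat φ (π k)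
  | .un .A .G φ, w => ∀ π ∈ M.paths w, ∀ k, M.Sat φ (π k)
  | .bin .E .U φ ψ, w => ∃ π ∈ M.paths w, ∃ k, M.Sat ψ (π k) ∧ ∀ i < k, M.Sat φ (π i)
  | .bin .A .U φ ψ, w => ∀ π ∈ M.paths w, ∃ k, M.Sat ψ (π k) ∧ ∀ i < k, M.Sat φ (π i)
  | .bin .E .R φ ψ, w => ∃ π ∈ M.paths w, ∀ k, M.Sat ψ (π k) ∨ ∃ i < k, M.Sat φ (π i)
  | .bin .A .R φ ψ, w => ∀ π ∈ M.paths w, ∀ k, M.Sat ψ (π k) ∨ ∃ i < k, M.Sat φ (π i)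

/-- `M ⊨ φ`: satisfaction at the root. -/
def Models (M : Kripke W) (φ : CTL) : Prop := M.Sat φ M.r

/-- The structure with worlds `V` (containing the root), transitions those pairs of `S` that lie in
`V × V`, and the restricted assignment. -/
def sub (M : Kripke W) (V : Set W) (S : Set (W × W)) (h : M.r ∈ V) : Kripke V where
  R a b := ((a : W), (b : W)) ∈ S
  η a := M.η a
  r := ⟨M.r, h⟩

/-- `(V, S, η↾V, r)` is a connected submodel of `M`: a total structure with `V ⊆ W`, `S ⊆ R`, in
which every world lies on a path from the root. -/
structure IsConnectedSubmodel (M : Kripke W) (V : Set W) (S : Set (W × W)) : Prop where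
  root_mem : M.r ∈ V
  rel_subset : ∀ a b, (a, b) ∈ S → M.R a b
  rel_on : ∀ a b, (a, b) ∈ S → a ∈ V ∧ b ∈ V
  total : (M.sub V S root_mem).Total
  connected : ∀ w, ∃ π ∈ (M.sub V S root_mem).paths (M.sub V S root_mem).r, ∃ i, π i = w

/-- `(V, S)` is a connected submodel of `M` that satisfies `φ`. -/
def IsSatisfyingSubmodel (M : Kripke W) (φ : CTL) (V : Set W) (S : Set (W × W)) : Prop :=
  ∃ h : M.IsConnectedSubmodel V S, (M.sub V S h.root_mem).Models φ

/-- A set of deletions: worlds and transitions to be removed. -/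
structure Deletions (W : Type u) where
  worlds : Set W
  rels : Set (W × W)

/-- The worlds of `M - D`. -/
def keptWorlds (_M : Kripke W) (D : Deletions W) : Set W := D.worldsᶜ

/-- The transitions of `M - D`. -/
def keptRels (M : Kripke W) (D : Deletions W) : Set (W × W) := {e | M.R e.1 e.2} \ D.rels

/-- The structure `M - D`, for deletions that do not remove the root. It need not be total. -/
def delete (M : Kripke W) (D : Deletions W) (h : M.r ∉ D.worlds) : Kripke (M.keptWorlds D) :=
  M.sub (M.keptWorlds D) (M.keptRels D) h

/-- The extension problem for submodels: some extension of the deletions `D` leaves a connected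
submodel that satisfies `φ`. -/
def ExtendSubmodel (M : Kripke W) (φ : CTL) (D : Deletions W) : Prop :=
  ∃ D₂ : Deletions W, D.worlds ⊆ D₂.worlds ∧ D.rels ⊆ D₂.rels ∧
    M.IsSatisfyingSubmodel φ (M.keptWorlds D₂) (M.keptRels D₂)

end Kripke

/-- Equivalence of CTL formulas over all rooted Kripke models. -/
def CTL.Equivalent (φ ψ : CTL) : Prop :=
  ∀ (W : Type u) (M : Kripke W), M.Total → ∀ w, M.Sat φ w ↔ M.Sat ψ w

/-! ## Random access machines with a decision oracle -/

namespace RAM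

/-- Instructions of a random access machine whose registers hold natural numbers. `orc` denotes the
separate bank of oracle registers. -/
inductive Instr
  /-- `reg i := c` -/
  | const (i c : ℕ)
  /-- `reg i := reg j` -/
  | copy (i j : ℕ)
  /-- `reg i := reg j + reg k` -/
  | add (i j k : ℕ)
  /-- `reg i := reg j - reg k`, truncated at `0` -/
  | sub (i j k : ℕ)
  /-- `reg i := reg (reg j)` -/
  | load (i j : ℕ)
  /-- `reg (reg i) := reg j` -/
  | store (i j : ℕ)
  /-- go to line `l` -/
  | jump (l : ℕ)
  /-- go to line `l` if `reg i = 0` -/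
  | jumpZero (i l : ℕ)
  /-- append the symbol `reg i` to the word that is being printed -/
  | print (i : ℕ)
  /-- the word printed since the last `emit` is complete: it is output -/
  | emit
  /-- `orc (reg i) := reg j` -/
  | oracleStore (i j : ℕ)
  /-- query the oracle; go to line `l` if the answer is positive -/
  | query (l : ℕ)

/-- A program. The machine halts when the program counter leaves the program. -/
abbrev Program := List Instr

/-- The cost of executing an instruction (logarithmic cost: the binary lengths of all addresses and
contents involved; an oracle query is charged as a single step). -/
def Instr.cost (reg : ℕ → ℕ) : Instr → ℕ
  | const i c => 1 + i.size + c.size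
  | copy i j => 1 + i.size + j.size + (reg j).size
  | add i j k => 1 + i.size + j.size + k.size + (reg j).size + (reg k).size
  | sub i j k => 1 + i.size + j.size + k.size + (reg j).size + (reg k).size
  | load i j => 1 + i.size + j.size + (reg j).size + (reg (reg j)).size
  | store i j => 1 + i.size + j.size + (reg i).size + (reg j).size
  | jump _ => 1
  | jumpZero i _ => 1 + i.size + (reg i).size
  | print i => 1 + i.size + (reg i).size
  | emit => 1
  | oracleStore i j => 1 + i.size + j.size + (reg i).size + (reg j).size
  | query _ => 1

/-- Configurations. The last three components record the history of the run. -/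
structure Config where
  /-- program counter -/
  pc : ℕ
  /-- registers -/
  reg : ℕ → ℕ
  /-- oracle registers; content `0` means empty, content `s + 1` holds the symbol `s` -/
  orc : ℕ → ℕ
  /-- symbols printed since the last output -/
  buf : List ℕ
  /-- the words output so far, each with the time of its output -/
  outs : List (ℕ × List ℕ)
  /-- elapsed time -/
  time : ℕ
  /-- the largest size of an oracle call so far -/
  querySize : ℕ

/-- The size of the current oracle input: the number of consecutive non-empty oracle registers. -/
noncomputable def oracleSize (orc : ℕ → ℕ) : ℕ := sInf {i | orc i = 0}

/-- The word held by the consecutive non-empty oracle registers belongs to `L`. -/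
def OracleAccepts {k : ℕ} (L : Set (List (Fin k))) (orc : ℕ → ℕ) : Prop :=
  ∃ w ∈ L, orc w.length = 0 ∧ ∀ (i : ℕ) (h : i < w.length), orc i = (w[i] : ℕ) + 1

open Classical in
/-- The effect of an instruction, apart from its cost, with oracle `L`. -/
noncomputable def Instr.exec {k : ℕ} (L : Set (List (Fin k))) (c : Config) : Instr → Config
  | const i v => { c with pc := c.pc + 1, reg := Function.update c.reg i v }
  | copy i j => { c with pc := c.pc + 1, reg := Function.update c.reg i (c.reg j) }
  | add i j l => { c with pc := c.pc + 1, reg := Function.update c.reg i (c.reg j + c.reg l) }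
  | sub i j l => { c with pc := c.pc + 1, reg := Function.update c.reg i (c.reg j - c.reg l) }
  | load i j => { c with pc := c.pc + 1, reg := Function.update c.reg i (c.reg (c.reg j)) }
  | store i j => { c with pc := c.pc + 1, reg := Function.update c.reg (c.reg i) (c.reg j) }
  | jump l => { c with pc := l }
  | jumpZero i l => { c with pc := if c.reg i = 0 then l else c.pc + 1 }
  | print i => { c with pc := c.pc + 1, buf := c.buf ++ [c.reg i] }
  | emit => { c with pc := c.pc + 1, buf := [], outs := c.outs ++ [(c.time, c.buf)] }
  | oracleStore i j => { c with pc := c.pc + 1, orc := Function.update c.orc (c.reg i) (c.reg j) }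
  | query l =>
      { c with
        pc := if OracleAccepts L c.orc then l else c.pc + 1
        querySize := max c.querySize (oracleSize c.orc) }

/-- One step; a halted machine stays as it is. -/
noncomputable def step {k : ℕ} (P : Program) (L : Set (List (Fin k))) (c : Config) : Config :=
  match P[c.pc]? with
  | none => c
  | some ins => ins.exec L { c with time := c.time + ins.cost c.reg }

/-- The start configuration: register `0` holds the length of the input, registers `1, 2, …` hold
its symbols, and all other registers are `0`. -/
def start {k : ℕ} (x : List (Fin k)) : Config where
  pc := 0
  reg i := if i = 0 then x.length else ((x.map Fin.val)[i - 1]?).getD 0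
  orc _ := 0
  buf := []
  outs := []
  time := 0
  querySize := 0

/-- `c` is the final configuration of the run on input `x` with oracle `L`. -/
def HaltsWith {k m : ℕ} (P : Program) (L : Set (List (Fin m))) (x : List (Fin k)) (c : Config) :
    Prop :=
  P.length ≤ c.pc ∧ ∃ N : ℕ, (step P L)^[N] (start x) = c

end RAM

/-! ## Enumeration problems and enumeration classes -/

/-- An enumeration problem over the alphabet `Fin k`; only the values of `Sol` on `I` matter. -/
structure EnumProblem (k : ℕ) where
  /-- instances -/
  I : Set (List (Fin k))
  /-- solutions of an instance -/
  Sol : List (Fin k) → Set (List (Fin k))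
  /-- solutions have polynomially bounded length -/
  bound : ∃ p : Polynomial ℕ, ∀ x ∈ I, ∀ y ∈ Sol x, y.length ≤ p.eval x.length

/-- A class of decision problems (languages over finite alphabets). -/
abbrev DecisionClass := (k : ℕ) → Set (Set (List (Fin k)))

/-- The class P: the languages decided in polynomial time by a machine without oracle (all queries
to the empty oracle are answered negatively). The final content `1` of register `0` means
acceptance. -/
def PTime : DecisionClass := fun k =>
  {L | ∃ (P : RAM.Program) (p : Polynomial ℕ), ∀ x : List (Fin k), ∃ c : RAM.Config,
    RAM.HaltsWith P (∅ : Set (List (Fin 0))) x c ∧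
    c.time ≤ p.eval x.length ∧ (c.reg 0 = 1 ↔ x ∈ L)}

/-- On instance `x` of `E`, the machine `P` with oracle `L` terminates, prints exactly the solutions
without duplicates, has all delays (including pre- and postcomputation time) at most `d`, and makes
only oracle calls of size at most `d`. -/
def EnumeratesWithDelay {k m : ℕ} (P : RAM.Program) (L : Set (List (Fin m))) (E : EnumProblem k)
    (x : List (Fin k)) (d : ℕ) : Prop :=
  ∃ c : RAM.Config, RAM.HaltsWith P L x c ∧
    (c.outs.map Prod.snd).Nodup ∧
    {y | y ∈ c.outs.map Prod.snd} = (fun s : List (Fin k) => s.map Fin.val) '' E.Sol x ∧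
    List.IsChain (fun s t => t ≤ s + d) (0 :: (c.outs.map Prod.fst ++ [c.time])) ∧
    c.querySize ≤ d

/-- The class `Del C`: problems that some machine with an oracle from `C` enumerates with
polynomial delay and polynomially bounded oracle calls. -/
def Del (C : DecisionClass) (k : ℕ) : Set (EnumProblem k) :=
  {E | ∃ (m : ℕ) (L : Set (List (Fin m))), L ∈ C m ∧
    ∃ (P : RAM.Program) (p : Polynomial ℕ), ∀ x ∈ E.I,
      EnumeratesWithDelay P L E x (p.eval x.length)}

/-- The class `DelP`. -/
def DelP (k : ℕ) : Set (EnumProblem k) := Del PTime k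

/-! ## Encodings -/

namespace Encoding

/-- The alphabet. `0, 1`: bits; `2`: end marker; `3`: `⊤`; `4`: start of a proposition;
`5, 6, 7`: negation, disjunction, conjunction; `8` to `17`: the CTL operators. -/
abbrev Symb := Fin 18

open Classical in
/-- The truth value of a statement as a bit. -/
noncomputable def bit (p : Prop) : Symb := if p then 1 else 0

/-- Binary representation of a natural number, least significant bit first. -/
def nat (p : ℕ) : List Symb := p.bits.map fun b => if b then 1 else 0

def unary : PathQuant → UnaryTemp → Symb
  | .E, .X => 8
  | .A, .X => 9
  | .E, .F => 10
  | .A, .F => 11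
  | .E, .G => 12
  | .A, .G => 13

def binary : PathQuant → BinaryTemp → Symb
  | .E, .U => 14
  | .A, .U => 15
  | .E, .R => 16
  | .A, .R => 17

/-- Formulas in prefix notation. -/
def formula : CTL → List Symb
  | .top => [3]
  | .prop p => 4 :: (nat p ++ [2])
  | .neg φ => 5 :: formula φ
  | .or φ ψ => 6 :: (formula φ ++ formula ψ)
  | .and φ ψ => 7 :: (formula φ ++ formula ψ)
  | .un q t φ => unary q t :: formula φ
  | .bin q t φ ψ => binary q t :: (formula φ ++ formula ψ)

/-- Characteristic bit vector of a set of worlds. -/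
noncomputable def worlds {n : ℕ} (V : Set (Fin n)) : List Symb :=
  List.ofFn fun i => bit (i ∈ V)

/-- Adjacency matrix of a set of transitions, row by row. -/
noncomputable def rels {n : ℕ} (S : Set (Fin n × Fin n)) : List Symb :=
  (List.ofFn fun i => List.ofFn fun j => bit ((i, j) ∈ S)).flatten

/-- A list of propositions. -/
def label (l : List ℕ) : List Symb := (l.map fun p => 4 :: nat p).flatten ++ [2]

/-- An instance: the number of worlds in unary, the root, the adjacency matrix, for each world the
list of its propositions, and the formula. -/
noncomputable def inst {n : ℕ} (M : Kripke (Fin n)) (lab : Fin n → List ℕ) (φ : CTL) :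
    List Symb :=
  List.replicate n 1 ++ [0] ++ worlds {M.r} ++ rels {e | M.R e.1 e.2} ++
    (List.ofFn fun i => label (lab i)).flatten ++ formula φ

/-- A submodel of a given model, by its worlds and its transitions. -/
noncomputable def submodel {n : ℕ} (V : Set (Fin n)) (S : Set (Fin n × Fin n)) : List Symb :=
  worlds V ++ rels S

/-- The word `x` encodes the finite rooted Kripke model `M` together with the formula `φ`; the
propositions of each world may be listed in any order. -/
def Encodes (x : List Symb) {n : ℕ} (M : Kripke (Fin n)) (φ : CTL) : Prop :=
  M.Total ∧ ∃ lab : Fin n → List ℕ, (∀ w p, p ∈ M.η w ↔ p ∈ lab w) ∧ x = inst M lab φ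

theorem length_submodel_le {n : ℕ} {x : List Symb} {M : Kripke (Fin n)} {φ : CTL}
    (h : Encodes x M φ) (V : Set (Fin n)) (S : Set (Fin n × Fin n)) :
    (submodel V S).length ≤ x.length := by
  obtain ⟨-, lab, -, rfl⟩ := h
  simp only [submodel, inst, worlds, rels, List.length_append, List.length_ofFn,
    List.length_flatten, List.map_ofFn, Function.comp_def]
  omega

end Encoding

/-- Submodel enumeration for formulas that use only the connectors and operators in `O`: given a
finite rooted Kripke model `M` and such a formula `φ`, output all connected submodels of `M` that
satisfy `φ`. -/
noncomputable def ESubmodels (O : Set CTL.Op) : EnumProblem 18 where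
  I := {x | ∃ (n : ℕ) (M : Kripke (Fin n)), ∃ φ ∈ CTL.Fragment O, Encoding.Encodes x M φ}
  Sol x := {y | ∃ (n : ℕ) (M : Kripke (Fin n)), ∃ φ ∈ CTL.Fragment O, Encoding.Encodes x M φ ∧
    ∃ V S, M.IsSatisfyingSubmodel φ V S ∧ y = Encoding.submodel V S}
  bound := by
    refine ⟨Polynomial.X, ?_⟩
    rintro x - y ⟨n, M, φ, -, hx, V, S, -, rfl⟩
    simpa using Encoding.length_submodel_le hx V S

/-! Normal forms. The infinite paths of a structure are closed under tails and under splicing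
(`exists_splice`). Hence `AF` and `AG` are idempotent, and AF AG AF collapses to AG AF and AG AF AG
to AF AG. A prefix of operators, read from the outside, is therefore described by one of five states
(`Mode`), and only the empty prefix gives the state `id`.

Enumeration. The submodels are found by backtracking over transitions, each of which is deleted,
undecided or chosen. If it can be decided in polynomial time whether a node of the search tree has a
solution below it, then empty branches are never entered, every descent ends with an output after at
most n² decisions, and the delay is polynomial. Only undecided transitions whose source is already
reached by chosen ones are branched on. So all chosen transitions stay reachable from the root and
never conflict with connectedness, and once no such transition is left, the solution is determined
(`word_of_leaf`).

Deciding whether a solution exists is a game on the worlds. Every world may be given any non-empty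
set of successors that contains the chosen transitions F and avoids the deleted ones, so that it
lies in P. AF a is a reachability objective, AG a a safety objective, AF AG a reachability of a safe
region, and AG AF a a Büchi objective. All are solved by a greatest fixed point around attractors,
each stable after as many steps as there are worlds. `exists_strategy` turns a winning region into a
submodel by allowing at each world all transitions that make progress; `mem_attr_of_forall_paths`
gives the converse by an infinite path that avoids the attractor; `mem_region_iff` combines them.
The extension criteria (`Kripke.extend_iff`) come from the same construction with F empty, where
attractors are plain reachability; for AG AF a, finiteness yields a cycle by the pigeonhole
principle.

Implementation. As the machine solves the game itself, the empty oracle suffices. A small structured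
language is compiled to the random access machine with a time bound (`run_compile`). `test_spec`
identifies the test program with the fixed point, `loops_body` counts the rounds between outputs,
`init_spec` covers the decoding of the input, and `run_loops` converts rounds into time. -/

namespace CTL

/-! ### Normal forms of operator prefixes -/

/-- The normal forms of prefixes of `AF` and `AG` operators. -/
inductive Mode
  | id
  | F
  | G
  | FG
  | GF

namespace Mode

/-- The operators that a mode stands for, applied to a formula. -/
def wrap : Mode → CTL → CTL
  | id, ψ => ψ
  | F, ψ => ψ.AF
  | G, ψ => ψ.AG
  | FG, ψ => ψ.AG.AF
  | GF, ψ => ψ.AF.AG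

/-- The normal form of the prefix extended by `AF`. -/
def stepF : Mode → Mode
  | id => F
  | F => F
  | G => GF
  | FG => GF
  | GF => GF

/-- The normal form of the prefix extended by `AG`. -/
def stepG : Mode → Mode
  | id => G
  | F => FG
  | G => G
  | FG => FG
  | GF => FG

end Mode

end CTL

/-! ### Splicing of paths and the absorption laws -/

namespace Kripke

variable {W : Type u} {M : Kripke W}

theorem shift_mem_paths {π : ℕ → W} {w : W} (h : π ∈ M.paths w) (k : ℕ) :
    (fun i => π (k + i)) ∈ M.paths (π k) :=
  ⟨rfl, fun i => h.2 (k + i)⟩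

/-- Follow `π` for `k` steps and then `ρ`. This lets two nested path quantifiers be merged into a
single one. -/
theorem exists_splice {π ρ : ℕ → W} {w : W} (h : π ∈ M.paths w) (k : ℕ)
    (h' : ρ ∈ M.paths (π k)) :
    ∃ τ ∈ M.paths w, (∀ i ≤ k, τ i = π i) ∧ ∀ i, τ (k + i) = ρ i := by
  -- At the seam `i = 0` the first branch applies, and it agrees with `ρ` because `ρ` starts in `π
  -- k`.
  have key : ∀ i, (if k + i ≤ k then π (k + i) else ρ (k + i - k)) = ρ i := by
    intro i
    rcases Nat.eq_zero_or_pos i with rfl | hi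
    · simpa using h'.1.symm
    · rw [if_neg (by omega), Nat.add_sub_cancel_left]
  refine ⟨fun i => if i ≤ k then π i else ρ (i - k), ⟨by simpa using h.1, fun i => ?_⟩,
    fun i hi => if_pos hi, key⟩
  rcases lt_or_ge i k with hi | hi
  · simpa only [if_pos hi.le, if_pos (Nat.succ_le_of_lt hi)] using h.2 i
  · obtain ⟨j, rfl⟩ := Nat.exists_eq_add_of_le hi
    have h1 := key j
    have h2 := key (j + 1)
    simp only [← add_assoc] at h2
    simp only [h1, h2]
    exact h'.2 j

variable (M) in
theorem sat_AF_AF (ψ : CTL) (w : W) : M.Sat ψ.AF.AF w ↔ M.Sat ψ.AF w := by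
  refine ⟨fun h π hπ => ?_, fun h π hπ => ⟨0, ?_⟩⟩
  · obtain ⟨k, hk⟩ := h π hπ
    obtain ⟨j, hj⟩ := hk _ (shift_mem_paths hπ k)
    exact ⟨_, hj⟩
  · rw [hπ.1]
    exact h

variable (M) in
theorem sat_AG_AG (ψ : CTL) (w : W) : M.Sat ψ.AG.AG w ↔ M.Sat ψ.AG w := by
  refine ⟨fun h π hπ k => ?_, fun h π hπ k ρ hρ i => ?_⟩
  · simpa using h π hπ k _ (shift_mem_paths hπ k) 0
  · obtain ⟨τ, hτ, -, h2⟩ := exists_splice hπ k hρ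
    exact h2 i ▸ h τ hτ (k + i)

variable (M) in
-- Splice `π` up to `k` with `ρ` and take a position `j` where `AG ψ` holds. If `j ≤ k`, then `AG ψ`
-- persists up to position `k`; otherwise `j` lies on `ρ`.
theorem sat_AG_AF_AG (ψ : CTL) (w : W) : M.Sat ψ.AG.AF.AG w ↔ M.Sat ψ.AG.AF w := by
  refine ⟨fun h π hπ => ?_, fun h π hπ k ρ hρ => ?_⟩
  · exact h π hπ 0 π ⟨rfl, hπ.2⟩
  · obtain ⟨τ, hτ, h1, h2⟩ := exists_splice hπ k hρ
    obtain ⟨j, hj⟩ := h τ hτ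
    rcases le_total j k with hjk | hjk
    · refine ⟨0, ?_⟩
      obtain ⟨i, rfl⟩ := Nat.exists_eq_add_of_le hjk
      rw [← h2 0, add_zero]
      exact ((M.sat_AG_AG ψ _).2 hj) _ (shift_mem_paths hτ j) i
    · obtain ⟨i, rfl⟩ := Nat.exists_eq_add_of_le hjk
      exact ⟨i, h2 i ▸ hj⟩

variable (M) in
-- On the spliced path some position `j` satisfies AG AF ψ. If `j ≤ k`, then AF ψ holds at `π k` and
-- can be applied to `ρ`; otherwise `j` lies on `ρ`, and so does a later world satisfying ψ.
theorem sat_AF_AG_AF (ψ : CTL) (w : W) : M.Sat ψ.AF.AG.AF w ↔ M.Sat ψ.AF.AG w := by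
  refine ⟨fun h π hπ k ρ hρ => ?_, fun h π hπ => ⟨0, hπ.1.symm ▸ h⟩⟩
  obtain ⟨τ, hτ, h1, h2⟩ := exists_splice hπ k hρ
  obtain ⟨j, hj⟩ := h τ hτ
  rcases le_total j k with hjk | hjk
  · obtain ⟨i, rfl⟩ := Nat.exists_eq_add_of_le hjk
    have := hj _ (shift_mem_paths hτ j) i
    simp only [h1 _ le_rfl] at this
    exact this ρ hρ
  · obtain ⟨i, rfl⟩ := Nat.exists_eq_add_of_le hjk
    have := hj _ (shift_mem_paths hτ (k + i)) 0 _ (shift_mem_paths hτ (k + i))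
    obtain ⟨l, hl⟩ := this
    exact ⟨i + l, by rw [← h2, ← add_assoc]; exact hl⟩

theorem sat_AF_congr {φ ψ : CTL} (h : ∀ w, M.Sat φ w ↔ M.Sat ψ w) (w : W) :
    M.Sat φ.AF w ↔ M.Sat ψ.AF w :=
  forall₂_congr fun _ _ => exists_congr fun _ => h _

theorem sat_AG_congr {φ ψ : CTL} (h : ∀ w, M.Sat φ w ↔ M.Sat ψ w) (w : W) :
    M.Sat φ.AG w ↔ M.Sat ψ.AG w :=
  forall₂_congr fun _ _ => forall_congr' fun _ => h _

variable (M) in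
-- The new operator is absorbed at the inner end of the prefix. This is the order in which a formula
-- in prefix notation is read, so the mode can be computed by a left fold.
theorem sat_wrap_AF (m : CTL.Mode) (ψ : CTL) (w : W) :
    M.Sat (m.wrap ψ.AF) w ↔ M.Sat (m.stepF.wrap ψ) w := by
  cases m
  · exact Iff.rfl
  · exact M.sat_AF_AF ψ w
  · exact Iff.rfl
  · exact M.sat_AF_AG_AF ψ w
  · exact sat_AG_congr (M.sat_AF_AF ψ) w

variable (M) in
theorem sat_wrap_AG (m : CTL.Mode) (ψ : CTL) (w : W) :
    M.Sat (m.wrap ψ.AG) w ↔ M.Sat (m.stepG.wrap ψ) w := by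
  cases m
  · exact Iff.rfl
  · exact Iff.rfl
  · exact M.sat_AG_AG ψ w
  · exact sat_AF_congr (M.sat_AG_AG ψ) w
  · exact M.sat_AG_AF_AG ψ w

end Kripke

/-! ### Reduction of a formula to its normal form -/

namespace CTL

/-- Induction along the formulas built from `AF` and `AG`. -/
theorem fragment_induction {p : CTL → Prop} (atom : ∀ a : CTL, a.IsAtom → p a)
    (AF : ∀ φ : CTL, p φ → p φ.AF) (AG : ∀ φ : CTL, p φ → p φ.AG) (φ : CTL)
    (h : φ ∈ Fragment opsAFAG) : p φ := by
  induction φ with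
  | top => exact atom _ (Or.inl rfl)
  | prop q => exact atom _ (Or.inr ⟨q, rfl⟩)
  | neg φ _ => exact absurd (h (Set.mem_insert _ _)) (by simp [opsAFAG])
  | or φ ψ _ _ => exact absurd (h (Set.mem_insert _ _)) (by simp [opsAFAG])
  | and φ ψ _ _ => exact absurd (h (Set.mem_insert _ _)) (by simp [opsAFAG])
  | bin q t φ ψ _ _ => exact absurd (h (Set.mem_insert _ _)) (by simp [opsAFAG])
  | un q t φ ih =>
    have h1 := h (Set.mem_insert _ _)
    have h2 := ih fun o ho => h (Set.mem_insert_of_mem _ ho)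
    simp only [opsAFAG, Set.mem_insert_iff, Set.mem_singleton_iff, Op.un.injEq] at h1
    rcases h1 with ⟨rfl, rfl⟩ | ⟨rfl, rfl⟩
    · exact AF φ h2
    · exact AG φ h2

/-- The mode `m` stands for the operators already stripped off; it has to be universally quantified
for the induction. No step leads back to `.id`, so the mode `.id` survives only if no operator
occurs at all. -/
theorem exists_wrap_equivalent (φ : CTL) (h : φ ∈ Fragment opsAFAG) :
    ∀ m : Mode, ∃ m' : Mode, ∃ a : CTL, a.IsAtom ∧ ((m ≠ .id ∨ ¬ φ.IsAtom) → m' ≠ .id) ∧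
      Equivalent.{u} (m.wrap φ) (m'.wrap a) := by
  refine fragment_induction (p := fun φ => ∀ m : Mode, ∃ m' : Mode, ∃ a : CTL, a.IsAtom ∧
    ((m ≠ .id ∨ ¬ φ.IsAtom) → m' ≠ .id) ∧ Equivalent.{u} (m.wrap φ) (m'.wrap a)) ?_ ?_ ?_ φ h
  · exact fun a ha m => ⟨m, a, ha, by tauto, fun _ _ _ _ => Iff.rfl⟩
  · intro φ ih m
    obtain ⟨m', a, ha, h1, h2⟩ := ih m.stepF
    exact ⟨m', a, ha, fun _ => h1 (Or.inl (by cases m <;> simp [Mode.stepF])),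
      fun W M hM w => (M.sat_wrap_AF m φ w).trans (h2 W M hM w)⟩
  · intro φ ih m
    obtain ⟨m', a, ha, h1, h2⟩ := ih m.stepG
    exact ⟨m', a, ha, fun _ => h1 (Or.inl (by cases m <;> simp [Mode.stepG])),
      fun W M hM w => (M.sat_wrap_AG m φ w).trans (h2 W M hM w)⟩

theorem isAtom_or_equivalent (φ : CTL) (h : φ ∈ Fragment opsAFAG) : φ.IsAtom ∨
    ∃ a : CTL, a.IsAtom ∧
      (Equivalent.{u} φ a.AF ∨ Equivalent.{u} φ a.AG ∨
        Equivalent.{u} φ a.AG.AF ∨ Equivalent.{u} φ a.AF.AG) := by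
  by_cases hφ : φ.IsAtom
  · exact Or.inl hφ
  · obtain ⟨m, a, ha, h1, h2⟩ := exists_wrap_equivalent.{u} φ h .id
    refine Or.inr ⟨a, ha, ?_⟩
    cases m
    · exact absurd rfl (h1 (Or.inr hφ))
    · exact Or.inl h2
    · exact Or.inr (Or.inl h2)
    · exact Or.inr (Or.inr (Or.inl h2))
    · exact Or.inr (Or.inr (Or.inr h2))

end CTL

/-! ### Satisfaction in a substructure, expressed by paths of the ambient set -/

open CTL (Mode)

namespace Kripke

variable {W : Type u}

/-- Infinite `S`-paths inside `V`, starting in `w`. -/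
def relPaths (V : Set W) (S : Set (W × W)) (w : W) : Set (ℕ → W) :=
  {π | π 0 = w ∧ ∀ i, π i ∈ V ∧ (π i, π (i + 1)) ∈ S}

theorem shift_mem_relPaths {V : Set W} {S : Set (W × W)} {π : ℕ → W} {w : W}
    (h : π ∈ relPaths V S w) (k : ℕ) : (fun i => π (k + i)) ∈ relPaths V S (π k) :=
  ⟨rfl, fun i => h.2 (k + i)⟩

section sub

variable {M : Kripke W} {V : Set W} {S : Set (W × W)} {h : M.r ∈ V}

theorem coe_mem_relPaths {w : V} {π : ℕ → V} (hπ : π ∈ (M.sub V S h).paths w) :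
    (fun i => (π i : W)) ∈ relPaths V S w :=
  ⟨congrArg Subtype.val hπ.1, fun i => ⟨(π i).2, hπ.2 i⟩⟩

theorem exists_lift {w : V} {π : ℕ → W} (hπ : π ∈ relPaths V S w) :
    ∃ ρ ∈ (M.sub V S h).paths w, ∀ i, (ρ i : W) = π i :=
  ⟨fun i => ⟨π i, (hπ.2 i).1⟩, ⟨Subtype.ext hπ.1, fun i => (hπ.2 i).2⟩, fun _ => rfl⟩

theorem sat_sub_atom {a : CTL} (ha : a.IsAtom) (v : V) : (M.sub V S h).Sat a v ↔ M.Sat a v := by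
  obtain rfl | ⟨p, rfl⟩ := ha <;> exact Iff.rfl

variable {φ : CTL} {q : W → Prop}

/-- The predicate `q` lives on `W` and not on the subtype `V`. The result has again the shape of the
hypothesis `hq`, so nested operators are translated by iteration. -/
theorem sat_sub_AF (hq : ∀ v : V, (M.sub V S h).Sat φ v ↔ q v) (v : V) :
    (M.sub V S h).Sat φ.AF v ↔ ∀ π ∈ relPaths V S v, ∃ k, q (π k) := by
  refine ⟨fun H π hπ => ?_, fun H π hπ => ?_⟩
  · obtain ⟨ρ, h1, h2⟩ := exists_lift (h := h) hπ
    obtain ⟨k, hk⟩ := H ρ h1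
    exact ⟨k, h2 k ▸ (hq _).1 hk⟩
  · obtain ⟨k, hk⟩ := H _ (coe_mem_relPaths hπ)
    exact ⟨k, (hq _).2 hk⟩

theorem sat_sub_AG (hq : ∀ v : V, (M.sub V S h).Sat φ v ↔ q v) (v : V) :
    (M.sub V S h).Sat φ.AG v ↔ ∀ π ∈ relPaths V S v, ∀ k, q (π k) := by
  refine ⟨fun H π hπ k => ?_, fun H π hπ k => ?_⟩
  · obtain ⟨ρ, h1, h2⟩ := exists_lift (h := h) hπ
    exact h2 k ▸ (hq _).1 (H ρ h1 k)
  · exact (hq _).2 (H _ (coe_mem_relPaths hπ) k)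

theorem sat_sub_EF (hq : ∀ v : V, (M.sub V S h).Sat φ v ↔ q v) (v : V) :
    (M.sub V S h).Sat φ.EF v ↔ ∃ π ∈ relPaths V S v, ∃ k, q (π k) := by
  refine ⟨fun ⟨π, hπ, k, hk⟩ => ⟨_, coe_mem_relPaths hπ, k, (hq _).1 hk⟩, fun ⟨π, hπ, k, hk⟩ => ?_⟩
  obtain ⟨ρ, h1, h2⟩ := exists_lift (h := h) hπ
  exact ⟨ρ, h1, k, (hq _).2 ((h2 k).symm ▸ hk)⟩

theorem sat_sub_EG (hq : ∀ v : V, (M.sub V S h).Sat φ v ↔ q v) (v : V) :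
    (M.sub V S h).Sat φ.EG v ↔ ∃ π ∈ relPaths V S v, ∀ k, q (π k) := by
  refine ⟨fun ⟨π, hπ, hk⟩ => ⟨_, coe_mem_relPaths hπ, fun k => (hq _).1 (hk k)⟩,
    fun ⟨π, hπ, hk⟩ => ?_⟩
  obtain ⟨ρ, h1, h2⟩ := exists_lift (h := h) hπ
  exact ⟨ρ, h1, fun k => (hq _).2 ((h2 k).symm ▸ hk k)⟩

/-- The meaning of `m.wrap a` in a substructure, where `A` is the set of worlds satisfying `a`. -/
def Holds (V : Set W) (S : Set (W × W)) (A : Set W) (w : W) : Mode → Prop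
  | .id => w ∈ A
  | .F => ∀ π ∈ relPaths V S w, ∃ k, π k ∈ A
  | .G => ∀ π ∈ relPaths V S w, ∀ k, π k ∈ A
  | .FG => ∀ π ∈ relPaths V S w, ∃ k, ∀ ρ ∈ relPaths V S (π k), ∀ l, ρ l ∈ A
  | .GF => ∀ π ∈ relPaths V S w, ∀ k, ∀ ρ ∈ relPaths V S (π k), ∃ l, ρ l ∈ A

theorem sat_sub_wrap {a : CTL} (ha : a.IsAtom) (m : Mode) (v : V) :
    (M.sub V S h).Sat (m.wrap a) v ↔ Holds V S {w | M.Sat a w} v m := by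
  have h0 := sat_sub_atom (M := M) (S := S) (h := h) ha
  cases m
  · exact h0 v
  · exact sat_sub_AF h0 v
  · exact sat_sub_AG h0 v
  · exact sat_sub_AF (q := fun w => ∀ π ∈ relPaths V S w, ∀ k, M.Sat a (π k)) (sat_sub_AG h0) v
  · exact sat_sub_AG (q := fun w => ∀ π ∈ relPaths V S w, ∃ k, M.Sat a (π k)) (sat_sub_AF h0) v

end sub

/-! ### Submodels between two relations -/

theorem Total.exists_path {M : Kripke W} (hM : M.Total) (w : W) : ∃ π, π ∈ M.paths w := by
  choose f hf using hM
  exact ⟨fun i => f^[i] w, rfl, fun i => by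
    simp only [Function.iterate_succ_apply']
    exact hf _⟩

/-- Connectedness asks for infinite paths; totality continues a finite path beyond its end. -/
theorem Total.exists_path_through {M : Kripke W} (hM : M.Total) {v w : W}
    (h : Relation.ReflTransGen M.R v w) : ∃ π ∈ M.paths v, ∃ i, π i = w := by
  induction h using Relation.ReflTransGen.head_induction_on with
  | refl =>
    obtain ⟨π, hπ⟩ := hM.exists_path w
    exact ⟨π, hπ, 0, hπ.1⟩
  | @head a b h _ ih =>
    obtain ⟨π, hπ, i, hi⟩ := ih
    refine ⟨fun j => Nat.casesOn j a π, ⟨rfl, fun j => ?_⟩, i + 1, hi⟩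
    cases j
    · simpa [hπ.1] using h
    · exact hπ.2 _

theorem reach_of_mem_paths {M : Kripke W} {w : W} {π : ℕ → W} (h : π ∈ M.paths w) (i : ℕ) :
    Relation.ReflTransGen M.R w (π i) := by
  induction i with
  | zero => rw [h.1]
  | succ i ih => exact ih.tail (h.2 i)

theorem IsConnectedSubmodel.exists_relPath {M : Kripke W} {V : Set W} {S : Set (W × W)}
    (h : M.IsConnectedSubmodel V S) {v : W} (hv : v ∈ V) : ∃ π, π ∈ relPaths V S v := by
  obtain ⟨π, hπ⟩ := h.total.exists_path ⟨v, hv⟩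
  exact ⟨_, coe_mem_relPaths hπ⟩

theorem IsConnectedSubmodel.induction {M : Kripke W} {V : Set W} {S : Set (W × W)}
    (h : M.IsConnectedSubmodel V S) {p : W → Prop} (h0 : p M.r)
    (h1 : ∀ v w, (v, w) ∈ S → p v → p w) {w : W} (hw : w ∈ V) : p w := by
  obtain ⟨π, hπ, i, hi⟩ := h.connected ⟨w, hw⟩
  have : ∀ i, p (π i) := by
    intro i
    induction i with
    | zero => rw [hπ.1]; exact h0
    | succ i ih => exact h1 _ _ (hπ.2 i) ih
  simpa [hi] using this i

/-- Cutting a relation down to the part reachable from the root makes it connected, and successors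
are needed at the reachable worlds only. -/
theorem isConnectedSubmodel_of_reach (M : Kripke W) {S₀ : W → W → Prop}
    (hR : ∀ v w, S₀ v w → M.R v w)
    (ht : ∀ v, Relation.ReflTransGen S₀ M.r v → ∃ w, S₀ v w) :
    M.IsConnectedSubmodel {v | Relation.ReflTransGen S₀ M.r v}
      {e | Relation.ReflTransGen S₀ M.r e.1 ∧ S₀ e.1 e.2} := by
  have hr : M.r ∈ {v | Relation.ReflTransGen S₀ M.r v} := Relation.ReflTransGen.refl
  have htot : (M.sub _ {e | Relation.ReflTransGen S₀ M.r e.1 ∧ S₀ e.1 e.2} hr).Total := by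
    rintro ⟨v, hv⟩
    obtain ⟨w, hw⟩ := ht v hv
    exact ⟨⟨w, hv.tail hw⟩, hv, hw⟩
  refine ⟨hr, fun a b h => hR _ _ h.2, fun a b h => ⟨h.1, h.1.tail h.2⟩, htot, ?_⟩
  rintro ⟨w, hw⟩
  apply htot.exists_path_through
  change Relation.ReflTransGen S₀ M.r w at hw
  induction hw with
  | refl => exact Relation.ReflTransGen.refl
  | tail h1 h2 ih => exact ih.tail ⟨h1, h2⟩

/-! ### The game of completing a partial submodel -/

section game

variable (P F : W → W → Prop)

/-- The worlds that can be given successors in `X`: by some transition in `P`, and containing all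
transitions in `F`. -/
def dia (X : Set W) : Set W := {v | (∃ w, P v w ∧ w ∈ X) ∧ ∀ w, F v w → w ∈ X}

/-- The worlds from which `T` can be forced within `k` transitions. -/
def attr (T : Set W) : ℕ → Set W
  | 0 => T
  | k + 1 => attr T k ∪ dia P F (attr T k)

variable {P F}

/-- Both clauses of `dia` ask for membership in the set, so it may grow. Everything about fixed
points below rests on this. -/
theorem dia_mono {X Y : Set W} (h : X ⊆ Y) : dia P F X ⊆ dia P F Y :=
  fun _ ⟨⟨w, h1, h2⟩, h3⟩ => ⟨⟨w, h1, h h2⟩, fun w hw => h (h3 w hw)⟩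

theorem attr_mono_right (T : Set W) : Monotone (attr P F T) :=
  monotone_nat_of_le_succ fun _ => Set.subset_union_left

theorem attr_mono_left {T T' : Set W} (h : T ⊆ T') (k : ℕ) : attr P F T k ⊆ attr P F T' k := by
  induction k with
  | zero => exact h
  | succ k ih => exact Set.union_subset_union ih (dia_mono ih)

/-- If `r` is in the attractor of `T`, and one can stay in `X` from `X` and move to `X` from `T`,
then there is a submodel between `F` and `P` all of whose paths behave accordingly. -/
theorem exists_strategy (M : Kripke W) (hFP : ∀ v w, F v w → P v w) (hP : ∀ v w, P v w → M.R v w)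
    (hF : ∀ v w, F v w → Relation.ReflTransGen F M.r v) {X T : Set W} (hX : X ⊆ dia P F X)
    (hT : T ⊆ dia P F X) {k : ℕ} (hr : M.r ∈ attr P F T k) :
    ∃ V S, M.IsConnectedSubmodel V S ∧ (∀ v w, F v w → (v, w) ∈ S) ∧
      (∀ v w, (v, w) ∈ S → P v w) ∧ (∀ v ∈ V, v ∈ X ∨ ∃ k, v ∈ attr P F T k) ∧
      (∀ v w, (v, w) ∈ S → v ∈ T → w ∈ X) ∧
      ∀ k, ∀ v ∈ attr P F T k, ∀ π ∈ relPaths V S v, ∃ j, π j ∈ T := by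
  set Y := attr P F T
  have hY : Monotone Y := attr_mono_right T
  -- The transitions that make progress: from a world of rank `k + 1` into stage `k`, and from `T`
  -- or from outside the attractor into `X`.
  let C : W → W → Prop := fun v w =>
    (∀ k, v ∈ Y (k + 1) → v ∉ Y k → w ∈ Y k) ∧ ((v ∈ T ∨ ∀ k, v ∉ Y k) → w ∈ X)
  let U : Set W := {v | v ∈ X ∨ ∃ k, v ∈ Y k}
  -- The two clauses of `dia` say exactly that some `P`-successor makes progress and that all
  -- `F`-successors do.
  have key : ∀ v ∈ U, (∃ w, P v w ∧ w ∈ U ∧ C v w) ∧ ∀ w, F v w → w ∈ U ∧ C v w := by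
    intro v hv
    by_cases h : v ∈ T ∨ ∀ k, v ∉ Y k
    · have hd : v ∈ dia P F X := by
        rcases h with h | h
        · exact hT h
        · rcases hv with hv | ⟨k, hk⟩
          · exact hX hv
          · exact absurd hk (h k)
      have hC : ∀ w, w ∈ X → w ∈ U ∧ C v w := by
        refine fun w hw => ⟨Or.inl hw, fun k h1 h2 => ?_, fun _ => hw⟩
        rcases h with h | h
        · exact absurd (hY (Nat.zero_le k) h) h2
        · exact absurd h1 (h _)
      obtain ⟨⟨w, hw, hwX⟩, h2⟩ := hd
      exact ⟨⟨w, hw, hC w hwX⟩, fun w hw => hC w (h2 w hw)⟩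
    · push Not at h
      obtain ⟨hvT, hk⟩ := h
      classical
      -- The least stage that contains `v` is its rank. It is not `0`, since stage `0` is `T`.
      have hfind := Nat.find_spec hk
      have hmin := fun j => Nat.find_min hk (m := j)
      set k := Nat.find hk
      obtain _ | k := k
      · exact absurd hfind hvT
      have hkk : v ∉ Y k := hmin k (Nat.lt_succ_self k)
      have hd : v ∈ dia P F (Y k) := hfind.resolve_left hkk
      have hC : ∀ w, w ∈ Y k → w ∈ U ∧ C v w := by
        refine fun w hw => ⟨Or.inr ⟨k, hw⟩, fun l h1 h2 => ?_, fun h => ?_⟩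
        · rcases lt_trichotomy l k with hl | rfl | hl
          · exact absurd (hY (Nat.succ_le_of_lt hl) h1) hkk
          · exact hw
          · exact absurd (hY (Nat.succ_le_of_lt hl) hfind) h2
        · rcases h with h | h
          · exact absurd h hvT
          · exact absurd hfind (h _)
      obtain ⟨⟨w, hw, hwX⟩, h2⟩ := hd
      exact ⟨⟨w, hw, hC w hwX⟩, fun w hw => hC w (h2 w hw)⟩
  -- All transitions that make progress are kept, not one per world; so the transitions of `F` are
  -- included without further choice.
  let S₀ : W → W → Prop := fun v w => v ∈ U ∧ P v w ∧ w ∈ U ∧ C v w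
  have hrU : M.r ∈ U := Or.inr ⟨k, hr⟩
  have hreachU : ∀ v, Relation.ReflTransGen S₀ M.r v → v ∈ U := by
    intro v hv
    induction hv with
    | refl => exact hrU
    | tail _ h _ => exact h.2.2.1
  -- Passing to the reachable part must not lose transitions of `F`. It does not, because their
  -- sources are reachable by `F` itself.
  have hFreach : ∀ v, Relation.ReflTransGen F M.r v → Relation.ReflTransGen S₀ M.r v := by
    intro v hv
    induction hv with
    | refl => exact Relation.ReflTransGen.refl
    | tail _ h ih =>
      have hb := hreachU _ ih
      exact ih.tail ⟨hb, hFP _ _ h, (key _ hb).2 _ h⟩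
  have hconn := isConnectedSubmodel_of_reach M (S₀ := S₀) (fun v w h => hP _ _ h.2.1) (by
    intro v hv
    have := hreachU v hv
    obtain ⟨w, h1, h2⟩ := (key v this).1
    exact ⟨w, this, h1, h2⟩)
  refine ⟨_, _, hconn, ?_, fun v w h => h.2.2.1, hreachU, fun v w h hv => h.2.2.2.2.2 (Or.inl hv),
    ?_⟩
  · intro v w h
    have hv := hFreach v (hF v w h)
    have := hreachU v hv
    exact ⟨hv, this, hFP _ _ h, (key v this).2 w h⟩
  · intro k
    induction k with
    | zero => exact fun v hv π hπ => ⟨0, by rw [hπ.1]; exact hv⟩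
    | succ k ih =>
      intro v hv π hπ
      by_cases hvk : v ∈ Y k
      · exact ih v hvk π hπ
      · have h1 : π (0 + 1) ∈ Y k := by
          refine (hπ.2 0).2.2.2.2.2.1 k ?_ ?_
          · simpa only [hπ.1] using hv
          · simpa only [hπ.1] using hvk
        obtain ⟨j, hj⟩ := ih _ h1 _ (shift_mem_relPaths hπ (0 + 1))
        exact ⟨_, hj⟩

/-- If stage `n` were not stable, then no earlier stage would be, so each of the `n + 1` inclusions
would be strict and stage `n + 1` would have more elements than `W`. -/
theorem eq_succ_of_card_le [Finite W] {f : ℕ → Set W} (hf : Monotone f)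
    (hs : ∀ k, f k = f (k + 1) → f (k + 1) = f (k + 2)) {n : ℕ} (hn : Nat.card W ≤ n) :
    f n = f (n + 1) := by
  by_contra hne
  have h1 : ∀ j k, f k = f (k + 1) → f (k + j) = f (k + j + 1) := by
    intro j k hk
    induction j with
    | zero => exact hk
    | succ j ih => exact hs _ ih
  have h2 : ∀ k ≤ n, f k ⊂ f (k + 1) := by
    intro k hk
    refine (hf (Nat.le_succ k)).ssubset_of_ne fun h => hne ?_
    obtain ⟨j, rfl⟩ := Nat.exists_eq_add_of_le hk
    exact h1 j k h
  have h3 : ∀ k ≤ n + 1, k ≤ (f k).ncard := by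
    intro k hk
    induction k with
    | zero => exact Nat.zero_le _
    | succ k ih =>
      have := Set.ncard_lt_ncard (h2 k (by omega)) (Set.toFinite _)
      have := ih (by omega)
      omega
  have h4 := h3 (n + 1) le_rfl
  have h5 := Set.ncard_le_card (f (n + 1))
  omega

theorem dia_attr_subset [Finite W] {n : ℕ} (hn : Nat.card W ≤ n) (T : Set W) :
    dia P F (attr P F T n) ⊆ attr P F T n := by
  have := eq_succ_of_card_le (attr_mono_right (P := P) (F := F) T) (fun k hk => ?_) hn
  · rw [this]
    rw [← this]
    conv_rhs => rw [this]
    exact Set.subset_union_right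
  · change _ = attr P F T (k + 1) ∪ dia P F (attr P F T (k + 1))
    rw [← hk]
    exact hk

variable (P F) in
/-- `n` rounds of an iteration from above, each followed by `n₁` attractor steps, and a last round
followed by `n₃` attractor steps. -/
def region (A B : Set W) (n n₁ n₃ : ℕ) : Set W :=
  attr P F (A ∩ dia P F ((fun X => attr P F (B ∩ dia P F X) n₁)^[n] Set.univ)) n₃

/-- The iterates from above decrease; their complements increase and become stable by
`eq_succ_of_card_le`. -/
theorem iterate_fixed [Finite W] {n : ℕ} (hn : Nat.card W ≤ n) {f : Set W → Set W}
    (hf : Monotone f) : f (f^[n] Set.univ) = f^[n] Set.univ := by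
  have hm : Antitone fun k => f^[k] Set.univ := by
    refine antitone_nat_of_succ_le fun k => ?_
    induction k with
    | zero => exact Set.subset_univ _
    | succ k ih =>
      rw [Function.iterate_succ_apply'] at ih ⊢
      rw [Function.iterate_succ_apply']
      exact hf ih
  have := eq_succ_of_card_le (f := fun k => (f^[k] Set.univ)ᶜ)
    (fun i j h => Set.compl_subset_compl.2 (hm h)) (fun k hk => ?_) hn
  · rw [compl_inj_iff, Function.iterate_succ_apply'] at this
    exact this.symm
  · rw [compl_inj_iff] at hk ⊢
    rw [Function.iterate_succ_apply', Function.iterate_succ_apply' f (k + 1), ← hk]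

theorem subset_iterate {f : Set W → Set W} (hf : Monotone f) {V : Set W} (hV : V ⊆ f V) (n : ℕ) :
    V ⊆ f^[n] Set.univ := by
  induction n with
  | zero => exact Set.subset_univ _
  | succ n ih =>
    rw [Function.iterate_succ_apply']
    exact hV.trans (hf ih)

/-- The iteration from above is only restricted to `A` if the operator `AG` occurs. -/
def Mode.base (A : Set W) : Mode → Set W
  | .id => Set.univ
  | .F => Set.univ
  | .G => A
  | .FG => A
  | .GF => A

/-- The number of attractor steps in each round of the iteration from above. -/
def Mode.inner (n : ℕ) : Mode → ℕ
  | .id => 0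
  | .F => 0
  | .G => 0
  | .FG => 0
  | .GF => n

/-- The number of attractor steps in the last round. -/
def Mode.outer (n : ℕ) : Mode → ℕ
  | .id => 0
  | .F => n
  | .G => 0
  | .FG => n
  | .GF => n

/-- If all `S`-successors of a world of `V` were in the attractor, so would be the world, as `S`
lies between `F` and `P` and the attractor is closed under `dia`. Hence from a world of `V` outside
the attractor an infinite `S`-path stays outside and in particular misses `T`. -/
theorem mem_attr_of_forall_paths [Finite W] {n : ℕ} (hn : Nat.card W ≤ n) {V : Set W}
    {S : Set (W × W)} (hSV : ∀ v ∈ V, ∃ w ∈ V, (v, w) ∈ S) (hS : ∀ v w, (v, w) ∈ S → w ∈ V)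
    (hFS : ∀ v w, F v w → (v, w) ∈ S) (hSP : ∀ v w, (v, w) ∈ S → P v w) {T : Set W} {v : W}
    (hv : v ∈ V) (h : ∀ π ∈ relPaths V S v, ∃ k, π k ∈ T) : v ∈ attr P F T n := by
  by_contra hvn
  have key : ∀ v : {v // v ∈ V ∧ v ∉ attr P F T n}, ∃ w : {v // v ∈ V ∧ v ∉ attr P F T n},
      ((v : W), (w : W)) ∈ S := by
    rintro ⟨v, hv, hvn⟩
    have hvd : v ∉ dia P F (attr P F T n) := fun h => hvn (dia_attr_subset hn T h)
    by_contra hcon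
    push Not at hcon
    have hall : ∀ w, (v, w) ∈ S → w ∈ attr P F T n := by
      intro w hw
      by_contra hwn
      exact hcon ⟨w, hS v w hw, hwn⟩ hw
    obtain ⟨w, -, hw⟩ := hSV v hv
    exact hvd ⟨⟨w, hSP _ _ hw, hall w hw⟩, fun w hw => hall w (hFS _ _ hw)⟩
  choose f hf using key
  let π : ℕ → {v // v ∈ V ∧ v ∉ attr P F T n} := fun i => f^[i] ⟨v, hv, hvn⟩
  obtain ⟨k, hk⟩ := h (fun i => π i) ⟨rfl, fun i => ⟨(π i).2.1, by
    simp only [π, Function.iterate_succ_apply']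
    exact hf _⟩⟩
  exact (π k).2.2 (attr_mono_right T (Nat.zero_le n) hk)

/-- The game is determined by a fixed point. For soundness, the iteration from above has reached a
fixed set `X`, and `exists_strategy` builds the submodel. For completeness, the worlds of a given
submodel (for `G` and `FG`, those from which all paths stay in `A`) form a post-fixed point and so
survive all iterations, by `subset_iterate`. The hypothesis `hF` is what keeps `F` inside the part
reachable from the root. -/
theorem mem_region_iff [Finite W] (M : Kripke W) (hFP : ∀ v w, F v w → P v w)
    (hP : ∀ v w, P v w → M.R v w) (hF : ∀ v w, F v w → Relation.ReflTransGen F M.r v) (A : Set W)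
    (m : Mode) {n : ℕ} (hn : Nat.card W ≤ n) :
    M.r ∈ region P F A (Mode.base A m) n (Mode.inner n m) (Mode.outer n m) ↔
      ∃ V S, M.IsConnectedSubmodel V S ∧ Holds V S A M.r m ∧ (∀ v w, F v w → (v, w) ∈ S) ∧
        ∀ v w, (v, w) ∈ S → P v w := by
  have hf : Monotone fun X => attr P F (Mode.base A m ∩ dia P F X) (Mode.inner n m) :=
    fun X Y h => attr_mono_left (Set.inter_subset_inter_right _ (dia_mono h)) _
  have hfix := iterate_fixed hn hf
  unfold region
  constructor
  · intro hr
    set X := (fun X => attr P F (Mode.base A m ∩ dia P F X) (Mode.inner n m))^[n] Set.univ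
    -- `X` is an attractor by the fixed point equation. Its stage `0` lies in `dia P F X` by
    -- definition, and each later stage adds only `dia` of a stage contained in `X`.
    have hXd : X ⊆ dia P F X := by
      have : ∀ k, k ≤ Mode.inner n m → attr P F (Mode.base A m ∩ dia P F X) k ⊆ dia P F X := by
        intro k hk
        induction k with
        | zero => exact Set.inter_subset_right
        | succ k ih =>
          refine Set.union_subset (ih (by omega)) (dia_mono ?_)
          exact (attr_mono_right _ (by omega)).trans hfix.le
      exact hfix.ge.trans (this _ le_rfl)
    obtain ⟨V, S, hc, hFS, hSP, hV, hTX, hatt⟩ :=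
      exists_strategy M hFP hP hF hXd Set.inter_subset_right hr
    refine ⟨V, S, hc, ?_, hFS, hSP⟩
    cases m with
    | id => exact hr.1
    | F =>
      intro π hπ
      obtain ⟨k, hk⟩ := hatt _ _ hr π hπ
      exact ⟨k, hk.1⟩
    | G =>
      -- Without inner attractor steps the fixed point equation says that the target is `X` itself,
      -- so paths that reach `X` never leave it and stay in `A`.
      have hXT : A ∩ dia P F X = X := hfix
      rw [hXT] at hTX
      intro π hπ k
      have : π k ∈ X := by
        induction k with
        | zero => rw [hπ.1]; exact hfix.le hr
        | succ k ih => exact hTX _ _ (hπ.2 k).2 ih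
      exact (hfix.ge this).1
    | FG =>
      have hXT : A ∩ dia P F X = X := hfix
      rw [hXT] at hTX
      intro π hπ
      obtain ⟨k, hk⟩ := hatt _ _ hr π hπ
      refine ⟨k, fun ρ hρ l => ?_⟩
      have : ρ l ∈ X := by
        induction l with
        | zero => rw [hρ.1]; exact hXT.le hk
        | succ l ih => exact hTX _ _ (hρ.2 l).2 ih
      exact (hfix.ge this).1
    | GF =>
      intro π hπ k ρ hρ
      obtain ⟨j, hj⟩ : ∃ j, π k ∈ attr P F (A ∩ dia P F X) j := by
        rcases hV _ (hπ.2 k).1 with h | h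
        -- For this mode `X` is the attractor of the target after `n` steps, so every world of `V`
        -- is in some stage and the target is forced again and again.
        · exact ⟨n, hfix.ge h⟩
        · exact h
      obtain ⟨l, hl⟩ := hatt _ _ hj ρ hρ
      exact ⟨l, hl.1⟩
  · rintro ⟨V, S, hc, hH, hFS, hSP⟩
    have hSV : ∀ v ∈ V, ∃ w ∈ V, (v, w) ∈ S := by
      intro v hv
      obtain ⟨w, hw⟩ := hc.total ⟨v, hv⟩
      exact ⟨w, w.2, hw⟩
    have hS : ∀ v w, (v, w) ∈ S → w ∈ V := fun v w h => (hc.rel_on v w h).2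
    have hd : ∀ {V' : Set W}, V' ⊆ V → (∀ v w, (v, w) ∈ S → v ∈ V' → w ∈ V') →
        V' ⊆ dia P F V' := by
      intro V' h1 h2 v hv
      obtain ⟨w, -, hw⟩ := hSV v (h1 hv)
      exact ⟨⟨w, hSP _ _ hw, h2 v w hw hv⟩, fun w hw => h2 v w (hFS _ _ hw) hv⟩
    have hVd : V ⊆ dia P F V := hd subset_rfl fun v w h _ => hS v w h
    have hmem : ∀ {T : Set W} {v : W}, v ∈ V → (∀ π ∈ relPaths V S v, ∃ k, π k ∈ T) →
      v ∈ attr P F T n := fun h => mem_attr_of_forall_paths hn hSV hS hFS hSP h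
    -- The safe worlds of the given submodel. They are closed under `S`: a path from a successor of
    -- `v` is prolonged by `v` at its front.
    let V' := {v | v ∈ V ∧ ∀ π ∈ relPaths V S v, ∀ k, π k ∈ A}
    have hV' : V' ⊆ dia P F V' := by
      refine hd (fun v hv => hv.1) fun v w h hv => ⟨hS v w h, fun π hπ k => ?_⟩
      refine hv.2 (fun j => Nat.casesOn j v π) ⟨rfl, fun j => ?_⟩ (k + 1)
      cases j
      · exact ⟨hv.1, by simpa [hπ.1] using h⟩
      · exact hπ.2 _
    have hA : V' ⊆ A := by
      intro v hv
      obtain ⟨π, hπ⟩ := hc.exists_relPath hv.1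
      exact hπ.1 ▸ hv.2 π hπ 0
    cases m with
    | id =>
      have hVX := subset_iterate hf (V := V) (fun v hv => ⟨trivial, hVd hv⟩) n
      exact ⟨hH, dia_mono hVX (hVd hc.root_mem)⟩
    | F =>
      have hVX := subset_iterate hf (V := V) (fun v hv => ⟨trivial, hVd hv⟩) n
      refine hmem hc.root_mem fun π hπ => ?_
      obtain ⟨k, hk⟩ := hH π hπ
      exact ⟨k, hk, dia_mono hVX (hVd (hπ.2 k).1)⟩
    | G =>
      have hVX := subset_iterate hf (V := V') (fun v hv => ⟨hA hv, hV' hv⟩) n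
      have hr : M.r ∈ V' := ⟨hc.root_mem, hH⟩
      exact ⟨hA hr, dia_mono hVX (hV' hr)⟩
    | FG =>
      have hVX := subset_iterate hf (V := V') (fun v hv => ⟨hA hv, hV' hv⟩) n
      refine hmem hc.root_mem fun π hπ => ?_
      obtain ⟨k, hk⟩ := hH π hπ
      have hr : π k ∈ V' := ⟨(hπ.2 k).1, hk⟩
      exact ⟨k, hA hr, dia_mono hVX (hV' hr)⟩
    | GF =>
      -- Every world of `V` lies on a path from the root, so the outer `AG` applies to it.
      have hAF : ∀ v ∈ V, ∀ π ∈ relPaths V S v, ∃ k, π k ∈ A := by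
        intro v hv π hπ
        obtain ⟨ρ, hρ, i, hi⟩ := hc.connected ⟨v, hv⟩
        refine hH _ (coe_mem_relPaths hρ) i π ?_
        simpa only [hi] using hπ
      have hVX := subset_iterate hf (V := V) (fun v hv => hmem hv fun π hπ => by
        obtain ⟨k, hk⟩ := hAF v hv π hπ
        exact ⟨k, hk, hVd (hπ.2 k).1⟩) n
      refine hmem hc.root_mem fun π hπ => ?_
      obtain ⟨k, hk⟩ := hAF _ hc.root_mem π hπ
      exact ⟨k, hk, dia_mono hVX (hVd (hπ.2 k).1)⟩

end game

end Kripke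

/-! ### Extending a set of deletions to a satisfying submodel -/

open CTL (Mode)

namespace Kripke

variable {W : Type u}

/-- The transitions of `M - D` as a relation on all worlds. -/
def keptRel (M : Kripke W) (D : Deletions W) (v w : W) : Prop :=
  v ∈ M.keptWorlds D ∧ w ∈ M.keptWorlds D ∧ (v, w) ∈ M.keptRels D

/-- A submodel is what remains after deleting the complements of its worlds and transitions. Worlds
need no separate condition: by totality each has an outgoing transition, which witnesses that it is
not deleted by `D`. -/
theorem extendSubmodel_wrap_iff (M : Kripke W) (D : Deletions W) {a : CTL} (ha : a.IsAtom)
    (m : Mode) : M.ExtendSubmodel (m.wrap a) D ↔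
      ∃ V S, M.IsConnectedSubmodel V S ∧ Holds V S {w | M.Sat a w} M.r m ∧
        ∀ v w, (v, w) ∈ S → M.keptRel D v w := by
  constructor
  · rintro ⟨D₂, h1, h2, h3, h4⟩
    refine ⟨_, _, h3, (sat_sub_wrap ha m _).1 h4, fun v w h => ?_⟩
    obtain ⟨hv, hw⟩ := h3.rel_on v w h
    exact ⟨fun h => hv (h1 h), fun h => hw (h1 h), h.1, fun h' => h.2 (h2 h')⟩
  · rintro ⟨V, S, h3, h4, h5⟩
    refine ⟨⟨Vᶜ, Sᶜ⟩, fun v hv hvV => ?_, fun e he heS => (h5 e.1 e.2 heS).2.2.2 he, ?_⟩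
    · obtain ⟨w, hw⟩ := h3.total ⟨v, hvV⟩
      exact (h5 _ _ hw).1 hv
    · have e1 : M.keptWorlds ⟨Vᶜ, Sᶜ⟩ = V := compl_compl V
      have e2 : M.keptRels ⟨Vᶜ, Sᶜ⟩ = S := by
        ext e
        simp only [keptRels, Set.mem_sdiff, Set.mem_ofPred_eq, Set.mem_compl_iff, not_not]
        exact ⟨fun h => h.2, fun h => ⟨h3.rel_subset _ _ h, h⟩⟩
      rw [e1, e2]
      exact ⟨h3, (sat_sub_wrap ha m _).2 h4⟩

theorem relPaths_subset_of_rel {M : Kripke W} {D : Deletions W} {V : Set W} {S : Set (W × W)}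
    (h : ∀ v w, (v, w) ∈ S → M.keptRel D v w) (w : W) :
    relPaths V S w ⊆ relPaths (M.keptWorlds D) (M.keptRels D) w :=
  fun _ hπ => ⟨hπ.1, fun i => ⟨(h _ _ (hπ.2 i).2).1, (h _ _ (hπ.2 i).2).2.2⟩⟩

theorem keptRel_of_mem_relPaths {M : Kripke W} {D : Deletions W} {π : ℕ → W} {w : W}
    (h : π ∈ relPaths (M.keptWorlds D) (M.keptRels D) w) (i : ℕ) :
    M.keptRel D (π i) (π (i + 1)) :=
  ⟨(h.2 i).1, (h.2 (i + 1)).1, (h.2 i).2⟩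

/-- If no transition is forced, the attractor is ordinary backward reachability. -/
theorem mem_attr_of_chain {P : W → W → Prop} {T : Set W} {π : ℕ → W}
    (h : ∀ i, P (π i) (π (i + 1))) {k : ℕ} (hk : π k ∈ T) :
    π 0 ∈ attr P (fun _ _ => False) T k := by
  induction k generalizing π with
  | zero => exact hk
  | succ k ih =>
    have := ih (π := fun i => π (i + 1)) (fun i => h (i + 1)) hk
    exact Or.inr ⟨⟨_, h 0, this⟩, fun _ h => h.elim⟩

theorem exists_strategy_of_deletions (M : Kripke W) (D : Deletions W) {X T : Set W}
    (hX : ∀ v ∈ X, ∃ w ∈ X, M.keptRel D v w) (hT : T ⊆ X)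
    {k : ℕ} (hr : M.r ∈ attr (M.keptRel D) (fun _ _ => False) T k) :
    ∃ V S, M.IsConnectedSubmodel V S ∧ (∀ v w, (v, w) ∈ S → M.keptRel D v w) ∧
      (∀ v ∈ V, v ∈ X ∨ ∃ k, v ∈ attr (M.keptRel D) (fun _ _ => False) T k) ∧
      (∀ v w, (v, w) ∈ S → v ∈ T → w ∈ X) ∧
      ∀ k, ∀ v ∈ attr (M.keptRel D) (fun _ _ => False) T k, ∀ π ∈ relPaths V S v, ∃ j, π j ∈ T := by
  have hd : X ⊆ dia (M.keptRel D) (fun _ _ => False) X := by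
    intro v hv
    obtain ⟨w, h1, h2⟩ := hX v hv
    exact ⟨⟨w, h2, h1⟩, fun _ h => h.elim⟩
  obtain ⟨V, S, h1, -, h2⟩ := exists_strategy M (fun _ _ h => False.elim h)
    (fun v w h => h.2.2.1) (fun _ _ h => False.elim h) hd (hT.trans hd) hr
  exact ⟨V, S, h1, h2⟩

/-- From left to right, any one path of the submodel is a witness, since `S`-paths are paths of `M -
D`. From right to left, the witness makes the root winning in the game without forced transitions,
with the safe set `X` chosen according to the form of the formula. -/
theorem extend_iff [Finite W] (M : Kripke W) (D : Deletions W) (hD : M.r ∉ D.worlds) (a : CTL)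
    (ha : a.IsAtom) :
    (M.ExtendSubmodel a.AF D ↔ (M.delete D hD).Models a.EF) ∧
    (M.ExtendSubmodel a.AG D ↔ (M.delete D hD).Models a.EG) ∧
    (M.ExtendSubmodel a.AG.AF D ↔ (M.delete D hD).Models a.EG.EF) ∧
    (M.ExtendSubmodel a.AF.AG D ↔
      ∃ w, Relation.ReflTransGen (M.delete D hD).R (M.delete D hD).r w ∧
        (M.delete D hD).Sat a w ∧ Relation.TransGen (M.delete D hD).R w w) := by
  have h0 : ∀ v, (M.delete D hD).Sat a v ↔ M.Sat a v := fun v => sat_sub_atom ha v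
  set K := relPaths (M.keptWorlds D) (M.keptRels D) with hK
  refine ⟨?_, ?_, ?_, ?_⟩
  · refine (extendSubmodel_wrap_iff M D ha .F).trans (Iff.trans ?_ (sat_sub_EF h0 _).symm)
    constructor
    · rintro ⟨V, S, hc, hH, hS⟩
      obtain ⟨π, hπ⟩ := hc.exists_relPath hc.root_mem
      exact ⟨π, relPaths_subset_of_rel hS _ hπ, hH π hπ⟩
    · rintro ⟨π, hπ, k, hk⟩
      -- `M - D` need not be total. The safe set consists of the worlds that start an infinite path,
      -- so that the submodel can be continued after the target has been met.
      have hX : ∀ v ∈ {v | ∃ π, π ∈ K v}, ∃ w ∈ {v | ∃ π, π ∈ K v}, M.keptRel D v w := by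
        rintro v ⟨ρ, hρ⟩
        exact ⟨_, ⟨_, shift_mem_relPaths hρ 1⟩, hρ.1 ▸ keptRel_of_mem_relPaths hρ 0⟩
      obtain ⟨V, S, hc, hS, -, -, hatt⟩ := exists_strategy_of_deletions M D hX
        (T := {v | M.Sat a v} ∩ {v | ∃ π, π ∈ K v}) Set.inter_subset_right (k := k) (by
          have := mem_attr_of_chain (keptRel_of_mem_relPaths hπ)
            (T := {v | M.Sat a v} ∩ {v | ∃ π, π ∈ K v}) ⟨hk, _, shift_mem_relPaths hπ k⟩
          rwa [hπ.1] at this)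
      refine ⟨V, S, hc, fun ρ hρ => ?_, hS⟩
      obtain ⟨j, hj⟩ := hatt k M.r (by
          have := mem_attr_of_chain (keptRel_of_mem_relPaths hπ)
            (T := {v | M.Sat a v} ∩ {v | ∃ π, π ∈ K v}) ⟨hk, _, shift_mem_relPaths hπ k⟩
          rwa [hπ.1] at this) ρ hρ
      exact ⟨j, hj.1⟩
  · refine (extendSubmodel_wrap_iff M D ha .G).trans (Iff.trans ?_ (sat_sub_EG h0 _).symm)
    constructor
    · rintro ⟨V, S, hc, hH, hS⟩
      obtain ⟨π, hπ⟩ := hc.exists_relPath hc.root_mem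
      exact ⟨π, relPaths_subset_of_rel hS _ hπ, hH π hπ⟩
    · rintro ⟨π, hπ, hk⟩
      -- The worlds satisfying EG a in `M - D`. Target and safe set coincide, so the submodel starts
      -- in `X` and stays there.
      let X : Set W := {v | ∃ π ∈ K v, ∀ k, M.Sat a (π k)}
      have hX : ∀ v ∈ X, ∃ w ∈ X, M.keptRel D v w := by
        rintro v ⟨ρ, hρ, hρk⟩
        exact ⟨_, ⟨_, shift_mem_relPaths hρ 1, fun k => hρk _⟩,
          hρ.1 ▸ keptRel_of_mem_relPaths hρ 0⟩
      have hr : M.r ∈ X := ⟨π, hπ, hk⟩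
      obtain ⟨V, S, hc, hS, -, hTX, -⟩ := exists_strategy_of_deletions M D hX
        (T := X) subset_rfl (k := 0) hr
      refine ⟨V, S, hc, fun ρ hρ k => ?_, hS⟩
      have : ρ k ∈ X := by
        induction k with
        | zero => rw [hρ.1]; exact hr
        | succ k ih => exact hTX _ _ (hρ.2 k).2 ih
      obtain ⟨τ, hτ, hτk⟩ := this
      exact hτ.1 ▸ hτk 0
  · refine (extendSubmodel_wrap_iff M D ha .FG).trans (Iff.trans ?_
      (sat_sub_EF (q := fun w => ∃ π ∈ K w, ∀ k, M.Sat a (π k)) (sat_sub_EG h0) _).symm)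
    constructor
    · rintro ⟨V, S, hc, hH, hS⟩
      obtain ⟨π, hπ⟩ := hc.exists_relPath hc.root_mem
      obtain ⟨k, hk⟩ := hH π hπ
      have := shift_mem_relPaths hπ k
      exact ⟨π, relPaths_subset_of_rel hS _ hπ, k, _, relPaths_subset_of_rel hS _ this, hk _ this⟩
    · rintro ⟨π, hπ, k, hk⟩
      let X : Set W := {v | ∃ π ∈ K v, ∀ k, M.Sat a (π k)}
      have hX : ∀ v ∈ X, ∃ w ∈ X, M.keptRel D v w := by
        rintro v ⟨ρ, hρ, hρk⟩
        exact ⟨_, ⟨_, shift_mem_relPaths hρ 1, fun k => hρk _⟩,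
          hρ.1 ▸ keptRel_of_mem_relPaths hρ 0⟩
      have hr := mem_attr_of_chain (keptRel_of_mem_relPaths hπ) (T := X) hk
      rw [hπ.1] at hr
      obtain ⟨V, S, hc, hS, -, hTX, hatt⟩ := exists_strategy_of_deletions M D hX
        (T := X) subset_rfl hr
      refine ⟨V, S, hc, fun ρ hρ => ?_, hS⟩
      obtain ⟨j, hj⟩ := hatt _ _ hr ρ hρ
      refine ⟨j, fun τ hτ l => ?_⟩
      have : τ l ∈ X := by
        induction l with
        | zero => rw [hτ.1]; exact hj
        | succ l ih => exact hTX _ _ (hτ.2 l).2 ih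
      obtain ⟨σ, hσ, hσk⟩ := this
      exact hσ.1 ▸ hσk 0
  · refine (extendSubmodel_wrap_iff M D ha .GF).trans ?_
    constructor
    · rintro ⟨V, S, hc, hH, hS⟩
      obtain ⟨π, hπ⟩ := hc.exists_relPath hc.root_mem
      have hinf : ∃ᶠ k in Filter.atTop, M.Sat a (π k) := by
        refine Filter.frequently_atTop.2 fun k => ?_
        obtain ⟨l, hl⟩ := hH π hπ k _ (shift_mem_relPaths hπ k)
        exact ⟨k + l, Nat.le_add_right _ _, hl⟩
      obtain ⟨f, hf, hfa⟩ := Filter.extraction_of_frequently_atTop hinf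
      -- Infinitely many visits to worlds satisfying `a`, but finitely many worlds: one of them is
      -- visited twice, and the path in between is a cycle.
      obtain ⟨i, j, hij, hne⟩ := Finite.exists_ne_map_eq_of_infinite fun i => π (f i)
      obtain ⟨ρ, hρ, hρπ⟩ := exists_lift (h := hD) (w := ⟨M.r, hD⟩)
        (relPaths_subset_of_rel hS M.r hπ)
      have key : ∀ i j, i < j → π (f i) = π (f j) → ∃ w : M.keptWorlds D,
          Relation.ReflTransGen (M.delete D hD).R (M.delete D hD).r w ∧
          (M.delete D hD).Sat a w ∧ Relation.TransGen (M.delete D hD).R w w := by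
        intro i j hij he
        refine ⟨ρ (f i), reach_of_mem_paths hρ _, (h0 _).2 (hρπ (f i) ▸ hfa i), ?_⟩
        have he' : ρ (f j) = ρ (f i) := Subtype.ext (by rw [hρπ, hρπ, he])
        conv => arg 3; rw [← he']
        obtain ⟨d, hd⟩ := Nat.exists_eq_add_of_lt (hf hij)
        rw [hd, add_assoc]
        have h1 : Relation.ReflTransGen (M.delete D hD).R (ρ (f i)) (ρ (f i + d)) :=
          reach_of_mem_paths (shift_mem_paths hρ (f i)) d
        exact Relation.TransGen.tail' h1 (hρ.2 _)
      rcases lt_or_gt_of_ne hij with h | h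
      · exact key i j h hne
      · exact key j i h hne.symm
    · rintro ⟨w, hrw, hwa, hww⟩
      -- The worlds that can reach `w`. Since `w` lies on a cycle, it too has a successor in `X`;
      -- and since all of `X` is attracted to `w`, the submodel returns to `w` forever.
      let X : Set W := {v | ∃ h : v ∈ M.keptWorlds D,
        Relation.ReflTransGen (M.delete D hD).R ⟨v, h⟩ w}
      have hstep : ∀ u, Relation.TransGen (M.delete D hD).R u w →
          ∃ v ∈ X, M.keptRel D u v := by
        intro u hu
        obtain ⟨v, h1, h2⟩ := (Relation.TransGen.head'_iff).1 hu
        exact ⟨v, ⟨v.2, h2⟩, u.2, v.2, h1⟩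
      have hX : ∀ v ∈ X, ∃ w ∈ X, M.keptRel D v w := by
        rintro v ⟨hv, hvw⟩
        rcases Relation.reflTransGen_iff_eq_or_transGen.1 hvw with h | h
        · exact hstep ⟨v, hv⟩ (h ▸ hww)
        · exact hstep _ h
      have hXatt : ∀ v ∈ X, ∃ k, v ∈ attr (M.keptRel D) (fun _ _ => False) {(w : W)} k := by
        rintro v ⟨hv, hvw⟩
        have : ∀ u : M.keptWorlds D, Relation.ReflTransGen (M.delete D hD).R u w →
            ∃ k, (u : W) ∈ attr (M.keptRel D) (fun _ _ => False) {(w : W)} k := by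
          intro u hu
          induction hu using Relation.ReflTransGen.head_induction_on with
          | refl => exact ⟨0, rfl⟩
          | @head a b h _ ih =>
            obtain ⟨k, hk⟩ := ih
            exact ⟨k + 1, Or.inr ⟨⟨b, ⟨a.2, b.2, h⟩, hk⟩, fun _ h => h.elim⟩⟩
        exact this ⟨v, hv⟩ hvw
      have hwX : {(w : W)} ⊆ X := by
        rintro _ rfl
        exact ⟨w.2, Relation.ReflTransGen.refl⟩
      obtain ⟨k, hr⟩ := hXatt M.r ⟨hD, hrw⟩
      obtain ⟨V, S, hc, hS, hV, -, hatt⟩ := exists_strategy_of_deletions M D hX hwX hr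
      refine ⟨V, S, hc, fun π hπ k ρ hρ => ?_, hS⟩
      obtain ⟨j, hj⟩ : ∃ j, π k ∈ attr (M.keptRel D) (fun _ _ => False) {(w : W)} j := by
        rcases hV _ (hπ.2 k).1 with h | h
        · exact hXatt _ h
        · exact h
      obtain ⟨l, hl⟩ := hatt _ _ hj ρ hρ
      exact ⟨l, by rw [hl]; exact (h0 _).1 hwa⟩

end Kripke

/-! ## A structured language for random access machines -/

namespace RAM

/-- Scalar variables. -/
inductive Var
  | len | pos | sym | num | sq | root | row | col | edge | tmp | val | aux | start | rest | tpos
  | wld | glob | inner | outer | ans | cnt | cnt₂ | found | sel | top | mode | out | go | one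
  deriving DecidableEq

/-- Arrays. -/
inductive Arr
  | inp | src | tgt | stat | trail | lab | cur | nxt | good | bad | disc
  deriving DecidableEq

theorem Var.ctorIdx_lt (x : Var) : x.ctorIdx < 32 := by cases x <;> decide

theorem Arr.ctorIdx_lt (k : Arr) : k.ctorIdx < 16 := by cases k <;> decide

theorem Var.ctorIdx_inj {x y : Var} (h : x.ctorIdx = y.ctorIdx) : x = y := by
  cases x <;> cases y <;> first | rfl | cases h

theorem Arr.ctorIdx_inj {k l : Arr} (h : k.ctorIdx = l.ctorIdx) : k = l := by
  cases k <;> cases l <;> first | rfl | cases h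

/-- Statements. -/
inductive Stmt
  | skip
  | set (i : Var) (c : ℕ)
  | copy (i j : Var)
  | inc (i : Var)
  | sub (i j k : Var)
  | dist (i j k : Var)
  | load (i : Var) (k : Arr) (j : Var)
  | store (k : Arr) (i j : Var)
  | print (i : Var)
  | seq (s t : Stmt)
  | ifz (i : Var) (s t : Stmt)
  | loop (c i : Var) (s : Stmt)

/-- The memory seen by a statement: scalars, arrays, and the word that is being printed. -/
structure Mem where
  v : Var → ℕ
  a : Arr → ℕ → ℕ
  buf : List ℕ

namespace Mem

def setV (σ : Mem) (i : Var) (x : ℕ) : Mem := { σ with v := Function.update σ.v i x }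

def setA (σ : Mem) (k : Arr) (i x : ℕ) : Mem :=
  { σ with a := Function.update σ.a k (Function.update (σ.a k) i x) }

def flush (σ : Mem) : Mem := { σ with buf := [] }

@[simp] theorem setV_v (σ : Mem) (i : Var) (x : ℕ) (j : Var) :
    (σ.setV i x).v j = if j = i then x else σ.v j := by
  simp [setV, Function.update_apply]

@[simp] theorem setV_a (σ : Mem) (i : Var) (x : ℕ) : (σ.setV i x).a = σ.a := rfl

@[simp] theorem setV_buf (σ : Mem) (i : Var) (x : ℕ) : (σ.setV i x).buf = σ.buf := rfl

@[simp] theorem setA_v (σ : Mem) (k : Arr) (i x : ℕ) : (σ.setA k i x).v = σ.v := rfl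

@[simp] theorem setA_a (σ : Mem) (k : Arr) (i x : ℕ) (l : Arr) :
    (σ.setA k i x).a l = if l = k then Function.update (σ.a k) i x else σ.a l := by
  by_cases h : l = k
  · subst h; simp [setA]
  · simp [setA, h]

@[simp] theorem setA_buf (σ : Mem) (k : Arr) (i x : ℕ) : (σ.setA k i x).buf = σ.buf := rfl

@[simp] theorem flush_v (σ : Mem) : σ.flush.v = σ.v := rfl

@[simp] theorem flush_a (σ : Mem) : σ.flush.a = σ.a := rfl

theorem setV_setV (σ : Mem) (i : Var) (x y : ℕ) : (σ.setV i x).setV i y = σ.setV i y := by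
  simp [setV]

/-- All contents are at most `B`. -/
structure Bounded (σ : Mem) (B : ℕ) : Prop where
  v : ∀ x, σ.v x ≤ B
  a : ∀ k i, σ.a k i ≤ B

theorem Bounded.setV {σ : Mem} {B : ℕ} (h : σ.Bounded B) (i : Var) {x : ℕ} (hx : x ≤ B) :
    (σ.setV i x).Bounded B :=
  ⟨fun y => by rw [setV_v]; split_ifs; exacts [hx, h.v y], h.a⟩

theorem Bounded.setA {σ : Mem} {B : ℕ} (h : σ.Bounded B) (k : Arr) (i : ℕ) {x : ℕ} (hx : x ≤ B) :
    (σ.setA k i x).Bounded B :=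
  ⟨h.v, fun l j => by
    rw [setA_a]
    split_ifs
    · rw [Function.update_apply]
      split_ifs
      exacts [hx, h.a k j]
    · exact h.a l j⟩

end Mem

namespace Stmt

/-- Run `f` for the values `0, …, m - 1` of the counter `c`. -/
def iter (f : Mem → Mem) (c : Var) : ℕ → Mem → Mem
  | 0, σ => σ.setV c 0
  | m + 1, σ => (f (iter f c m σ)).setV c (m + 1)

/-- The effect of a statement; increments are capped at `B`. -/
def sem (B : ℕ) : Stmt → Mem → Mem
  | skip, σ => σ
  | set i c, σ => σ.setV i c
  | copy i j, σ => σ.setV i (σ.v j)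
  | inc i, σ => σ.setV i (min (σ.v i + 1) B)
  | sub i j k, σ => σ.setV i (σ.v j - σ.v k)
  | dist i j k, σ => σ.setV i ((σ.v j - σ.v k) + (σ.v k - σ.v j))
  | load i k j, σ => σ.setV i (σ.a k (σ.v j))
  | store k i j, σ => σ.setA k (σ.v i) (σ.v j)
  | print i, σ => { σ with buf := σ.buf ++ [σ.v i] }
  | seq s t, σ => t.sem B (s.sem B σ)
  | ifz i s t, σ => if σ.v i = 0 then s.sem B σ else t.sem B σ
  | loop c i s, σ => iter (s.sem B) c (σ.v i) σ

/-- The statement may assign to the scalar `x`. -/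
def writesV (x : Var) : Stmt → Bool
  | skip => false
  | set i _ => x = i
  | copy i _ => x = i
  | inc i => x = i
  | sub i _ _ => x = i
  | dist i _ _ => x = i
  | load i _ _ => x = i
  | store _ _ _ => false
  | print _ => false
  | seq s t => s.writesV x || t.writesV x
  | ifz _ s t => s.writesV x || t.writesV x
  | loop c _ s => x = c || s.writesV x

/-- The statement may assign to the array `k`. -/
def writesA (k : Arr) : Stmt → Bool
  | store l _ _ => k = l
  | seq s t => s.writesA k || t.writesA k
  | ifz _ s t => s.writesA k || t.writesA k
  | loop _ _ s => s.writesA k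
  | _ => false

/-- The statement may print. -/
def prints : Stmt → Bool
  | print _ => true
  | seq s t => s.prints || t.prints
  | ifz _ s t => s.prints || t.prints
  | loop _ _ s => s.prints
  | _ => false

/-- A frame rule with a computable side condition: for concrete statements the hypothesis is closed
by `rfl`. It carries most of the invariants below. -/
theorem sem_v {B : ℕ} {x : Var} : ∀ {s : Stmt} {σ : Mem}, s.writesV x = false →
    (s.sem B σ).v x = σ.v x
  | skip, σ, _ | store _ _ _, σ, _ | print _, σ, _ => rfl
  | set _ _, σ, h | copy _ _, σ, h | inc _, σ, h | sub _ _ _, σ, h | dist _ _ _, σ, h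
  | load _ _ _, σ, h => by
    simp only [writesV, decide_eq_false_iff_not] at h
    simp [sem, h]
  | seq s t, σ, h => by
    simp only [writesV, Bool.or_eq_false_iff] at h
    rw [sem, sem_v h.2, sem_v h.1]
  | ifz i s t, σ, h => by
    simp only [writesV, Bool.or_eq_false_iff] at h
    rw [sem]
    split_ifs
    exacts [sem_v h.1, sem_v h.2]
  | loop c i s, σ, h => by
    simp only [writesV, Bool.or_eq_false_iff, decide_eq_false_iff_not] at h
    rw [sem]
    induction σ.v i with
    | zero => simp [iter, h.1]
    | succ m ih => simp [iter, h.1, sem_v h.2, ih]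

theorem sem_a {B : ℕ} {k : Arr} : ∀ {s : Stmt} {σ : Mem}, s.writesA k = false →
    (s.sem B σ).a k = σ.a k
  | skip, σ, _ | print _, σ, _ | set _ _, σ, _ | copy _ _, σ, _ | inc _, σ, _ | sub _ _ _, σ, _
  | dist _ _ _, σ, _ | load _ _ _, σ, _ => rfl
  | store l i j, σ, h => by
    simp only [writesA, decide_eq_false_iff_not] at h
    simp [sem, h]
  | seq s t, σ, h => by
    simp only [writesA, Bool.or_eq_false_iff] at h
    rw [sem, sem_a h.2, sem_a h.1]
  | ifz i s t, σ, h => by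
    simp only [writesA, Bool.or_eq_false_iff] at h
    rw [sem]
    split_ifs
    exacts [sem_a h.1, sem_a h.2]
  | loop c i s, σ, h => by
    simp only [writesA] at h
    rw [sem]
    induction σ.v i with
    | zero => simp [iter]
    | succ m ih => simp [iter, sem_a h, ih]

theorem sem_buf {B : ℕ} : ∀ {s : Stmt} {σ : Mem}, s.prints = false → (s.sem B σ).buf = σ.buf
  | skip, σ, _ | set _ _, σ, _ | copy _ _, σ, _ | inc _, σ, _ | sub _ _ _, σ, _
  | dist _ _ _, σ, _ | load _ _ _, σ, _ | store _ _ _, σ, _ => rfl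
  | print _, σ, h => by simp [prints] at h
  | seq s t, σ, h => by
    simp only [prints, Bool.or_eq_false_iff] at h
    rw [sem, sem_buf h.2, sem_buf h.1]
  | ifz i s t, σ, h => by
    simp only [prints, Bool.or_eq_false_iff] at h
    rw [sem]
    split_ifs
    exacts [sem_buf h.1, sem_buf h.2]
  | loop c i s, σ, h => by
    simp only [prints] at h
    rw [sem]
    induction σ.v i with
    | zero => simp [iter]
    | succ m ih => simp [iter, sem_buf h, ih]

/-- Invariant rule for loops. -/
theorem loop_rule {B : ℕ} {c i : Var} {s : Stmt} {σ : Mem} (P : ℕ → Mem → Prop)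
    (h0 : P 0 (σ.setV c 0))
    (hs : ∀ m τ, m < σ.v i → τ.v c = m → (∀ x, (loop c i s).writesV x = false → τ.v x = σ.v x) →
      (∀ k, (loop c i s).writesA k = false → τ.a k = σ.a k) →
      ((loop c i s).prints = false → τ.buf = σ.buf) → P m τ →
      P (m + 1) ((s.sem B τ).setV c (m + 1))) :
    P (σ.v i) ((loop c i s).sem B σ) := by
  rw [sem]
  have key : ∀ m, m ≤ σ.v i → P m (iter (s.sem B) c m σ) ∧ (iter (s.sem B) c m σ).v c = m ∧
      (∀ x, (loop c i s).writesV x = false → (iter (s.sem B) c m σ).v x = σ.v x) ∧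
      (∀ k, (loop c i s).writesA k = false → (iter (s.sem B) c m σ).a k = σ.a k) ∧
      ((loop c i s).prints = false → (iter (s.sem B) c m σ).buf = σ.buf) := by
    intro m hm
    induction m with
    | zero =>
      refine ⟨h0, by simp [iter], fun x hx => ?_, fun k _ => rfl, fun _ => rfl⟩
      simp only [writesV, Bool.or_eq_false_iff, decide_eq_false_iff_not] at hx
      simp [iter, hx.1]
    | succ m ih =>
      obtain ⟨h1, h2, h3, h4, h5⟩ := ih (by omega)
      refine ⟨hs m _ (by omega) h2 h3 h4 h5 h1, by simp [iter], fun x hx => ?_, fun k hk => ?_,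
        fun hp => ?_⟩
      · have := h3 x hx
        simp only [writesV, Bool.or_eq_false_iff, decide_eq_false_iff_not] at hx
        simp [iter, hx.1, sem_v hx.2, this]
      · have := h4 k hk
        simp only [writesA] at hk
        simp [iter, sem_a hk, this]
      · have := h5 hp
        simp only [prints] at hp
        simp [iter, sem_buf hp, this]
  exact (key _ le_rfl).1

/-- Constants are at most `20`, and loops change neither their counter nor their bound. -/
def WF : Stmt → Bool
  | set _ c => c ≤ 20
  | seq s t => s.WF && t.WF
  | ifz _ s t => s.WF && t.WF
  | loop c i s => s.WF && !s.writesV c && !s.writesV i && c ≠ i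
  | _ => true

/-- Capped increments make this hold for every well-formed statement, without any knowledge of what
it computes. That the cap does no harm is shown separately, where the value of an increment matters.
-/
theorem bounded_sem {B : ℕ} (hB : 20 ≤ B) : ∀ {s : Stmt} {σ : Mem}, s.WF → σ.Bounded B →
    (s.sem B σ).Bounded B
  | skip, σ, _, h => h
  | print _, σ, _, h => ⟨h.v, h.a⟩
  | set i c, σ, hw, h => h.setV i (by simp only [WF, decide_eq_true_eq] at hw; omega)
  | copy i j, σ, _, h => h.setV i (h.v j)
  | inc i, σ, _, h => h.setV i (min_le_right _ _)
  | sub i j k, σ, _, h => h.setV i ((Nat.sub_le _ _).trans (h.v j))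
  | dist i j k, σ, _, h => h.setV i (by have := h.v j; have := h.v k; omega)
  | load i k j, σ, _, h => h.setV i (h.a k _)
  | store k i j, σ, _, h => h.setA k _ (h.v j)
  | seq s t, σ, hw, h => by
    simp only [WF, Bool.and_eq_true] at hw
    rw [sem]
    exact bounded_sem hB hw.2 (bounded_sem hB hw.1 h)
  | ifz i s t, σ, hw, h => by
    simp only [WF, Bool.and_eq_true] at hw
    rw [sem]
    split_ifs
    exacts [bounded_sem hB hw.1 h, bounded_sem hB hw.2 h]
  | loop c i s, σ, hw, h => by
    simp only [WF, Bool.and_eq_true] at hw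
    rw [sem]
    have key : ∀ m ≤ B, (iter (s.sem B) c m σ).Bounded B := by
      intro m hm
      induction m with
      | zero => exact h.setV c (Nat.zero_le _)
      | succ m ih => exact (bounded_sem hB hw.1.1.1 (ih (by omega))).setV c hm
    exact key _ (h.v i)

/-! ### Compilation -/

/-- The number of instructions of the compiled statement. -/
def size : Stmt → ℕ
  | skip => 0
  | set _ _ => 1
  | copy _ _ => 1
  | inc _ => 3
  | sub _ _ _ => 1
  | dist _ _ _ => 3
  | load _ _ _ => 9
  | store _ _ _ => 9
  | print _ => 1
  | seq s t => s.size + t.size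
  | ifz _ s t => t.size + s.size + 2
  | loop _ _ s => s.size + 5

/-- Compute the address of an array cell in register `40`. -/
def address (k : Arr) (i : Var) : List Instr :=
  [.copy 40 i.ctorIdx, .add 40 40 40, .add 40 40 40, .add 40 40 40, .add 40 40 40, .add 40 40 43,
    .const 41 k.ctorIdx, .add 40 40 41]

/-- The compiled statement, starting at line `o`. Register `43` holds the base address of the
arrays, `44` the cap of increments and `45` the number one. -/
def compile : Stmt → ℕ → List Instr
  | skip, _ => []
  | set i c, _ => [.const i.ctorIdx c]
  | copy i j, _ => [.copy i.ctorIdx j.ctorIdx]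
  | inc i, _ => [.add i.ctorIdx i.ctorIdx 45, .sub 40 i.ctorIdx 44, .sub i.ctorIdx i.ctorIdx 40]
  | sub i j k, _ => [.sub i.ctorIdx j.ctorIdx k.ctorIdx]
  | dist i j k, _ =>
    [.sub 40 j.ctorIdx k.ctorIdx, .sub 41 k.ctorIdx j.ctorIdx, .add i.ctorIdx 40 41]
  | load i k j, _ => address k j ++ [.load i.ctorIdx 40]
  | store k i j, _ => address k i ++ [.store 40 j.ctorIdx]
  | print i, _ => [.print i.ctorIdx]
  | seq s t, o => s.compile o ++ t.compile (o + s.size)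
  | ifz i s t, o =>
    [.jumpZero i.ctorIdx (o + 1 + t.size + 1)] ++ t.compile (o + 1) ++
      [.jump (o + 1 + t.size + 1 + s.size)] ++ s.compile (o + 1 + t.size + 1)
  | loop c i s, o =>
    [.const c.ctorIdx 0, .sub 40 i.ctorIdx c.ctorIdx, .jumpZero 40 (o + 1 + 1 + 1 + s.size + 1 + 1)]
      ++ s.compile (o + 1 + 1 + 1) ++ [.add c.ctorIdx c.ctorIdx 45, .jump (o + 1)]

theorem length_compile (s : Stmt) (o : ℕ) : (s.compile o).length = s.size := by
  induction s generalizing o <;> simp [compile, size, address, *]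
  all_goals omega

/-- A bound for the number of steps of the compiled statement on contents at most `B`. -/
def time (B : ℕ) : Stmt → ℕ
  | seq s t => s.time B + t.time B
  | ifz _ s t => s.time B + t.time B + 2
  | loop _ _ s => B * (s.time B + 4) + 3
  | _ => 9

end Stmt

/-! ### Runs of the machine -/

/-- The code `l` occurs in `P` from line `o` on. -/
def CodeAt (P : Program) (o : ℕ) (l : List Instr) : Prop :=
  ∃ P₁ P₂, P = P₁ ++ l ++ P₂ ∧ P₁.length = o

theorem CodeAt.left {P : Program} {o : ℕ} {l l' : List Instr} (h : CodeAt P o (l ++ l')) :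
    CodeAt P o l := by
  obtain ⟨P₁, P₂, h1, h2⟩ := h
  exact ⟨P₁, l' ++ P₂, by simp [h1], h2⟩

theorem CodeAt.right {P : Program} {o : ℕ} {l l' : List Instr} (h : CodeAt P o (l ++ l')) :
    CodeAt P (o + l.length) l' := by
  obtain ⟨P₁, P₂, h1, h2⟩ := h
  exact ⟨P₁ ++ l, P₂, by simp [h1], by simp [h2]⟩

theorem CodeAt.head {P : Program} {o : ℕ} {a : Instr} {l : List Instr} (h : CodeAt P o (a :: l)) :
    P[o]? = some a := by
  obtain ⟨P₁, P₂, h1, h2⟩ := h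
  subst h1 h2
  simp

theorem CodeAt.tail {P : Program} {o : ℕ} {a : Instr} {l : List Instr} (h : CodeAt P o (a :: l)) :
    CodeAt P (o + 1) l :=
  CodeAt.right (l := [a]) h

/-- A bound for the cost of an instruction when all contents are at most `17 * L + 500`. -/
def stepCost (L : ℕ) : ℕ := 34 * L + 1200

section run

variable {m : ℕ} (P : Program) (O : Set (List (Fin m)))

/-- From line `o` with registers `reg` and printed word `b` the machine gets to line `o'` with
`reg'` and `b'` in time `k * stepCost L`, without output and oracle calls. -/
def Run (L : ℕ) (o : ℕ) (reg : ℕ → ℕ) (b : List ℕ) (o' : ℕ) (reg' : ℕ → ℕ) (b' : List ℕ) (k : ℕ) :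
    Prop :=
  ∀ c : Config, c.pc = o → c.reg = reg → c.buf = b → ∃ N c', (step P O)^[N] c = c' ∧
    c'.pc = o' ∧ c'.reg = reg' ∧ c'.buf = b' ∧ c'.outs = c.outs ∧ c'.querySize = c.querySize ∧
    c'.time ≤ c.time + k * stepCost L

variable {P O} {L o : ℕ} {reg : ℕ → ℕ} {b : List ℕ}

theorem Run.refl : Run P O L o reg b o reg b 0 :=
  fun c h1 h2 h3 => ⟨0, c, rfl, h1, h2, h3, rfl, rfl, by omega⟩

theorem Run.trans {o' o'' : ℕ} {reg' reg'' : ℕ → ℕ} {b' b'' : List ℕ} {k k' : ℕ}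
    (h : Run P O L o reg b o' reg' b' k) (h' : Run P O L o' reg' b' o'' reg'' b'' k') :
    Run P O L o reg b o'' reg'' b'' (k + k') := by
  intro c h1 h2 h3
  obtain ⟨N, c', rfl, h4, h5, h6, h7, h8, h9⟩ := h c h1 h2 h3
  obtain ⟨N', c'', rfl, h4', h5', h6', h7', h8', h9'⟩ := h' _ h4 h5 h6
  refine ⟨N' + N, _, rfl, ?_⟩
  rw [Function.iterate_add_apply]
  exact ⟨h4', h5', h6', h7'.trans h7, h8'.trans h8, by rw [add_mul]; omega⟩

theorem Run.mono {o' : ℕ} {reg' : ℕ → ℕ} {b' : List ℕ} {k k' : ℕ}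
    (h : Run P O L o reg b o' reg' b' k) (hk : k ≤ k') : Run P O L o reg b o' reg' b' k' := by
  intro c h1 h2 h3
  obtain ⟨N, c', h4, h5, h6, h7, h8, h9, h10⟩ := h c h1 h2 h3
  exact ⟨N, c', h4, h5, h6, h7, h8, h9, h10.trans (by gcongr)⟩

theorem step_eq {P : Program} {c : Config} {a : Instr} (h : P[c.pc]? = some a) :
    step P O c = a.exec O { c with time := c.time + a.cost c.reg } := by
  simp [step, h]

/-- Logarithmic cost is estimated crudely by the values themselves; as these are linear in the input
length, the bounds remain polynomial. -/
theorem size_le (n : ℕ) : n.size ≤ n := Nat.size_le.2 Nat.lt_two_pow_self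

theorem Run.single {a : Instr} {o' : ℕ} {reg' : ℕ → ℕ} {b' : List ℕ} (h : P[o]? = some a)
    (hc : a.cost reg ≤ stepCost L)
    (he : ∀ c : Config, c.pc = o → c.reg = reg → c.buf = b → (a.exec O c).pc = o' ∧
      (a.exec O c).reg = reg' ∧ (a.exec O c).buf = b' ∧ (a.exec O c).outs = c.outs ∧
      (a.exec O c).querySize = c.querySize ∧ (a.exec O c).time = c.time) :
    Run P O L o reg b o' reg' b' 1 := by
  intro c h1 h2 h3
  obtain ⟨e1, e2, e3, e4, e5, e6⟩ := he { c with time := c.time + a.cost c.reg } h1 h2 h3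
  refine ⟨1, _, rfl, ?_⟩
  rw [Function.iterate_one, step_eq (by rw [h1, h])]
  refine ⟨e1, e2, e3, e4, e5, ?_⟩
  rw [e6, h2, one_mul]
  exact Nat.add_le_add_left hc _

theorem run_const (hb : ∀ x, reg x ≤ 17 * L + 500) {i c : ℕ} (h : P[o]? = some (.const i c)) (hi : i < 64) (hc : c ≤ 500) :
    Run P O L o reg b (o + 1) (Function.update reg i c) b 1 := by
  refine Run.single h ?_ fun c' h1 h2 h3 => ?_
  · have := size_le i
    have := size_le c
    simp only [Instr.cost, stepCost]
    omega
  · subst h1 h2 h3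
    exact ⟨rfl, rfl, rfl, rfl, rfl, rfl⟩

theorem run_copy (hb : ∀ x, reg x ≤ 17 * L + 500) {i j : ℕ} (h : P[o]? = some (.copy i j)) (hi : i < 64) (hj : j < 64) :
    Run P O L o reg b (o + 1) (Function.update reg i (reg j)) b 1 := by
  refine Run.single h ?_ fun c' h1 h2 h3 => ?_
  · have := size_le i
    have := size_le j
    have := size_le (reg j)
    have := hb j
    simp only [Instr.cost, stepCost]
    omega
  · subst h1 h2 h3
    exact ⟨rfl, rfl, rfl, rfl, rfl, rfl⟩

theorem run_add (hb : ∀ x, reg x ≤ 17 * L + 500) {i j k : ℕ} (h : P[o]? = some (.add i j k)) (hi : i < 64) (hj : j < 64)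
    (hk : k < 64) :
    Run P O L o reg b (o + 1) (Function.update reg i (reg j + reg k)) b 1 := by
  refine Run.single h ?_ fun c' h1 h2 h3 => ?_
  · have := size_le i
    have := size_le j
    have := size_le k
    have := size_le (reg j)
    have := hb j
    have := size_le (reg k)
    have := hb k
    simp only [Instr.cost, stepCost]
    omega
  · subst h1 h2 h3
    exact ⟨rfl, rfl, rfl, rfl, rfl, rfl⟩

theorem run_sub (hb : ∀ x, reg x ≤ 17 * L + 500) {i j k : ℕ} (h : P[o]? = some (.sub i j k)) (hi : i < 64) (hj : j < 64)
    (hk : k < 64) :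
    Run P O L o reg b (o + 1) (Function.update reg i (reg j - reg k)) b 1 := by
  refine Run.single h ?_ fun c' h1 h2 h3 => ?_
  · have := size_le i
    have := size_le j
    have := size_le k
    have := size_le (reg j)
    have := hb j
    have := size_le (reg k)
    have := hb k
    simp only [Instr.cost, stepCost]
    omega
  · subst h1 h2 h3
    exact ⟨rfl, rfl, rfl, rfl, rfl, rfl⟩

theorem run_load (hb : ∀ x, reg x ≤ 17 * L + 500) {i j : ℕ} (h : P[o]? = some (.load i j)) (hi : i < 64) (hj : j < 64) :
    Run P O L o reg b (o + 1) (Function.update reg i (reg (reg j))) b 1 := by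
  refine Run.single h ?_ fun c' h1 h2 h3 => ?_
  · have := size_le i
    have := size_le j
    have := size_le (reg j)
    have := hb j
    have := size_le (reg (reg j))
    have := hb (reg j)
    simp only [Instr.cost, stepCost]
    omega
  · subst h1 h2 h3
    exact ⟨rfl, rfl, rfl, rfl, rfl, rfl⟩

theorem run_store (hb : ∀ x, reg x ≤ 17 * L + 500) {i j : ℕ} (h : P[o]? = some (.store i j)) (hi : i < 64) (hj : j < 64) :
    Run P O L o reg b (o + 1) (Function.update reg (reg i) (reg j)) b 1 := by
  refine Run.single h ?_ fun c' h1 h2 h3 => ?_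
  · have := size_le i
    have := size_le j
    have := size_le (reg i)
    have := hb i
    have := size_le (reg j)
    have := hb j
    simp only [Instr.cost, stepCost]
    omega
  · subst h1 h2 h3
    exact ⟨rfl, rfl, rfl, rfl, rfl, rfl⟩

theorem run_jump {l : ℕ} (h : P[o]? = some (.jump l)) :
    Run P O L o reg b l reg b 1 := by
  refine Run.single h ?_ fun c' h1 h2 h3 => ?_
  · simp only [Instr.cost, stepCost]
    omega
  · subst h1 h2 h3
    exact ⟨rfl, rfl, rfl, rfl, rfl, rfl⟩

theorem run_jumpZero (hb : ∀ x, reg x ≤ 17 * L + 500) {i l : ℕ} (h : P[o]? = some (.jumpZero i l)) (hi : i < 64) :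
    Run P O L o reg b (if reg i = 0 then l else o + 1) reg b 1 := by
  refine Run.single h ?_ fun c' h1 h2 h3 => ?_
  · have := size_le i
    have := size_le (reg i)
    have := hb i
    simp only [Instr.cost, stepCost]
    omega
  · subst h1 h2 h3
    exact ⟨rfl, rfl, rfl, rfl, rfl, rfl⟩

theorem run_print (hb : ∀ x, reg x ≤ 17 * L + 500) {i : ℕ} (h : P[o]? = some (.print i)) (hi : i < 64) :
    Run P O L o reg b (o + 1) reg (b ++ [reg i]) 1 := by
  refine Run.single h ?_ fun c' h1 h2 h3 => ?_
  · have := size_le i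
    have := size_le (reg i)
    have := hb i
    simp only [Instr.cost, stepCost]
    omega
  · subst h1 h2 h3
    exact ⟨rfl, rfl, rfl, rfl, rfl, rfl⟩

end run

/-- The registers represent the memory `σ`; the layout depends on the input length `L`. -/
structure Rel (L : ℕ) (σ : Mem) (reg : ℕ → ℕ) : Prop where
  var : ∀ x : Var, reg x.ctorIdx = σ.v x
  arr : ∀ (k : Arr) i, reg (L + 65 + 16 * i + k.ctorIdx) = σ.a k i
  base : reg 43 = L + 65
  cap : reg 44 = L + 20
  one : reg 45 = 1
  bound : ∀ x, reg x ≤ 17 * L + 500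

namespace Rel

variable {L : ℕ} {σ : Mem} {reg : ℕ → ℕ}

theorem bound_update (h : ∀ x, reg x ≤ 17 * L + 500) (i : ℕ) {x : ℕ} (hx : x ≤ 17 * L + 500) (y : ℕ) :
    Function.update reg i x y ≤ 17 * L + 500 := by
  rw [Function.update_apply]
  split_ifs
  exacts [hx, h y]

theorem scratch (h : Rel L σ reg) {i x : ℕ} (hi : i = 40 ∨ i = 41) (hx : x ≤ 17 * L + 500) :
    Rel L σ (Function.update reg i x) where
  var y := by
    have := y.ctorIdx_lt
    rw [Function.update_of_ne (by omega), h.var]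
  arr k j := by rw [Function.update_of_ne (by omega), h.arr]
  base := by rw [Function.update_of_ne (by omega), h.base]
  cap := by rw [Function.update_of_ne (by omega), h.cap]
  one := by rw [Function.update_of_ne (by omega), h.one]
  bound := bound_update h.bound i hx

theorem setV (h : Rel L σ reg) (i : Var) {x : ℕ} (hx : x ≤ 17 * L + 500) :
    Rel L (σ.setV i x) (Function.update reg i.ctorIdx x) := by
  have hi := i.ctorIdx_lt
  refine ⟨fun y => ?_, fun k j => ?_, ?_, ?_, ?_, bound_update h.bound _ hx⟩
  · rw [Mem.setV_v]
    split_ifs with hy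
    · rw [hy, Function.update_self]
    · rw [Function.update_of_ne fun h' => hy (Var.ctorIdx_inj h'), h.var]
  · rw [Function.update_of_ne (by omega), h.arr, Mem.setV_a]
  · rw [Function.update_of_ne (by omega), h.base]
  · rw [Function.update_of_ne (by omega), h.cap]
  · rw [Function.update_of_ne (by omega), h.one]

/-- The arrays are interleaved with period `16`. As there are fewer than `16` of them, distinct
cells have distinct addresses, and the base `L + 65` lies above the scalars and the reserved
registers. -/
theorem setA (h : Rel L σ reg) (k : Arr) (i : ℕ) {x : ℕ} (hx : x ≤ 17 * L + 500) :
    Rel L (σ.setA k i x) (Function.update reg (L + 65 + 16 * i + k.ctorIdx) x) := by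
  have hk := k.ctorIdx_lt
  refine ⟨fun y => ?_, fun l j => ?_, ?_, ?_, ?_, bound_update h.bound _ hx⟩
  · have := y.ctorIdx_lt
    rw [Function.update_of_ne (by omega), h.var, Mem.setA_v]
  · have hl := l.ctorIdx_lt
    rw [Mem.setA_a]
    split_ifs with hlk
    · subst hlk
      rw [Function.update_apply, Function.update_apply, h.arr]
      exact if_congr (by omega) rfl rfl
    · have : l.ctorIdx ≠ k.ctorIdx := fun h' => hlk (Arr.ctorIdx_inj h')
      rw [Function.update_of_ne (by omega), h.arr]
  · rw [Function.update_of_ne (by omega), h.base]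
  · rw [Function.update_of_ne (by omega), h.cap]
  · rw [Function.update_of_ne (by omega), h.one]

theorem congr {σ' : Mem} (h : Rel L σ reg) (hv : σ'.v = σ.v) (ha : σ'.a = σ.a) : Rel L σ' reg :=
  ⟨fun x => by rw [hv, h.var], fun k i => by rw [ha, h.arr], h.base, h.cap, h.one, h.bound⟩

end Rel

section compile

variable {m : ℕ} {P : Program} {O : Set (List (Fin m))} {L o : ℕ} {σ : Mem} {reg : ℕ → ℕ}
  {b : List ℕ}

theorem run_double (hR : Rel L σ reg) (h : P[o]? = some (.add 40 40 40))
    (h40 : reg 40 ≤ 8 * L + 200) : ∃ reg', Rel L σ reg' ∧ reg' 40 = 2 * reg 40 ∧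
      Run P O L o reg b (o + 1) reg' b 1 :=
  ⟨_, hR.scratch (Or.inl rfl) (by omega), by rw [Function.update_self]; omega,
    run_add hR.bound h (by omega) (by omega) (by omega)⟩

/-- Four doublings multiply the index by `16`. The index is at most `L + 20`, so the address stays
below `17 * L + 500`. -/
theorem run_address (hR : Rel L σ reg) (hσ : σ.Bounded (L + 20)) (k : Arr) (i : Var)
    (h : CodeAt P o (Stmt.address k i)) :
    ∃ reg', Rel L σ reg' ∧ reg' 40 = L + 65 + 16 * σ.v i + k.ctorIdx ∧
      Run P O L o reg b (o + 8) reg' b 8 := by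
  have hi := hσ.v i
  have hk := k.ctorIdx_lt
  have hi' := i.ctorIdx_lt
  have R1 : Rel L σ (Function.update reg 40 (reg i.ctorIdx)) :=
    hR.scratch (Or.inl rfl) (hR.bound _)
  have S1 := run_copy (O := O) (b := b) hR.bound h.head (by omega) (by omega)
  have e1 : Function.update reg 40 (reg i.ctorIdx) 40 = σ.v i := by
    rw [Function.update_self, hR.var]
  obtain ⟨r2, R2, e2, S2⟩ := run_double (O := O) (b := b) R1 h.tail.head (by omega)
  obtain ⟨r3, R3, e3, S3⟩ := run_double (O := O) (b := b) R2 h.tail.tail.head (by omega)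
  obtain ⟨r4, R4, e4, S4⟩ := run_double (O := O) (b := b) R3 h.tail.tail.tail.head (by omega)
  obtain ⟨r5, R5, e5, S5⟩ := run_double (O := O) (b := b) R4 h.tail.tail.tail.tail.head (by omega)
  have S6 := run_add (O := O) (b := b) R5.bound h.tail.tail.tail.tail.tail.head (by omega)
    (by omega) (by omega)
  have R6 := R5.scratch (i := 40) (x := r5 40 + r5 43) (Or.inl rfl) (by rw [R5.base]; omega)
  have S7 := run_const (O := O) (b := b) R6.bound h.tail.tail.tail.tail.tail.tail.head (by omega)
    (by omega)
  have R7 := R6.scratch (i := 41) (x := k.ctorIdx) (Or.inr rfl) (by omega)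
  have S8 := run_add (O := O) (b := b) R7.bound h.tail.tail.tail.tail.tail.tail.tail.head (by omega)
    (by omega) (by omega)
  have hval : Function.update (Function.update r5 40 (r5 40 + r5 43)) 41 k.ctorIdx 40 +
      Function.update (Function.update r5 40 (r5 40 + r5 43)) 41 k.ctorIdx 41 =
      L + 65 + 16 * σ.v i + k.ctorIdx := by
    rw [Function.update_self, Function.update_of_ne (by omega), Function.update_self, R5.base]
    omega
  rw [hval] at S8
  exact ⟨_, R7.scratch (x := L + 65 + 16 * σ.v i + k.ctorIdx) (Or.inl rfl) (by omega),
    Function.update_self .., by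
      simpa only [add_assoc, Nat.reduceAdd] using
        ((((((S1.trans S2).trans S3).trans S4).trans S5).trans S6).trans S7).trans S8⟩

/-- Correctness of the compiler with its time bound. Boundedness of the memory is needed in each
step, because addresses, costs and numbers of rounds are estimated from it. -/
theorem run_compile (s : Stmt) (hw : s.WF) (hσ : σ.Bounded (L + 20)) (hR : Rel L σ reg)
    (h : CodeAt P o (s.compile o)) : ∃ reg', Rel L (s.sem (L + 20) σ) reg' ∧
      Run P O L o reg σ.buf (o + s.size) reg' (s.sem (L + 20) σ).buf (s.time (L + 20)) := by
  induction s generalizing o σ reg with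
  | skip => exact ⟨reg, hR, Run.refl.mono (Nat.zero_le _)⟩
  | set i c =>
    simp only [Stmt.WF, decide_eq_true_eq] at hw
    have := i.ctorIdx_lt
    exact ⟨_, hR.setV i (by omega), (run_const hR.bound h.head (by omega) (by omega)).mono
      (by simp [Stmt.time])⟩
  | copy i j =>
    have := i.ctorIdx_lt
    have := j.ctorIdx_lt
    have S := run_copy (O := O) (b := σ.buf) hR.bound h.head (by omega) (by omega)
    refine ⟨_, ?_, S.mono (by simp [Stmt.time])⟩
    rw [hR.var]
    exact hR.setV i ((hR.var j).symm ▸ hR.bound _)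
  | sub i j k =>
    have := i.ctorIdx_lt
    have := j.ctorIdx_lt
    have := k.ctorIdx_lt
    have := hσ.v j
    have S := run_sub (O := O) (b := σ.buf) hR.bound h.head (by omega) (by omega) (by omega)
    refine ⟨_, ?_, S.mono (by simp [Stmt.time])⟩
    rw [hR.var, hR.var]
    exact hR.setV i (by omega)
  | inc i =>
    have hi := i.ctorIdx_lt
    have := hσ.v i
    have S1 := run_add (O := O) (b := σ.buf) hR.bound h.head (by omega) (by omega) (by omega)
    rw [hR.var, hR.one] at S1
    have R1 := hR.setV i (x := σ.v i + 1) (by omega)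
    have S2 := run_sub (O := O) (b := σ.buf) R1.bound h.tail.head (by omega) (by omega) (by omega)
    rw [R1.var, R1.cap, Mem.setV_v, if_pos rfl] at S2
    have R2 := R1.scratch (i := 40) (x := σ.v i + 1 - (L + 20)) (Or.inl rfl) (by omega)
    have S3 := run_sub (O := O) (b := σ.buf) R2.bound h.tail.tail.head (by omega) (by omega)
      (by omega)
    rw [R2.var, Function.update_self, Mem.setV_v, if_pos rfl] at S3
    have R3 := R2.setV i (x := σ.v i + 1 - (σ.v i + 1 - (L + 20))) (by omega)
    refine ⟨_, ?_, ((S1.trans S2).trans S3).mono (by simp [Stmt.time])⟩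
    rw [Mem.setV_setV] at R3
    have e : σ.v i + 1 - (σ.v i + 1 - (L + 20)) = min (σ.v i + 1) (L + 20) := by omega
    rw [e] at R3 ⊢
    exact R3
  | dist i j k =>
    have := i.ctorIdx_lt
    have hj := j.ctorIdx_lt
    have hk := k.ctorIdx_lt
    have := hσ.v j
    have := hσ.v k
    have S1 := run_sub (O := O) (b := σ.buf) hR.bound h.head (by omega) (by omega) (by omega)
    rw [hR.var, hR.var] at S1
    have R1 := hR.scratch (i := 40) (x := σ.v j - σ.v k) (Or.inl rfl) (by omega)
    have S2 := run_sub (O := O) (b := σ.buf) R1.bound h.tail.head (by omega) (by omega) (by omega)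
    rw [R1.var, R1.var] at S2
    have R2 := R1.scratch (i := 41) (x := σ.v k - σ.v j) (Or.inr rfl) (by omega)
    have S3 := run_add (O := O) (b := σ.buf) R2.bound h.tail.tail.head (by omega) (by omega)
      (by omega)
    rw [Function.update_self, Function.update_of_ne (by omega), Function.update_self] at S3
    exact ⟨_, R2.setV i (by omega), ((S1.trans S2).trans S3).mono (by simp [Stmt.time])⟩
  | load i k j =>
    have hi := i.ctorIdx_lt
    obtain ⟨r1, R1, e1, S1⟩ := run_address (O := O) (b := σ.buf) hR hσ k j h.left
    have S2 := run_load (O := O) (b := σ.buf) R1.bound h.right.head (by omega) (by omega)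
    rw [e1, R1.arr] at S2
    exact ⟨_, R1.setV i (x := σ.a k (σ.v j)) ((R1.arr _ _).symm ▸ R1.bound _), by
      simpa only [Stmt.size, Stmt.time, Stmt.sem, Mem.setV_buf, Mem.setA_buf, Stmt.address,
        List.length_cons, List.length_nil, add_assoc, Nat.reduceAdd] using S1.trans S2⟩
  | store k i j =>
    have hj := j.ctorIdx_lt
    obtain ⟨r1, R1, e1, S1⟩ := run_address (O := O) (b := σ.buf) hR hσ k i h.left
    have S2 := run_store (O := O) (b := σ.buf) R1.bound h.right.head (by omega) (by omega)
    rw [e1, R1.var] at S2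
    exact ⟨_, R1.setA k (σ.v i) (x := σ.v j) ((R1.var _).symm ▸ R1.bound _), by
      simpa only [Stmt.size, Stmt.time, Stmt.sem, Mem.setV_buf, Mem.setA_buf, Stmt.address,
        List.length_cons, List.length_nil, add_assoc, Nat.reduceAdd] using S1.trans S2⟩
  | print i =>
    have := i.ctorIdx_lt
    have S := run_print (O := O) (b := σ.buf) hR.bound h.head (by omega)
    rw [hR.var] at S
    exact ⟨_, hR.congr rfl rfl, S.mono (by simp [Stmt.time])⟩
  | seq s t ihs iht =>
    simp only [Stmt.WF, Bool.and_eq_true] at hw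
    obtain ⟨r1, R1, S1⟩ := ihs hw.1 hσ hR h.left
    have h2 := h.right
    rw [Stmt.length_compile] at h2
    obtain ⟨r2, R2, S2⟩ := iht hw.2 (Stmt.bounded_sem (by omega) hw.1 hσ) R1 h2
    refine ⟨r2, R2, ?_⟩
    have S := S1.trans S2
    rw [add_assoc] at S
    exact S
  | ifz i s t ihs iht =>
    simp only [Stmt.WF, Bool.and_eq_true] at hw
    have hi := i.ctorIdx_lt
    have h1 : CodeAt P o [.jumpZero i.ctorIdx (o + 1 + t.size + 1)] := h.left.left.left
    have h2 : CodeAt P (o + 1) (t.compile (o + 1)) := h.left.left.right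
    have h3 : CodeAt P (o + 1 + t.size) [.jump (o + 1 + t.size + 1 + s.size)] := by
      have := h.left.right
      simp only [List.length_append, Stmt.length_compile, List.length_singleton] at this
      rwa [← add_assoc] at this
    have h4 : CodeAt P (o + 1 + t.size + 1) (s.compile (o + 1 + t.size + 1)) := by
      have := h.right
      simp only [List.length_append, Stmt.length_compile, List.length_singleton] at this
      rwa [← add_assoc, ← add_assoc] at this
    have S1 := run_jumpZero (O := O) (b := σ.buf) hR.bound h1.head (by omega)
    rw [hR.var] at S1
    have hsz : o + (Stmt.ifz i s t).size = o + 1 + t.size + 1 + s.size := by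
      simp only [Stmt.size]; omega
    rw [hsz]
    simp only [Stmt.sem]
    split_ifs at S1 ⊢ with hz
    · obtain ⟨r2, R2, S2⟩ := ihs hw.1 hσ hR h4
      exact ⟨r2, R2, (S1.trans S2).mono (by simp only [Stmt.time]; omega)⟩
    · obtain ⟨r2, R2, S2⟩ := iht hw.2 hσ hR h2
      exact ⟨r2, R2, ((S1.trans S2).trans (run_jump h3.head)).mono
        (by simp only [Stmt.time]; omega)⟩
  | loop c i s ih =>
    simp only [Stmt.WF, Bool.and_eq_true, decide_eq_true_eq, Bool.not_eq_true'] at hw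
    obtain ⟨⟨⟨hws, hwc⟩, hwi⟩, hci⟩ := hw
    have hc := c.ctorIdx_lt
    have hi := i.ctorIdx_lt
    have h1 : CodeAt P o [.const c.ctorIdx 0, .sub 40 i.ctorIdx c.ctorIdx,
      .jumpZero 40 (o + 1 + 1 + 1 + s.size + 1 + 1)] := h.left.left
    have h2 : CodeAt P (o + 1 + 1 + 1) (s.compile (o + 1 + 1 + 1)) := h.left.right
    have h3 : CodeAt P (o + 1 + 1 + 1 + s.size) [.add c.ctorIdx c.ctorIdx 45, .jump (o + 1)] := by
      have := h.right
      simp only [List.length_append, Stmt.length_compile, List.length_cons, List.length_nil] at this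
      convert this using 1
      omega
    have hbd : ∀ m ≤ L + 20, (Stmt.iter (s.sem (L + 20)) c m σ).Bounded (L + 20) := by
      intro m hm
      induction m with
      | zero => exact hσ.setV c (Nat.zero_le _)
      | succ m ih => exact (Stmt.bounded_sem (by omega) hws (ih (by omega))).setV c hm
    have hvi : ∀ m, (Stmt.iter (s.sem (L + 20)) c m σ).v i = σ.v i := by
      intro m
      induction m with
      | zero => simp [Stmt.iter, hci.symm]
      | succ m ih => simp [Stmt.iter, hci.symm, Stmt.sem_v hwi, ih]
    have hvc : ∀ m, (Stmt.iter (s.sem (L + 20)) c m σ).v c = m := by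
      intro m
      cases m <;> simp [Stmt.iter]
    -- After `m` rounds the machine is at line `o + 1`, where the loop test is; the single extra
    -- step in the time is the initialisation of the counter.
    have key : ∀ m ≤ σ.v i, ∃ r, Rel L (Stmt.iter (s.sem (L + 20)) c m σ) r ∧
        Run P O L o reg σ.buf (o + 1) r (Stmt.iter (s.sem (L + 20)) c m σ).buf
          (m * (s.time (L + 20) + 4) + 1) := by
      intro m hm
      induction m with
      | zero =>
        refine ⟨_, hR.setV c (Nat.zero_le _), ?_⟩
        rw [zero_mul, zero_add]
        exact run_const hR.bound h1.head (by omega) (by omega)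
      | succ m ihm =>
        obtain ⟨r1, R1, S1⟩ := ihm (by omega)
        have hbm := hbd m (by have := hσ.v i; omega)
        have S2 := run_sub (O := O) (b := (Stmt.iter (s.sem (L + 20)) c m σ).buf) R1.bound
          h1.tail.head (by omega) (by omega) (by omega)
        rw [R1.var, R1.var, hvi, hvc] at S2
        have R2 := R1.scratch (i := 40) (x := σ.v i - m) (Or.inl rfl)
          (by have := hσ.v i; omega)
        have S3 := run_jumpZero (O := O) (b := (Stmt.iter (s.sem (L + 20)) c m σ).buf) R2.bound
          h1.tail.tail.head (by omega)
        rw [Function.update_self, if_neg (by omega)] at S3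
        obtain ⟨r4, R4, S4⟩ := ih hws hbm R2 h2
        have S5 := run_add (O := O) (b := (s.sem (L + 20) (Stmt.iter (s.sem (L + 20)) c m σ)).buf)
          R4.bound h3.head (by omega) (by omega) (by omega)
        rw [R4.var, R4.one, Stmt.sem_v hwc, hvc] at S5
        have R5 := R4.setV c (x := m + 1) (by have := hσ.v i; omega)
        refine ⟨_, R5, ((((S1.trans S2).trans S3).trans S4).trans (S5.trans
          (run_jump h3.tail.head))).mono (le_of_eq (by ring))⟩
    obtain ⟨r1, R1, S1⟩ := key _ le_rfl
    have S2 := run_sub (O := O) (b := (Stmt.iter (s.sem (L + 20)) c (σ.v i) σ).buf) R1.bound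
      h1.tail.head (by omega) (by omega) (by omega)
    rw [R1.var, R1.var, hvi, hvc, Nat.sub_self] at S2
    have R2 := R1.scratch (i := 40) (x := 0) (Or.inl rfl) (Nat.zero_le _)
    have S3 := run_jumpZero (O := O) (b := (Stmt.iter (s.sem (L + 20)) c (σ.v i) σ).buf) R2.bound
      h1.tail.tail.head (by omega)
    rw [Function.update_self, if_pos rfl] at S3
    refine ⟨_, R2, ?_⟩
    have hsz : o + (Stmt.loop c i s).size = o + 1 + 1 + 1 + s.size + 1 + 1 := by
      simp only [Stmt.size]; omega
    rw [hsz]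
    refine ((S1.trans S2).trans S3).mono ?_
    have := Nat.mul_le_mul_right (s.time (L + 20) + 4) (hσ.v i)
    simp only [Stmt.time]
    omega

end compile

end RAM

namespace RAM

/-! ### The start of the machine: the input is moved into an array -/

theorem Run.of_eq {m : ℕ} {P : Program} {O : Set (List (Fin m))} {L o o' o₁ o₂ k k' : ℕ}
    {reg reg' : ℕ → ℕ} {b b' : List ℕ} (h : Run P O L o reg b o' reg' b' k) (h1 : o = o₁)
    (h2 : o' = o₂) (hk : k ≤ k') : Run P O L o₁ reg b o₂ reg' b' k' := by
  subst h1 h2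
  exact h.mono hk

/-- Save register `j` in the cell with address `c` plus the content of register `0`. -/
def save (c j : ℕ) : List Instr := [.const 2 c, .add 2 2 0, .store 2 j]

/-- Move the input, which is assumed to start with the symbol `1`, into the array `inp` and set up
the constants of the memory layout. -/
def prelude : List Instr :=
  [.add 0 0 1, .store 0 2] ++ (save 112 3 ++ (save 128 4 ++ (save 144 5 ++ ([.load 3 0] ++
    (save 96 3 ++ (save 80 1 ++ ([.const 2 6, .const 4 160, .add 4 4 0, .const 5 16] ++
    [.sub 3 0 2, .jumpZero 3 29, .load 3 2, .store 4 3, .add 2 2 1, .add 4 4 5, .jump 22,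
      .const 43 64, .add 43 43 0, .const 44 19, .add 44 44 0, .const 45 1, .sub 0 0 1, .const 4 0])))))))

section prelude

variable {m : ℕ} {P : Program} {O : Set (List (Fin m))} {L o : ℕ} {reg : ℕ → ℕ} {b : List ℕ}

/-- Register `2` is the only one free for address computations; this is why it has to be rescued
first. -/
theorem run_save (hb : ∀ x, reg x ≤ 17 * L + 500) (h0 : reg 0 = L + 1) {c j : ℕ}
    (h : CodeAt P o (save c j)) (hc : c ≤ 200) (hj : j ≠ 2) (hj' : j < 64) :
    ∃ reg', Run P O L o reg b (o + 3) reg' b 3 ∧ (∀ x, reg' x ≤ 17 * L + 500) ∧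
      reg' (L + 1 + c) = reg j ∧ ∀ y, y ≠ 2 → y ≠ L + 1 + c → reg' y = reg y := by
  have S1 := run_const (O := O) (b := b) hb h.head (by omega) (by omega)
  have b1 := Rel.bound_update hb 2 (x := c) (by omega)
  have S2 := run_add (O := O) (b := b) b1 h.tail.head (by omega) (by omega) (by omega)
  rw [Function.update_self, Function.update_of_ne (by omega), h0, Function.update_idem] at S2
  have b2 := Rel.bound_update hb 2 (x := c + (L + 1)) (by omega)
  have S3 := run_store (O := O) (b := b) b2 h.tail.tail.head (by omega) hj'
  rw [Function.update_self, Function.update_of_ne hj, add_comm c] at S3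
  rw [add_comm c] at S2 b2
  exact ⟨_, ((S1.trans S2).trans S3).of_eq rfl (by omega) (by omega),
    Rel.bound_update b2 _ (hb _), by simp,
    fun y h2 hy => by rw [Function.update_of_ne hy, Function.update_of_ne h2]⟩

/-- The registers while the input is being moved; the symbols before position `s` are done. -/
structure Moving (L : ℕ) (X : ℕ → ℕ) (s : ℕ) (reg : ℕ → ℕ) : Prop where
  r0 : reg 0 = L + 1
  r1 : reg 1 = 1
  r2 : reg 2 = s
  r4 : reg 4 = L + 65 + 16 * s
  r5 : reg 5 = 16
  src : ∀ y, 6 ≤ y → y ≤ L → reg y = X y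
  inp : ∀ i, reg (L + 65 + 16 * i) = if 1 ≤ i ∧ i < s then X i else 0
  arr : ∀ i k, 0 < k → k < 16 → reg (L + 65 + 16 * i + k) = 0
  low : ∀ y, 6 ≤ y → y < L + 65 → reg y ≤ 20
  bound : ∀ y, reg y ≤ 17 * L + 500

/-- At the start every low register may hold input. The known symbol `1` in register `1` permits
computing `L + 1` in place, the address of an empty cell in which register `2` is parked. The
constants `80`, `96`, `112`, `128`, `144` are `64 + 16 * i`, so that position `i ≤ 5` goes to its
array cell; the copying loop then takes over with six free registers. -/
theorem run_saves {X : ℕ → ℕ} (hL : 5 ≤ L) (h0 : X 0 = L) (h1 : X 1 = 1) (hX : ∀ y, L < y → X y = 0)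
    (hX' : ∀ y, 1 ≤ y → X y ≤ 20) (h : CodeAt P 0 prelude) :
    ∃ reg, Moving L X 6 reg ∧ Run P O L 0 X b 22 reg b 22 := by
  have hb : ∀ y, X y ≤ 17 * L + 500 := by
    intro y
    rcases Nat.eq_zero_or_pos y with rfl | hy
    · omega
    · exact (hX' y hy).trans (by omega)
  have S1 := run_add (O := O) (b := b) hb h.left.head (by omega) (by omega) (by omega)
  rw [h0, h1] at S1
  have B1 := Rel.bound_update hb 0 (x := L + 1) (by omega)
  have S2 := run_store (O := O) (b := b) B1 h.left.tail.head (by omega) (by omega)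
  rw [Function.update_self, Function.update_of_ne (by omega)] at S2
  have B2 := Rel.bound_update B1 (L + 1) (hb 2)
  have F2 : ∀ y, y ≠ 0 → y ≠ L + 1 →
      Function.update (Function.update X 0 (L + 1)) (L + 1) (X 2) y = X y := by
    intro y h1 h2
    rw [Function.update_of_ne h2, Function.update_of_ne h1]
  have E2 : Function.update (Function.update X 0 (L + 1)) (L + 1) (X 2) 0 = L + 1 := by simp
  have G2 : Function.update (Function.update X 0 (L + 1)) (L + 1) (X 2) (L + 1) = X 2 := by simp
  generalize Function.update (Function.update X 0 (L + 1)) (L + 1) (X 2) = r2 at S2 B2 F2 E2 G2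
  obtain ⟨r3, S3, B3, E3, F3⟩ := run_save (O := O) (b := b) B2 E2 h.right.left (by omega)
    (by omega) (by omega)
  obtain ⟨r4, S4, B4, E4, F4⟩ := run_save (O := O) (b := b) B3
    (by rw [F3 _ (by omega) (by omega), E2]) h.right.right.left (by omega) (by omega) (by omega)
  obtain ⟨r5, S5, B5, E5, F5⟩ := run_save (O := O) (b := b) B4
    (by rw [F4 _ (by omega) (by omega), F3 _ (by omega) (by omega), E2])
    h.right.right.right.left (by omega) (by omega) (by omega)
  have Z5 : r5 0 = L + 1 := by
    rw [F5 _ (by omega) (by omega), F4 _ (by omega) (by omega), F3 _ (by omega) (by omega), E2]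
  have S6 := run_load (O := O) (b := b) B5 h.right.right.right.right.left.head (by omega) (by omega)
  rw [Z5] at S6
  have B6 := Rel.bound_update B5 3 (B5 (L + 1))
  have F6 : ∀ y, y ≠ 3 → Function.update r5 3 (r5 (L + 1)) y = r5 y := fun y hy =>
    Function.update_of_ne hy ..
  have E6 : Function.update r5 3 (r5 (L + 1)) 3 = r5 (L + 1) := Function.update_self ..
  generalize Function.update r5 3 (r5 (L + 1)) = r6 at S6 B6 F6 E6
  obtain ⟨r7, S7, B7, E7, F7⟩ := run_save (O := O) (b := b) B6
    (by rw [F6 _ (by omega), Z5]) h.right.right.right.right.right.left (by omega) (by omega)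
    (by omega)
  obtain ⟨r8, S8, B8, E8, F8⟩ := run_save (O := O) (b := b) B7
    (by rw [F7 _ (by omega) (by omega), F6 _ (by omega), Z5])
    h.right.right.right.right.right.right.left (by omega) (by omega) (by omega)
  have F : ∀ y, 6 ≤ y → y ≠ L + 1 → y ≠ L + 1 + 112 → y ≠ L + 1 + 128 → y ≠ L + 1 + 144 →
      y ≠ L + 1 + 96 → y ≠ L + 1 + 80 → r8 y = X y := by
    intro y _ _ _ _ _ _ _
    rw [F8 _ (by omega) (by omega), F7 _ (by omega) (by omega), F6 _ (by omega),
      F5 _ (by omega) (by omega), F4 _ (by omega) (by omega), F3 _ (by omega) (by omega),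
      F2 _ (by omega) (by omega)]
  have H := h.right.right.right.right.right.right.right.left
  have S9 := run_const (O := O) (b := b) B8 H.head (by omega) (by omega)
  have B9 := Rel.bound_update B8 2 (x := 6) (by omega)
  have S10 := run_const (O := O) (b := b) B9 H.tail.head (by omega) (by omega)
  have B10 := Rel.bound_update B9 4 (x := 160) (by omega)
  have S11 := run_add (O := O) (b := b) B10 H.tail.tail.head (by omega) (by omega) (by omega)
  have Z8 : r8 0 = L + 1 := by
    rw [F8 _ (by omega) (by omega), F7 _ (by omega) (by omega), F6 _ (by omega), Z5]
  rw [Function.update_self, Function.update_of_ne (by omega), Function.update_of_ne (by omega), Z8,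
    Function.update_idem] at S11
  have B11 := Rel.bound_update B9 4 (x := 160 + (L + 1)) (by omega)
  have S12 := run_const (O := O) (b := b) B11 H.tail.tail.tail.head (by omega) (by omega)
  have B12 := Rel.bound_update B11 5 (x := 16) (by omega)
  have F12 : ∀ y, y ≠ 2 → y ≠ 4 → y ≠ 5 → Function.update (Function.update (Function.update r8 2 6) 4
      (160 + (L + 1))) 5 16 y = r8 y := by
    intro y _ _ _
    rw [Function.update_of_ne (by omega), Function.update_of_ne (by omega),
      Function.update_of_ne (by omega)]
  refine ⟨_, ?_, (((((((((((S1.trans S2).trans S3).trans S4).trans S5).trans S6).trans S7).trans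
    S8).trans S9).trans S10).trans S11).trans S12).of_eq rfl rfl (by omega)⟩
  refine ⟨?_, ?_, ?_, ?_, ?_, ?_, ?_, ?_, ?_, B12⟩
  · rw [F12 _ (by omega) (by omega) (by omega), Z8]
  · rw [F12 _ (by omega) (by omega) (by omega), F8 _ (by omega) (by omega),
      F7 _ (by omega) (by omega), F6 _ (by omega), F5 _ (by omega) (by omega),
      F4 _ (by omega) (by omega), F3 _ (by omega) (by omega), F2 _ (by omega) (by omega), h1]
  · simp
  · rw [Function.update_of_ne (by omega), Function.update_self]
    omega
  · simp
  · intro y hy hyL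
    rw [F12 _ (by omega) (by omega) (by omega), F _ (by omega) (by omega) (by omega) (by omega)
      (by omega) (by omega) (by omega)]
  · intro i
    rw [F12 _ (by omega) (by omega) (by omega)]
    rcases Nat.lt_or_ge i 6 with hi | hi
    · interval_cases i
      -- Cell `0` stays empty: register `0` holds the length, and the input symbols are numbered
      -- from `1`.
      · rw [F _ (by omega) (by omega) (by omega) (by omega) (by omega) (by omega) (by omega),
          hX _ (by omega), if_neg (by omega)]
      · rw [if_pos (by omega)]
        refine E8.trans ?_
        rw [F7 _ (by omega) (by omega), F6 _ (by omega), F5 _ (by omega) (by omega),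
          F4 _ (by omega) (by omega), F3 _ (by omega) (by omega), F2 _ (by omega) (by omega)]
      · rw [if_pos (by omega), F8 _ (by omega) (by omega)]
        refine E7.trans (E6.trans ?_)
        rw [F5 _ (by omega) (by omega), F4 _ (by omega) (by omega), F3 _ (by omega) (by omega), G2]
      · rw [if_pos (by omega), F8 _ (by omega) (by omega), F7 _ (by omega) (by omega),
          F6 _ (by omega), F5 _ (by omega) (by omega), F4 _ (by omega) (by omega)]
        refine E3.trans ?_
        rw [F2 _ (by omega) (by omega)]
      · rw [if_pos (by omega), F8 _ (by omega) (by omega), F7 _ (by omega) (by omega),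
          F6 _ (by omega), F5 _ (by omega) (by omega)]
        refine E4.trans ?_
        rw [F3 _ (by omega) (by omega), F2 _ (by omega) (by omega)]
      · rw [if_pos (by omega), F8 _ (by omega) (by omega), F7 _ (by omega) (by omega),
          F6 _ (by omega)]
        refine E5.trans ?_
        rw [F4 _ (by omega) (by omega), F3 _ (by omega) (by omega), F2 _ (by omega) (by omega)]
    · rw [F _ (by omega) (by omega) (by omega) (by omega) (by omega) (by omega) (by omega),
        hX _ (by omega), if_neg (by omega)]
  · intro i k hk hk'
    rw [F12 _ (by omega) (by omega) (by omega), F _ (by omega) (by omega) (by omega) (by omega)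
      (by omega) (by omega) (by omega), hX _ (by omega)]
  · intro y hy hy'
    rw [F12 _ (by omega) (by omega) (by omega)]
    by_cases h : y = L + 1
    · rw [h, F8 _ (by omega) (by omega), F7 _ (by omega) (by omega), F6 _ (by omega),
        F5 _ (by omega) (by omega), F4 _ (by omega) (by omega), F3 _ (by omega) (by omega), G2]
      exact hX' 2 (by omega)
    · rw [F _ (by omega) (by omega) (by omega) (by omega) (by omega) (by omega) (by omega)]
      exact hX' y (by omega)

theorem run_move {X : ℕ → ℕ} (hX : ∀ y, 6 ≤ y → X y ≤ 17 * L + 500) (h : CodeAt P 0 prelude)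
    {s : ℕ} (hs : s ≤ L) (hs' : 6 ≤ s) (hM : Moving L X s reg) :
    ∃ reg', Moving L X (s + 1) reg' ∧ Run P O L 22 reg b 22 reg' b 7 := by
  have H : CodeAt P 22 _ := h.right.right.right.right.right.right.right.right
  have S1 := run_sub (O := O) (b := b) hM.bound H.head (by omega) (by omega) (by omega)
  rw [hM.r0, hM.r2] at S1
  have B1 := Rel.bound_update hM.bound 3 (x := L + 1 - s) (by omega)
  have S2 := run_jumpZero (O := O) (b := b) B1 H.tail.head (by omega)
  rw [Function.update_self, if_neg (by omega)] at S2
  have S3 := run_load (O := O) (b := b) B1 H.tail.tail.head (by omega) (by omega)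
  rw [Function.update_of_ne (a := 2) (by omega), hM.r2, Function.update_of_ne (by omega),
    hM.src s hs' hs, Function.update_idem] at S3
  have B3 := Rel.bound_update hM.bound 3 (hX s hs')
  have S4 := run_store (O := O) (b := b) B3 H.tail.tail.tail.head (by omega) (by omega)
  rw [Function.update_self, Function.update_of_ne (by omega), hM.r4] at S4
  have B4 := Rel.bound_update B3 (L + 65 + 16 * s) (hX s hs')
  have S5 := run_add (O := O) (b := b) B4 H.tail.tail.tail.tail.head (by omega) (by omega)
    (by omega)
  have e2 : Function.update (Function.update reg 3 (X s)) (L + 65 + 16 * s) (X s) 2 = s := by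
    rw [Function.update_of_ne (by omega), Function.update_of_ne (by omega), hM.r2]
  have e1 : Function.update (Function.update reg 3 (X s)) (L + 65 + 16 * s) (X s) 1 = 1 := by
    rw [Function.update_of_ne (by omega), Function.update_of_ne (by omega), hM.r1]
  rw [e2, e1] at S5
  have B5 := Rel.bound_update B4 2 (x := s + 1) (by omega)
  have S6 := run_add (O := O) (b := b) B5 H.tail.tail.tail.tail.tail.head (by omega) (by omega)
    (by omega)
  have e4 : Function.update (Function.update (Function.update reg 3 (X s)) (L + 65 + 16 * s) (X s))
      2 (s + 1) 4 = L + 65 + 16 * s := by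
    rw [Function.update_of_ne (by omega), Function.update_of_ne (by omega),
      Function.update_of_ne (by omega), hM.r4]
  have e5 : Function.update (Function.update (Function.update reg 3 (X s)) (L + 65 + 16 * s) (X s))
      2 (s + 1) 5 = 16 := by
    rw [Function.update_of_ne (by omega), Function.update_of_ne (by omega),
      Function.update_of_ne (by omega), hM.r5]
  rw [e4, e5] at S6
  have B6 := Rel.bound_update B5 4 (x := L + 65 + 16 * s + 16) (by omega)
  have S7 := run_jump (O := O) (L := L) (b := b) (reg := Function.update (Function.update
    (Function.update (Function.update reg 3 (X s)) (L + 65 + 16 * s) (X s)) 2 (s + 1)) 4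
    (L + 65 + 16 * s + 16)) H.tail.tail.tail.tail.tail.tail.head
  refine ⟨_, ?_, ((((((S1.trans S2).trans S3).trans S4).trans S5).trans S6).trans S7).of_eq rfl rfl
    (by omega)⟩
  have F : ∀ y, y ≠ 2 → y ≠ 3 → y ≠ 4 → y ≠ L + 65 + 16 * s → Function.update (Function.update
    (Function.update (Function.update reg 3 (X s)) (L + 65 + 16 * s) (X s)) 2 (s + 1)) 4
    (L + 65 + 16 * s + 16) y = reg y := by
    intro y _ _ _ _
    rw [Function.update_of_ne (by omega), Function.update_of_ne (by omega),
      Function.update_of_ne (by omega), Function.update_of_ne (by omega)]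
  refine ⟨?_, ?_, ?_, ?_, ?_, fun y _ _ => ?_, fun i => ?_, fun i k _ _ => ?_, fun y _ _ => ?_,
    B6⟩
  · rw [F _ (by omega) (by omega) (by omega) (by omega), hM.r0]
  · rw [F _ (by omega) (by omega) (by omega) (by omega), hM.r1]
  · rw [Function.update_of_ne (by omega), Function.update_self]
  · rw [Function.update_self]
    omega
  · rw [F _ (by omega) (by omega) (by omega) (by omega), hM.r5]
  · rw [F _ (by omega) (by omega) (by omega) (by omega), hM.src _ (by omega) (by omega)]
  · by_cases hi : i = s
    · subst hi
      rw [Function.update_of_ne (by omega), Function.update_of_ne (by omega), Function.update_self,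
        if_pos (by omega)]
    · rw [F _ (by omega) (by omega) (by omega) (by omega), hM.inp]
      exact if_congr (by omega) rfl rfl
  · rw [F _ (by omega) (by omega) (by omega) (by omega), hM.arr _ _ (by omega) (by omega)]
  · rw [F _ (by omega) (by omega) (by omega) (by omega)]
    exact hM.low _ (by omega) (by omega)

/-- The memory after the input has been moved. -/
structure Initial (L : ℕ) (X : ℕ → ℕ) (σ : Mem) : Prop where
  len : σ.v .len = L
  inp : ∀ i, σ.a .inp i = if 1 ≤ i ∧ i ≤ L then X i else 0
  arr : ∀ k i, k ≠ .inp → σ.a k i = 0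
  buf : σ.buf = []

/-- Scalars other than `len` keep leftovers, which may be input symbols. `Initial` makes no claim
about them; only their size is controlled. -/
theorem run_prelude {X : ℕ → ℕ} (hL : 5 ≤ L) (h0 : X 0 = L) (h1 : X 1 = 1)
    (hX : ∀ y, L < y → X y = 0) (hX' : ∀ y, 1 ≤ y → X y ≤ 20) (h : CodeAt P 0 prelude) :
    ∃ reg σ, Rel L σ reg ∧ Initial L X σ ∧ σ.Bounded (L + 20) ∧
      Run P O L 0 X [] 36 reg [] (7 * L + 40) := by
  obtain ⟨r1, M1, S1⟩ : ∃ reg, Moving L X (L + 1) reg ∧ Run P O L 0 X [] 22 reg [] (22 + 7 * L) := by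
    have key : ∀ s, 6 + s ≤ L + 1 → ∃ reg, Moving L X (6 + s) reg ∧
        Run P O L 0 X [] 22 reg [] (22 + 7 * s) := by
      intro s hs
      induction s with
      | zero => exact run_saves hL h0 h1 hX hX' h
      | succ s ih =>
        obtain ⟨r, M, S⟩ := ih (by omega)
        obtain ⟨r', M', S'⟩ := run_move (O := O) (b := []) (fun y _ => (hX' y (by omega)).trans
          (by omega)) h (by omega) (by omega) M
        exact ⟨r', M', (S.trans S').of_eq rfl rfl (by omega)⟩
    obtain ⟨r, M, S⟩ := key (L - 5) (by omega)
    exact ⟨r, by rwa [show 6 + (L - 5) = L + 1 by omega] at M, S.mono (by omega)⟩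
  have H : CodeAt P 22 _ := h.right.right.right.right.right.right.right.right
  have S2 := run_sub (O := O) (b := []) M1.bound H.head (by omega) (by omega) (by omega)
  rw [M1.r0, M1.r2, Nat.sub_self] at S2
  have B2 := Rel.bound_update M1.bound 3 (x := 0) (by omega)
  have S3 := run_jumpZero (O := O) (b := []) B2 H.tail.head (by omega)
  rw [Function.update_self, if_pos rfl] at S3
  have H' := H.tail.tail.tail.tail.tail.tail.tail
  have F2 : ∀ y, y ≠ 3 → Function.update r1 3 0 y = r1 y := fun y hy => Function.update_of_ne hy ..
  have E2 : Function.update r1 3 0 3 = 0 := Function.update_self ..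
  generalize Function.update r1 3 0 = r2 at S2 S3 B2 F2 E2
  have S4 := run_const (O := O) (b := []) B2 H'.head (by omega) (by omega)
  have B4 := Rel.bound_update B2 43 (x := 64) (by omega)
  have S5 := run_add (O := O) (b := []) B4 H'.tail.head (by omega) (by omega) (by omega)
  rw [Function.update_self, Function.update_of_ne (by omega), F2 _ (by omega), M1.r0,
    Function.update_idem] at S5
  have B5 := Rel.bound_update B2 43 (x := 64 + (L + 1)) (by omega)
  have F5 : ∀ y, y ≠ 43 → Function.update r2 43 (64 + (L + 1)) y = r2 y :=
    fun y hy => Function.update_of_ne hy ..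
  have E5 : Function.update r2 43 (64 + (L + 1)) 43 = 64 + (L + 1) := Function.update_self ..
  generalize Function.update r2 43 (64 + (L + 1)) = r5 at S5 B5 F5 E5
  have S6 := run_const (O := O) (b := []) B5 H'.tail.tail.head (by omega) (by omega)
  have B6 := Rel.bound_update B5 44 (x := 19) (by omega)
  have S7 := run_add (O := O) (b := []) B6 H'.tail.tail.tail.head (by omega) (by omega) (by omega)
  rw [Function.update_self, Function.update_of_ne (by omega), F5 _ (by omega), F2 _ (by omega),
    M1.r0, Function.update_idem] at S7
  have B7 := Rel.bound_update B5 44 (x := 19 + (L + 1)) (by omega)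
  have F7 : ∀ y, y ≠ 44 → Function.update r5 44 (19 + (L + 1)) y = r5 y :=
    fun y hy => Function.update_of_ne hy ..
  have E7 : Function.update r5 44 (19 + (L + 1)) 44 = 19 + (L + 1) := Function.update_self ..
  generalize Function.update r5 44 (19 + (L + 1)) = r7 at S7 B7 F7 E7
  have S8 := run_const (O := O) (b := []) B7 H'.tail.tail.tail.tail.head (by omega) (by omega)
  have B8 := Rel.bound_update B7 45 (x := 1) (by omega)
  have F8 : ∀ y, y ≠ 45 → Function.update r7 45 1 y = r7 y := fun y hy => Function.update_of_ne hy ..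
  have E8 : Function.update r7 45 1 45 = 1 := Function.update_self ..
  generalize Function.update r7 45 1 = r8 at S8 B8 F8 E8
  have S9 := run_sub (O := O) (b := []) B8 H'.tail.tail.tail.tail.tail.head (by omega) (by omega)
    (by omega)
  rw [F8 0 (by omega), F7 _ (by omega), F5 _ (by omega), F2 _ (by omega), M1.r0,
    F8 _ (by omega), F7 _ (by omega), F5 _ (by omega), F2 _ (by omega), M1.r1] at S9
  have B9 := Rel.bound_update B8 0 (x := L + 1 - 1) (by omega)
  have F9 : ∀ y, y ≠ 0 → Function.update r8 0 (L + 1 - 1) y = r8 y :=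
    fun y hy => Function.update_of_ne hy ..
  have E9 : Function.update r8 0 (L + 1 - 1) 0 = L + 1 - 1 := Function.update_self ..
  generalize Function.update r8 0 (L + 1 - 1) = r9 at S9 B9 F9 E9
  -- Register `4` still holds an address above the bound `L + 20` for scalars and therefore has to
  -- be cleared.
  have S10 := run_const (O := O) (b := []) B9 H'.tail.tail.tail.tail.tail.tail.head (by omega)
    (by omega)
  have B10 := Rel.bound_update B9 4 (x := 0) (by omega)
  have F10 : ∀ y, y ≠ 4 → Function.update r9 4 0 y = r9 y := fun y hy => Function.update_of_ne hy ..
  have E10 : Function.update r9 4 0 4 = 0 := Function.update_self ..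
  generalize Function.update r9 4 0 = r at S10 B10 F10 E10
  have S := (((((((((S1.trans S2).trans S3).trans S4).trans S5).trans S6).trans S7).trans S8).trans
    S9).trans S10).of_eq (o₂ := 36) (k' := 7 * L + 40) rfl rfl (by omega)
  have F : ∀ y, y ≠ 0 → y ≠ 3 → y ≠ 4 → y ≠ 43 → y ≠ 44 → y ≠ 45 → r y = r1 y := by
    intro y _ _ _ _ _ _
    rw [F10 _ (by omega), F9 _ (by omega), F8 _ (by omega), F7 _ (by omega), F5 _ (by omega),
      F2 _ (by omega)]
  have hinp : ∀ i, r (L + 65 + 16 * i) = if 1 ≤ i ∧ i ≤ L then X i else 0 := by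
    intro i
    rw [F _ (by omega) (by omega) (by omega) (by omega) (by omega) (by omega), M1.inp]
    exact if_congr (by omega) rfl rfl
  have harr : ∀ (k : Arr) i, k ≠ .inp → r (L + 65 + 16 * i + k.ctorIdx) = 0 := by
    intro k i hk
    have h1 := k.ctorIdx_lt
    have h2 : 0 < k.ctorIdx := Nat.pos_of_ne_zero fun h => hk (Arr.ctorIdx_inj (h.trans rfl))
    rw [F _ (by omega) (by omega) (by omega) (by omega) (by omega) (by omega),
      M1.arr _ _ h2 h1]
  have h00 : r 0 = L := by
    rw [F10 _ (by omega), E9]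
    omega
  refine ⟨r, ⟨fun x => r x.ctorIdx, fun k i => r (L + 65 + 16 * i + k.ctorIdx), []⟩,
    ⟨fun _ => rfl, fun _ _ => rfl, ?_, ?_, ?_, B10⟩, ⟨h00, hinp, harr, rfl⟩, ⟨fun x => ?_,
    fun k i => ?_⟩, S⟩
  · rw [F10 _ (by omega), F9 _ (by omega), F8 _ (by omega), F7 _ (by omega), E5]
    omega
  · rw [F10 _ (by omega), F9 _ (by omega), F8 _ (by omega), E7]
    omega
  · rw [F10 _ (by omega), F9 _ (by omega), E8]
  · change r x.ctorIdx ≤ L + 20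
    have hx := x.ctorIdx_lt
    generalize x.ctorIdx = y at hx
    rcases Nat.lt_or_ge y 6 with hy | hy
    · interval_cases y
      · omega
      · rw [F _ (by omega) (by omega) (by omega) (by omega) (by omega) (by omega), M1.r1]
        omega
      · rw [F _ (by omega) (by omega) (by omega) (by omega) (by omega) (by omega), M1.r2]
        omega
      · rw [F10 _ (by omega), F9 _ (by omega), F8 _ (by omega), F7 _ (by omega), F5 _ (by omega),
          E2]
        omega
      · omega
      · rw [F _ (by omega) (by omega) (by omega) (by omega) (by omega) (by omega), M1.r5]
        omega
    · rw [F _ (by omega) (by omega) (by omega) (by omega) (by omega) (by omega)]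
      exact (M1.low _ hy (by omega)).trans (by omega)
  · change r (L + 65 + 16 * i + k.ctorIdx) ≤ L + 20
    by_cases hk : k = .inp
    · subst hk
      refine (hinp i).trans_le ?_
      split_ifs with hi
      · exact (hX' i hi.1).trans (by omega)
      · exact Nat.zero_le _
    · rw [harr k i hk]
      exact Nat.zero_le _

end prelude

/-! ### The main loop -/

/-- Repeating `f` from the memory `σ` outputs the words `ws` and then halts. It takes at most `r`
rounds until the first output, and at most `D` rounds between outputs and after the last one. -/
inductive Loops (f : Mem → Mem) (D : ℕ) : ℕ → Mem → List (List ℕ) → Prop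
  | halt {r σ} (h1 : (f σ).v .out = 0) (h2 : (f σ).v .go = 0) : Loops f D (r + 1) σ []
  | next {r σ ws} (h1 : (f σ).v .out = 0) (h2 : (f σ).v .go ≠ 0) (h : Loops f D r (f σ) ws) :
    Loops f D (r + 1) σ ws
  | output {r σ ws} (h1 : (f σ).v .out ≠ 0) (h2 : (f σ).v .go ≠ 0)
    (h : Loops f D D (f σ).flush ws) : Loops f D (r + 1) σ ((f σ).buf :: ws)

end RAM

namespace RAM

theorem Loops.mono {f : Mem → Mem} {D r r' : ℕ} {σ : Mem} {ws : List (List ℕ)}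
    (h : Loops f D r σ ws) (hr : r ≤ r') : Loops f D r' σ ws := by
  induction h generalizing r' with
  | halt h1 h2 =>
    obtain _ | r' := r'
    · omega
    · exact .halt h1 h2
  | next h1 h2 h ih =>
    obtain _ | r' := r'
    · omega
    · exact .next h1 h2 (ih (by omega))
  | output h1 h2 h _ =>
    obtain _ | r' := r'
    · omega
    · exact .output h1 h2 h

/-- The code that runs `body` at line `o` in a loop. -/
def loopCode (body : Stmt) (o : ℕ) : List Instr :=
  body.compile o ++ [.jumpZero Var.out.ctorIdx (o + body.size + 2), .emit,
    .jumpZero Var.go.ctorIdx (o + body.size + 4), .jump o]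

/-- Here `t` is the time of the last output, and `ht` is a budget: even if all `r` remaining rounds
are used, the next event comes at most `d` after `t`. An output resets the budget to `D` rounds, and
the additional round in `hd` pays for the rest of the round that made the output. -/
theorem run_loops {m : ℕ} {P : Program} {O : Set (List (Fin m))} {L o : ℕ} {body : Stmt}
    (hw : body.WF) (hcode : CodeAt P o (loopCode body o)) (hlen : P.length = o + body.size + 4)
    {D d : ℕ} (hd : (D + 1) * ((body.time (L + 20) + 4) * stepCost L) ≤ d) {r : ℕ} {σ : Mem}
    {ws : List (List ℕ)} (h : Loops (body.sem (L + 20)) D r σ ws) {c : Config}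
    (hσ : σ.Bounded (L + 20)) (hR : Rel L σ c.reg) (hbuf : c.buf = σ.buf) (hpc : c.pc = o) {t : ℕ}
    (ht : c.time + r * ((body.time (L + 20) + 4) * stepCost L) ≤ t + d) :
    ∃ N c', (step P O)^[N] c = c' ∧ P.length ≤ c'.pc ∧ c'.querySize = c.querySize ∧
      ∃ ts, c'.outs = c.outs ++ ts ∧ ts.map Prod.snd = ws ∧
        List.IsChain (fun s t => t ≤ s + d) (t :: (ts.map Prod.fst ++ [c'.time])) := by
  induction h generalizing c t with
  | @halt r σ h1 h2 =>
    obtain ⟨r1, R1, S1⟩ := run_compile (O := O) body hw hσ hR hcode.left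
    have hc := hcode.right
    rw [Stmt.length_compile] at hc
    have S2 := run_jumpZero (O := O) (b := (body.sem (L + 20) σ).buf) R1.bound hc.head (by decide)
    rw [R1.var, if_pos h1] at S2
    have S3 := run_jumpZero (O := O) (b := (body.sem (L + 20) σ).buf) R1.bound hc.tail.tail.head
      (by decide)
    rw [R1.var, if_pos h2] at S3
    obtain ⟨N, c', e1, e2, e3, e4, e5, e6, e7⟩ := ((S1.trans S2).trans S3) c hpc rfl hbuf
    refine ⟨N, c', e1, by omega, e6, [], by simpa using e5, rfl, ?_⟩
    have : (body.time (L + 20) + 1 + 1) * stepCost L ≤ (body.time (L + 20) + 4) * stepCost L :=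
      Nat.mul_le_mul_right _ (by omega)
    rw [add_mul r, one_mul] at ht
    simp only [List.map_nil, List.nil_append, List.isChain_cons_cons, List.isChain_singleton,
      and_true]
    omega
  | @next r σ ws h1 h2 h ih =>
    obtain ⟨r1, R1, S1⟩ := run_compile (O := O) body hw hσ hR hcode.left
    have hc := hcode.right
    rw [Stmt.length_compile] at hc
    have S2 := run_jumpZero (O := O) (b := (body.sem (L + 20) σ).buf) R1.bound hc.head (by decide)
    rw [R1.var, if_pos h1] at S2
    have S3 := run_jumpZero (O := O) (b := (body.sem (L + 20) σ).buf) R1.bound hc.tail.tail.head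
      (by decide)
    rw [R1.var, if_neg h2] at S3
    have S4 := run_jump (O := O) (L := L) (reg := r1) (b := (body.sem (L + 20) σ).buf)
      hc.tail.tail.tail.head
    obtain ⟨N, c', e1, e2, e3, e4, e5, e6, e7⟩ := (((S1.trans S2).trans S3).trans S4) c hpc rfl hbuf
    have : (body.time (L + 20) + 1 + 1 + 1) * stepCost L ≤
        (body.time (L + 20) + 4) * stepCost L :=
      Nat.mul_le_mul_right _ (by omega)
    rw [add_mul r, one_mul] at ht
    obtain ⟨N', c'', e1', e2', e3', ts, e4', e5', e6'⟩ := ih (c := c') (t := t)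
      (Stmt.bounded_sem (by omega) hw hσ) (e3 ▸ R1) e4 e2 (by omega)
    refine ⟨N' + N, c'', ?_, e2', e3'.trans e6, ts, by rw [e4', e5], e5', e6'⟩
    rw [Function.iterate_add_apply, e1, e1']
  | @output r σ ws h1 h2 h ih =>
    obtain ⟨r1, R1, S1⟩ := run_compile (O := O) body hw hσ hR hcode.left
    have hc := hcode.right
    rw [Stmt.length_compile] at hc
    have S2 := run_jumpZero (O := O) (b := (body.sem (L + 20) σ).buf) R1.bound hc.head (by decide)
    rw [R1.var, if_neg h1] at S2
    obtain ⟨N, c1, e1, e2, e3, e4, e5, e6, e7⟩ := (S1.trans S2) c hpc rfl hbuf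
    have hem : P[c1.pc]? = some .emit := by rw [e2]; exact hc.tail.head
    have S3 := run_jumpZero (O := O) (b := []) R1.bound hc.tail.tail.head (by decide)
    rw [R1.var, if_neg h2] at S3
    have S4 := run_jump (O := O) (L := L) (reg := r1) (b := []) hc.tail.tail.tail.head
    obtain ⟨N', c2, f1, f2, f3, f4, f5, f6, f7⟩ := (S3.trans S4) (step P O c1)
      (by rw [step_eq hem]; exact congrArg (· + 1) e2) (by rw [step_eq hem]; exact e3)
      (by rw [step_eq hem]; rfl)
    have hR2 : Rel L (body.sem (L + 20) σ).flush c2.reg := f3 ▸ R1.congr rfl rfl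
    have hb2 := Stmt.bounded_sem (B := L + 20) (by omega) hw hσ
    have ht1 : (step P O c1).time = c1.time + 1 := by rw [step_eq hem]; rfl
    -- The cost of an instruction is charged before its effect, so the recorded time includes the
    -- `emit` itself.
    have ho1 : (step P O c1).outs = c1.outs ++ [(c1.time + 1, c1.buf)] := by
      rw [step_eq hem]; rfl
    have hq1 : (step P O c1).querySize = c1.querySize := by rw [step_eq hem]; rfl
    have hs : 1 ≤ stepCost L := by unfold stepCost; omega
    have hT : (body.time (L + 20) + 1) * stepCost L + 3 * stepCost L =
      (body.time (L + 20) + 4) * stepCost L := by ring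
    have hT' : (1 + 1) * stepCost L ≤ (body.time (L + 20) + 4) * stepCost L :=
      Nat.mul_le_mul_right _ (by omega)
    rw [add_mul r, one_mul] at ht
    rw [add_mul D, one_mul] at hd
    obtain ⟨N'', c'', e1', e2', e3', ts, e4', e5', e6'⟩ := ih (c := c2) (t := (step P O c1).time)
      ⟨hb2.v, hb2.a⟩ hR2 f4 f2 (by omega)
    refine ⟨N'' + (N' + (1 + N)), c'', ?_, e2', by rw [e3', f6, hq1, e6],
      (c1.time + 1, c1.buf) :: ts, ?_, ?_, ?_⟩
    · rw [Function.iterate_add_apply, Function.iterate_add_apply, Function.iterate_add_apply, e1,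
        Function.iterate_one, f1, e1']
    · rw [e4', f5, ho1, e5]
      simp
    · rw [List.map_cons, e5', e4]
    · rw [ht1] at e6'
      simp only [List.map_cons, List.cons_append, List.isChain_cons_cons]
      exact ⟨by omega, e6'⟩

/-- The program that runs `init` once and then `body` in a loop. -/
def machine (init body : Stmt) : Program :=
  prelude ++ (init.compile 36 ++ loopCode body (36 + init.size))

theorem time_eq_eval (s : Stmt) : ∃ p : Polynomial ℕ, ∀ L, s.time (L + 20) = p.eval L := by
  induction s with
  | seq s t hs ht =>
    obtain ⟨p, hp⟩ := hs
    obtain ⟨q, hq⟩ := ht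
    exact ⟨p + q, fun L => by simp [Stmt.time, hp, hq]⟩
  | ifz i s t hs ht =>
    obtain ⟨p, hp⟩ := hs
    obtain ⟨q, hq⟩ := ht
    exact ⟨p + q + 2, fun L => by simp [Stmt.time, hp, hq]⟩
  | loop c i s hs =>
    obtain ⟨p, hp⟩ := hs
    exact ⟨(Polynomial.X + 20) * (p + 4) + 3, fun L => by simp [Stmt.time, hp]⟩
  | _ => exact ⟨9, fun L => by simp [Stmt.time]⟩

/-- The delay of `machine init body` on inputs of length `L`, for `D` rounds between outputs. -/
def delay (init body : Stmt) (D L : ℕ) : ℕ :=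
  (7 * L + 40 + init.time (L + 20)) * stepCost L +
    (D + 1) * ((body.time (L + 20) + 4) * stepCost L)

theorem delay_eq_eval (init body : Stmt) : ∃ p : Polynomial ℕ, ∀ L,
    delay init body (2 * L + 3) L = p.eval L := by
  obtain ⟨p, hp⟩ := time_eq_eval init
  obtain ⟨q, hq⟩ := time_eq_eval body
  refine ⟨(7 * Polynomial.X + 40 + p) * (34 * Polynomial.X + 1200) +
    (2 * Polynomial.X + 3 + 1) * ((q + 4) * (34 * Polynomial.X + 1200)), fun L => ?_⟩
  simp [delay, hp, hq, stepCost]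

theorem start_reg {k : ℕ} (x : List (Fin k)) (i : ℕ) :
    (start x).reg (i + 1) = ((x.map Fin.val)[i]?).getD 0 := by
  simp [start]

/-- The list of outputs is specified only through the set `Q`, as the order depends on details of
the search that play no role. -/
theorem machine_run {k m : ℕ} (O : Set (List (Fin m))) {init body : Stmt} (hi : init.WF)
    (hb : body.WF) {x : List (Fin k)} (hk : k ≤ 20) (hx : 5 ≤ x.length) (h1 : (start x).reg 1 = 1)
    {D : ℕ} {Q : Set (List (List ℕ))}
    (h : ∀ σ, Initial x.length (start x).reg σ → σ.Bounded (x.length + 20) →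
      (init.sem (x.length + 20) σ).buf = [] ∧
      ∃ ws ∈ Q, Loops (body.sem (x.length + 20)) D D (init.sem (x.length + 20) σ) ws) :
    ∃ c, HaltsWith (machine init body) O x c ∧ c.outs.map Prod.snd ∈ Q ∧
      List.IsChain (fun s t => t ≤ s + delay init body D x.length)
        (0 :: (c.outs.map Prod.fst ++ [c.time])) ∧ c.querySize = 0 := by
  have hcode : CodeAt (machine init body) 0
      (prelude ++ (init.compile 36 ++ loopCode body (36 + init.size))) :=
    ⟨[], [], by simp [machine], rfl⟩
  obtain ⟨r1, σ, R1, hI, hσ, S1⟩ := run_prelude (O := O) (P := machine init body)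
    (X := (start x).reg) hx (by simp [start]) h1 (fun y hy => by
      obtain _ | y := y
      · omega
      · rw [start_reg, List.getElem?_eq_none (by simp; omega)]
        rfl) (fun y hy => by
      obtain _ | y := y
      · omega
      · rw [start_reg, List.getElem?_map]
        rcases x[y]? with _ | a
        · simp
        · have := a.2
          simp
          omega) hcode.left
  have hc2 : CodeAt (machine init body) 36 (init.compile 36 ++ loopCode body (36 + init.size)) :=
    hcode.right
  obtain ⟨r2, R2, S2⟩ := run_compile (O := O) init hi hσ R1 hc2.left
  have hc3 := hc2.right
  rw [Stmt.length_compile] at hc3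
  rw [hI.buf] at S2
  obtain ⟨hbuf, ws, hws, hL⟩ := h σ hI hσ
  obtain ⟨N, c, e1, e2, e3, e4, e5, e6, e7⟩ := (S1.trans S2) (start x) rfl rfl rfl
  obtain ⟨N', c', f1, f2, f3, ts, f4, f5, f6⟩ := run_loops (O := O) (t := 0)
    (d := delay init body D x.length) hb hc3 (by
      simp [machine, loopCode, Stmt.length_compile, prelude, save]
      omega) (Nat.le_add_left _ _) hL (c := c)
    (Stmt.bounded_sem (by omega) hi hσ) (e3 ▸ R2) e4 e2 (by
      have : (start x).time = 0 := rfl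
      have hD : D * ((body.time (x.length + 20) + 4) * stepCost x.length) ≤
        (D + 1) * ((body.time (x.length + 20) + 4) * stepCost x.length) :=
      Nat.mul_le_mul_right _ (by omega)
      simp only [delay]
      omega)
  have ho : c'.outs = ts := by
    rw [f4, e5]
    rfl
  refine ⟨c', ⟨f2, N' + N, ?_⟩, by rw [ho, f5]; exact hws, by rw [ho]; exact f6, by rw [f3, e6]; rfl⟩
  rw [Function.iterate_add_apply, e1, f1]

theorem step_eq_self {m : ℕ} {P : Program} {O : Set (List (Fin m))} {c : Config}
    (h : P.length ≤ c.pc) : step P O c = c := by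
  simp [step, List.getElem?_eq_none h]

/-- A halted configuration is a fixed point of `step`, so two final configurations of the same run
agree. -/
theorem HaltsWith.unique {k m : ℕ} {P : Program} {O : Set (List (Fin m))} {x : List (Fin k)}
    {c c' : Config} (h : HaltsWith P O x c) (h' : HaltsWith P O x c') : c = c' := by
  have key : ∀ {c c' : Config} {N N' : ℕ}, P.length ≤ c.pc → (step P O)^[N] (start x) = c →
      (step P O)^[N'] (start x) = c' → N ≤ N' → c = c' := by
    intro c c' N N' h1 h2 h3 hN
    obtain ⟨j, rfl⟩ := Nat.exists_eq_add_of_le' hN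
    rw [Function.iterate_add_apply, h2, Function.iterate_fixed (step_eq_self h1)] at h3
    exact h3
  obtain ⟨h1, N, h2⟩ := h
  obtain ⟨h1', N', h2'⟩ := h'
  rcases le_total N N' with hN | hN
  · exact key h1 h2 h2' hN
  · exact (key h1' h2' h2 hN).symm

end RAM

namespace RAM

/-! ### Solving the game -/

namespace Stmt

/-- Sequential composition of a list of statements. -/
def block : List Stmt → Stmt
  | [] => .skip
  | s :: l => .seq s (block l)

/-- Clear the arrays `good` and `bad`. -/
def diaClear : Stmt :=
  .loop .row .num (block [.set .tmp 0, .store .good .row .tmp, .store .bad .row .tmp])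

/-- Mark in `good` the sources of the remaining edges into `cur`, and in `bad` the sources of the
chosen edges that do not lead into `cur`. -/
def diaEdges : Stmt :=
  .loop .edge .sq (block [.load .val .stat .edge, .ifz .val .skip (block [
    .load .aux .tgt .edge, .load .aux .cur .aux, .load .tmp .src .edge, .sub .val .val .one,
    .ifz .aux (.ifz .val .skip (.store .bad .tmp .one)) (.store .good .tmp .one)])])

/-- Combine `good` and `bad`. -/
def diaCombine : Stmt :=
  .loop .row .num (block [.load .val .good .row, .load .aux .bad .row,
    .ifz .aux .skip (.set .val 0), .store .nxt .row .val])

/-- Compute in `nxt` the worlds that can be given successors in `cur`. -/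
def diaStep : Stmt := block [diaClear, diaEdges, diaCombine]

/-- Add to `cur` the worlds that can be given successors in `cur`. -/
def attrStep : Stmt := block [diaStep,
  .loop .row .num (block [.load .tmp .nxt .row, .ifz .tmp .skip (.store .cur .row .tmp)])]

/-- Move `nxt` to `cur`, restricted to `lab` if `f` is not zero. -/
def restrict (f : Var) : Stmt :=
  .loop .row .num (block [.load .tmp .nxt .row,
    .ifz f .skip (block [.load .val .lab .row, .ifz .val (.set .tmp 0) .skip]),
    .store .cur .row .tmp])

/-- One round of the iteration from above. -/
def round (f steps : Var) : Stmt := block [diaStep, restrict f, .loop .cnt steps attrStep]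

/-- Compute in `ans` whether the game is won from the root. -/
def test : Stmt := block [.loop .row .num (.store .cur .row .one),
  .loop .cnt₂ .num (round .glob .inner), round .one .outer, .load .ans .cur .root]

end Stmt

open Stmt

/-- The scalars and arrays that describe the edges of the complete graph on `n` worlds. -/
structure Graph (n : ℕ) (σ : Mem) : Prop where
  num : σ.v .num = n
  sq : σ.v .sq = n * n
  one : σ.v .one = 1
  src : ∀ e < n * n, σ.a .src e = e / n
  tgt : ∀ e < n * n, σ.a .tgt e = e % n

/-- The statement keeps the description of the complete graph. -/
def Stmt.keepsGraph (s : Stmt) : Bool :=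
  !s.writesV .num && !s.writesV .sq && !s.writesV .one && !s.writesA .src && !s.writesA .tgt

theorem Graph.sem {n B : ℕ} {σ : Mem} (h : Graph n σ) (s : Stmt) (hs : s.keepsGraph) :
    Graph n (s.sem B σ) := by
  simp only [Stmt.keepsGraph, Bool.and_eq_true, Bool.not_eq_true'] at hs
  obtain ⟨⟨⟨⟨h1, h2⟩, h3⟩, h4⟩, h5⟩ := hs
  exact ⟨by rw [sem_v h1, h.num], by rw [sem_v h2, h.sq], by rw [sem_v h3, h.one],
    by rw [sem_a h4]; exact h.src, by rw [sem_a h5]; exact h.tgt⟩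

variable {n B : ℕ} {σ : Mem}

theorem diaClear_spec : ∀ i < σ.v .num, (diaClear.sem B σ).a .good i = 0 ∧
    (diaClear.sem B σ).a .bad i = 0 := by
  refine loop_rule (fun m τ => ∀ i < m, τ.a .good i = 0 ∧ τ.a .bad i = 0) (by simp) ?_
  intro m τ hm hc hv ha hb hP i hi
  simp only [block, Stmt.sem, Mem.setV_v, Mem.setV_a, Mem.setA_a, Mem.setA_v, reduceCtorEq, if_true,
    if_false, hc, Function.update_apply]
  split_ifs with him
  · exact ⟨rfl, rfl⟩
  · exact hP i (by omega)

/-- One pass over the edges evaluates the existential clause of `dia` for all worlds in `good` and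
the negation of the universal clause in `bad`. -/
theorem diaEdges_spec (h : Graph n σ) (h0 : ∀ i < n, σ.a .good i = 0 ∧ σ.a .bad i = 0) :
    ∀ i < n, ((diaEdges.sem B σ).a .good i ≠ 0 ↔
      ∃ e < n * n, e / n = i ∧ σ.a .stat e ≠ 0 ∧ σ.a .cur (e % n) ≠ 0) ∧
    ((diaEdges.sem B σ).a .bad i ≠ 0 ↔
      ∃ e < n * n, e / n = i ∧ 2 ≤ σ.a .stat e ∧ σ.a .cur (e % n) = 0) := by
  have key := loop_rule (B := B) (c := .edge) (i := .sq) (σ := σ) (s := block [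
      .load .val .stat .edge, .ifz .val .skip (block [
    .load .aux .tgt .edge, .load .aux .cur .aux, .load .tmp .src .edge, .sub .val .val .one,
    .ifz .aux (.ifz .val .skip (.store .bad .tmp .one)) (.store .good .tmp .one)])])
    (fun m τ => ∀ i < n, (τ.a .good i ≠ 0 ↔
      ∃ e < m, e / n = i ∧ σ.a .stat e ≠ 0 ∧ σ.a .cur (e % n) ≠ 0) ∧
    (τ.a .bad i ≠ 0 ↔ ∃ e < m, e / n = i ∧ 2 ≤ σ.a .stat e ∧ σ.a .cur (e % n) = 0))
    (by intro i hi; simp [h0 i hi]) ?_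
  · rwa [h.sq] at key
  intro m τ hm hc hv ha hb hP i hi
  rw [h.sq] at hm
  have e1 := h.src m hm
  have e2 := h.tgt m hm
  have e3 := h.one
  rw [← ha .src rfl] at e1
  rw [← ha .tgt rfl] at e2
  rw [← hv .one rfl] at e3
  rw [← ha .stat rfl, ← ha .cur rfl] at hP ⊢
  obtain ⟨h1, h2⟩ := hP i hi
  simp only [Nat.lt_succ_iff_lt_or_eq, or_and_right, exists_or, exists_eq_left, ← h1, ← h2]
  simp only [block, Stmt.sem, Mem.setV_v, Mem.setV_a, reduceCtorEq, if_true, if_false, hc]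
  by_cases hs : τ.a .stat m = 0
  · simp [hs]
  · by_cases hcur : τ.a .cur (m % n) = 0
    · by_cases hs' : τ.a .stat m - 1 = 0
      · simp [hs, hcur, hs', e2, e3]
        omega
      · have : 2 ≤ τ.a .stat m := by omega
        by_cases hi' : i = m / n
        · simp [hs, hcur, hs', e1, e2, e3, hi', this]
        · simp [hs, hcur, hs', e1, e2, e3, hi', Ne.symm hi']
    · by_cases hi' : i = m / n
      · simp [hs, hcur, e1, e2, e3, hi']
      · simp [hs, hcur, e1, e2, e3, hi', Ne.symm hi']

theorem diaCombine_spec : ∀ i < σ.v .num, (diaCombine.sem B σ).a .nxt i ≠ 0 ↔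
    σ.a .good i ≠ 0 ∧ σ.a .bad i = 0 := by
  refine loop_rule (fun m τ => ∀ i < m, τ.a .nxt i ≠ 0 ↔ σ.a .good i ≠ 0 ∧ σ.a .bad i = 0)
    (by simp) ?_
  intro m τ hm hc hv ha hb hP i hi
  rw [← ha .good rfl, ← ha .bad rfl] at hP ⊢
  by_cases him : i = m
  · subst him
    by_cases hbad : τ.a .bad i = 0 <;> simp [block, Stmt.sem, hc, hbad]
  · have := hP i (by omega)
    by_cases hbad : τ.a .bad m = 0 <;> simpa [block, Stmt.sem, hc, hbad, him] using this

theorem diaStep_spec_edges (h : Graph n σ) {i : ℕ} (hi : i < n) :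
    (diaStep.sem B σ).a .nxt i ≠ 0 ↔
      (∃ e < n * n, e / n = i ∧ σ.a .stat e ≠ 0 ∧ σ.a .cur (e % n) ≠ 0) ∧
        ∀ e < n * n, e / n = i → 2 ≤ σ.a .stat e → σ.a .cur (e % n) ≠ 0 := by
  have h1 := h.sem (B := B) diaClear rfl
  have h2 := h1.sem (B := B) diaEdges rfl
  have e1 := diaEdges_spec (B := B) h1 (by simpa only [h.num] using diaClear_spec (σ := σ)) i hi
  have e2 := diaCombine_spec (B := B) (σ := diaEdges.sem B (diaClear.sem B σ)) i (by rwa [h2.num])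
  change (diaCombine.sem B (diaEdges.sem B (diaClear.sem B σ))).a .nxt i ≠ 0 ↔ _
  have e3 := not_iff_not.2 e1.2
  rw [not_not] at e3
  rw [e2, e1.1, e3, sem_a (s := diaClear) (k := .stat) rfl,
    sem_a (s := diaClear) (k := .cur) rfl]
  push Not
  rfl

/-- The subset of `Fin n` whose characteristic function is `f`. -/
def toSet (n : ℕ) (f : ℕ → ℕ) : Set (Fin n) := {i | f i ≠ 0}

/-- The transitions that are not deleted according to the status array `f`. -/
def remRel (n : ℕ) (f : ℕ → ℕ) (v w : Fin n) : Prop := f (v * n + w) ≠ 0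

/-- The transitions that are chosen according to the status array `f`. -/
def inRel (n : ℕ) (f : ℕ → ℕ) (v w : Fin n) : Prop := 2 ≤ f (v * n + w)

theorem edge_lt (v w : Fin n) : (v : ℕ) * n + w < n * n := by
  have h := Nat.mul_le_mul_right n (Nat.succ_le_of_lt v.2)
  have := w.2
  rw [Nat.succ_mul] at h
  omega

theorem edge_div (v w : Fin n) : ((v : ℕ) * n + w) / n = v := by
  rw [Nat.mul_comm, Nat.mul_add_div (by have := v.2; omega), Nat.div_eq_of_lt w.2, add_zero]

theorem edge_mod (v w : Fin n) : ((v : ℕ) * n + w) % n = w := by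
  rw [Nat.mul_comm, Nat.mul_add_mod, Nat.mod_eq_of_lt w.2]

theorem exists_edge {e : ℕ} (he : e < n * n) : ∃ v w : Fin n, e = v * n + w :=
  ⟨⟨e / n, Nat.div_lt_of_lt_mul he⟩, ⟨e % n, Nat.mod_lt _ (Nat.pos_of_mul_pos_left (by omega : 0 < n * n))⟩,
    by simpa [Nat.mul_comm] using (Nat.div_add_mod e n).symm⟩

theorem forall_edge {p : ℕ → Prop} : (∀ e < n * n, p e) ↔ ∀ v w : Fin n, p (v * n + w) :=
  ⟨fun h v w => h _ (edge_lt v w), fun h e he => by obtain ⟨v, w, rfl⟩ := exists_edge he; exact h v w⟩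

theorem exists_edge_iff {p : ℕ → Prop} : (∃ e < n * n, p e) ↔ ∃ v w : Fin n, p (v * n + w) :=
  ⟨fun ⟨e, he, h⟩ => by obtain ⟨v, w, rfl⟩ := exists_edge he; exact ⟨v, w, h⟩,
    fun ⟨v, w, h⟩ => ⟨_, edge_lt v w, h⟩⟩

theorem diaStep_spec (h : Graph n σ) : toSet n ((diaStep.sem B σ).a .nxt) =
    Kripke.dia (remRel n (σ.a .stat)) (inRel n (σ.a .stat)) (toSet n (σ.a .cur)) := by
  ext i
  refine (diaStep_spec_edges h i.2).trans ?_
  rw [exists_edge_iff, forall_edge]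
  simp only [edge_div, edge_mod, Kripke.dia, Set.mem_ofPred_eq, toSet, remRel, inRel, Fin.val_inj]
  constructor
  · rintro ⟨⟨v, w, rfl, h1, h2⟩, h3⟩
    exact ⟨⟨w, h1, h2⟩, fun w hw => h3 _ w rfl hw⟩
  · rintro ⟨⟨w, h1, h2⟩, h3⟩
    exact ⟨⟨i, w, rfl, h1, h2⟩, fun v w hv hw => by subst hv; exact h3 w hw⟩

/-- Updating `cur` in place is harmless, because `nxt` has been computed completely before the pass.
-/
theorem attrStep_spec (h : Graph n σ) : toSet n ((attrStep.sem B σ).a .cur) =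
    toSet n (σ.a .cur) ∪
      Kripke.dia (remRel n (σ.a .stat)) (inRel n (σ.a .stat)) (toSet n (σ.a .cur)) := by
  have h1 := h.sem (B := B) diaStep rfl
  rw [← diaStep_spec (B := B) h]
  have e : σ.a .cur = (diaStep.sem B σ).a .cur := (sem_a rfl).symm
  rw [e]
  generalize hτ : diaStep.sem B σ = τ at *
  have key := loop_rule (B := B) (c := .row) (i := .num) (σ := τ) (s := block [.load .tmp .nxt .row,
    .ifz .tmp .skip (.store .cur .row .tmp)])
    (fun m ρ => ∀ i, ρ.a .cur i ≠ 0 ↔ τ.a .cur i ≠ 0 ∨ i < m ∧ τ.a .nxt i ≠ 0) (by simp) ?_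
  · ext i
    have := key i
    rw [h1.num] at this
    change ((loop .row .num _).sem B (diaStep.sem B σ)).a .cur i ≠ 0 ↔ _
    rw [hτ]
    simpa only [toSet, Set.mem_union, Set.mem_ofPred_eq, i.2, true_and] using this
  · intro m ρ hm hc hv ha hb hP i
    rw [← ha .nxt rfl] at hP ⊢
    have := hP i
    by_cases hx : ρ.a .nxt m = 0
    · by_cases him : i = m
      · subst him
        simpa [block, Stmt.sem, hc, hx] using this
      · have hle : i ≤ m ↔ i < m := by omega
        simpa [block, Stmt.sem, hc, hx, Nat.lt_succ_iff, hle, him] using this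
    · by_cases him : i = m
      · subst him
        simp [block, Stmt.sem, hc, hx]
      · have hle : i ≤ m ↔ i < m := by omega
        simpa [block, Stmt.sem, hc, hx, Nat.lt_succ_iff, hle, him] using this

theorem restrict_spec (h : Graph n σ) {f : Var} (h1 : f ≠ .row) (h2 : f ≠ .tmp) (h3 : f ≠ .val) :
    toSet n (((restrict f).sem B σ).a .cur) =
      (if σ.v f = 0 then Set.univ else toSet n (σ.a .lab)) ∩ toSet n (σ.a .nxt) := by
  have key := loop_rule (B := B) (c := .row) (i := .num) (σ := σ) (s := block [.load .tmp .nxt .row,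
    .ifz f .skip (block [.load .val .lab .row, .ifz .val (.set .tmp 0) .skip]),
    .store .cur .row .tmp])
    (fun m τ => ∀ i < m, τ.a .cur i ≠ 0 ↔ (σ.v f = 0 ∨ σ.a .lab i ≠ 0) ∧ σ.a .nxt i ≠ 0)
    (by simp) ?_
  · ext i
    refine (key i (by rw [h.num]; exact i.2)).trans ?_
    by_cases hf : σ.v f = 0 <;> simp [hf, toSet]
  · intro m τ hm hc hv ha hb hP i hi
    rw [← ha .nxt rfl, ← ha .lab rfl, ← hv f (by simp [writesV, block, h1, h2, h3])] at hP ⊢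
    by_cases him : i = m
    · subst him
      by_cases hf : τ.v f = 0
      · simp [block, Stmt.sem, hc, h2, hf]
      · by_cases hl : τ.a .lab i = 0 <;> simp [block, Stmt.sem, hc, h2, hf, hl]
    · have := hP i (by omega)
      by_cases hf : τ.v f = 0
      · simpa [block, Stmt.sem, hc, h2, hf, him] using this
      · by_cases hl : τ.a .lab m = 0 <;> simpa [block, Stmt.sem, hc, h2, hf, hl, him] using this

theorem round_spec (h : Graph n σ) {f s : Var} (hf : f = .glob ∨ f = .one)
    (hs : s = .inner ∨ s = .outer) :
    toSet n (((round f s).sem B σ).a .cur) =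
      Kripke.attr (remRel n (σ.a .stat)) (inRel n (σ.a .stat))
        ((if σ.v f = 0 then Set.univ else toSet n (σ.a .lab)) ∩
          Kripke.dia (remRel n (σ.a .stat)) (inRel n (σ.a .stat)) (toSet n (σ.a .cur))) (σ.v s) := by
  have h1 := h.sem (B := B) diaStep rfl
  have h2 := h1.sem (B := B) (restrict f) (by rcases hf with rfl | rfl <;> rfl)
  have e1 := restrict_spec (B := B) h1 (f := f) (by rcases hf with rfl | rfl <;> simp)
    (by rcases hf with rfl | rfl <;> simp) (by rcases hf with rfl | rfl <;> simp)
  rw [diaStep_spec h, sem_v (s := diaStep) (by rcases hf with rfl | rfl <;> rfl),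
    sem_a (s := diaStep) rfl] at e1
  have e2 : ((restrict f).sem B (diaStep.sem B σ)).a .stat = σ.a .stat :=
    (sem_a (by rcases hf with rfl | rfl <;> rfl)).trans (sem_a rfl)
  have e3 : ((restrict f).sem B (diaStep.sem B σ)).v s = σ.v s :=
    (sem_v (by rcases hf with rfl | rfl <;> rcases hs with rfl | rfl <;> rfl)).trans
      (sem_v (by rcases hs with rfl | rfl <;> rfl))
  change toSet n (((loop .cnt s attrStep).sem B ((restrict f).sem B (diaStep.sem B σ))).a .cur) = _
  rw [← e1, ← e2, ← e3]
  generalize (restrict f).sem B (diaStep.sem B σ) = τ at h2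
  refine loop_rule (fun m ρ => toSet n (ρ.a .cur) = Kripke.attr (remRel n (τ.a .stat))
    (inRel n (τ.a .stat)) (toSet n (τ.a .cur)) m) rfl ?_
  intro m ρ hm hc hv ha hb hP
  have hg : Graph n ρ := ⟨by rw [hv _ rfl, h2.num], by rw [hv _ rfl, h2.sq], by rw [hv _ rfl, h2.one],
    by rw [ha _ rfl]; exact h2.src, by rw [ha _ rfl]; exact h2.tgt⟩
  rw [Mem.setV_a, attrStep_spec hg, ha .stat rfl, hP]
  rfl

/-- The program follows the definition of `region`. The last round is restricted by the variable
`one`, which is never zero; so it always intersects with `lab`, as the last round of `region` does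
with `A`. -/
theorem test_spec (h : Graph n σ) {r : Fin n} (hr : σ.v .root = r) :
    (test.sem B σ).v .ans ≠ 0 ↔ r ∈ Kripke.region (remRel n (σ.a .stat)) (inRel n (σ.a .stat))
      (toSet n (σ.a .lab)) (if σ.v .glob = 0 then Set.univ else toSet n (σ.a .lab)) n
      (σ.v .inner) (σ.v .outer) := by
  set s₁ : Stmt := .loop .row .num (.store .cur .row .one)
  set s₂ : Stmt := .loop .cnt₂ .num (round .glob .inner)
  have h1 := h.sem (B := B) s₁ rfl
  have h2 := h1.sem (B := B) s₂ rfl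
  have e1 : toSet n ((s₁.sem B σ).a .cur) = Set.univ := by
    have := loop_rule (B := B) (c := .row) (i := .num) (σ := σ) (s := .store .cur .row .one)
      (fun m τ => ∀ i < m, τ.a .cur i ≠ 0) (by simp) (by
        intro m τ hm hc hv ha hb hP i hi
        by_cases him : i = m
        · simp [Stmt.sem, him, hc, hv .one rfl, h.one]
        · simpa [Stmt.sem, him, hc] using hP i (by omega))
    rw [h.num] at this
    exact Set.eq_univ_of_forall fun i => this i i.2
  have e2 : toSet n ((s₂.sem B (s₁.sem B σ)).a .cur) =
      (fun X => Kripke.attr (remRel n (σ.a .stat)) (inRel n (σ.a .stat))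
        ((if σ.v .glob = 0 then Set.univ else toSet n (σ.a .lab)) ∩
          Kripke.dia (remRel n (σ.a .stat)) (inRel n (σ.a .stat)) X) (σ.v .inner))^[n]
        (toSet n ((s₁.sem B σ).a .cur)) := by
    rw [← sem_a (B := B) (σ := σ) (s := s₁) (k := .stat) rfl,
      ← sem_a (B := B) (σ := σ) (s := s₁) (k := .lab) rfl,
      ← sem_v (B := B) (σ := σ) (s := s₁) (x := .glob) rfl,
      ← sem_v (B := B) (σ := σ) (s := s₁) (x := .inner) rfl]
    generalize s₁.sem B σ = τ at h1
    have key := loop_rule (B := B) (c := .cnt₂) (i := .num) (σ := τ) (s := round .glob .inner)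
      (fun m ρ => toSet n (ρ.a .cur) = (fun X => Kripke.attr (remRel n (τ.a .stat))
        (inRel n (τ.a .stat)) ((if τ.v .glob = 0 then Set.univ else toSet n (τ.a .lab)) ∩
          Kripke.dia (remRel n (τ.a .stat)) (inRel n (τ.a .stat)) X) (τ.v .inner))^[m]
          (toSet n (τ.a .cur))) rfl ?_
    · rwa [h1.num] at key
    intro m ρ hm hc hv ha hb hP
    have hg : Graph n ρ := ⟨by rw [hv _ rfl, h1.num], by rw [hv _ rfl, h1.sq],
      by rw [hv _ rfl, h1.one], by rw [ha _ rfl]; exact h1.src, by rw [ha _ rfl]; exact h1.tgt⟩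
    rw [Mem.setV_a, round_spec hg (Or.inl rfl) (Or.inl rfl), Function.iterate_succ_apply', ← hP,
      ha .stat rfl, ha .lab rfl, hv .glob rfl, hv .inner rfl]
  rw [e1] at e2
  have e3 := round_spec (B := B) h2 (f := .one) (s := .outer) (Or.inr rfl) (Or.inr rfl)
  rw [h2.one, if_neg one_ne_zero, e2, sem_a (s := s₂) (k := .stat) rfl,
    sem_a (s := s₁) (k := .stat) rfl, sem_a (s := s₂) (k := .lab) rfl,
    sem_a (s := s₁) (k := .lab) rfl, sem_v (s := s₂) (x := .outer) rfl,
    sem_v (s := s₁) (x := .outer) rfl] at e3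
  have e4 : ((round .one .outer).sem B (s₂.sem B (s₁.sem B σ))).v .root = r := by
    rw [sem_v (s := round .one .outer) rfl, sem_v (s := s₂) rfl, sem_v (s := s₁) rfl, hr]
  rw [Kripke.region, ← e3]
  change ((load .ans .cur .root).sem B ((round .one .outer).sem B (s₂.sem B (s₁.sem B σ)))).v .ans
    ≠ 0 ↔ _
  simp [Stmt.sem, e4, toSet]

end RAM

namespace RAM

/-! ### The search -/

namespace Stmt

/-- Mark in `disc` the root and the targets of the chosen edges. -/
def discover : Stmt := block [
  .loop .row .num (block [.set .val 0, .store .disc .row .val]),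
  .store .disc .root .one,
  .loop .edge .sq (block [.load .val .stat .edge, .sub .val .val .one,
    .ifz .val .skip (block [.load .aux .tgt .edge, .store .disc .aux .one])])]

/-- Look for an undecided edge with a marked source. -/
def choose : Stmt := block [.set .found 0,
  .loop .edge .sq (block [.load .val .stat .edge, .load .aux .src .edge, .load .aux .disc .aux,
    .dist .val .val .one,
    .ifz .val (.ifz .aux .skip (block [.copy .found .one, .copy .sel .edge])) .skip])]

/-- Print the marked worlds and the chosen edges. -/
def printAll : Stmt := block [
  .loop .row .num (block [.load .val .disc .row, .print .val]),
  .loop .edge .sq (block [.load .val .stat .edge, .sub .val .val .one, .print .val])]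

/-- Print the submodel that has been found, and start to backtrack. -/
def emitLeaf : Stmt := block [printAll, .copy .out .one, .copy .mode .one]

/-- Set the status of the selected edge. -/
def decideSel (c : ℕ) : Stmt := block [.set .val c, .store .stat .sel .val]

/-- Put the selected edge on the trail. -/
def pushSel : Stmt := block [.store .trail .top .sel, .inc .top]

/-- Take the selected edge from the trail. -/
def popSel : Stmt := block [.sub .top .top .one, .load .sel .trail .top, .load .val .stat .sel]

/-- Decide the selected edge. -/
def push : Stmt := block [pushSel, decideSel 2, test, .ifz .ans (decideSel 0) .skip]

/-- Search below the current node. -/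
def descend : Stmt := block [discover, choose, .ifz .found emitLeaf push]

/-- Go to the sibling of the current node, or leave it. -/
def sibling : Stmt := block [decideSel 0, test,
  -- Popping lowers `top` but leaves the edge in its trail cell, so raising `top` puts it back.
  .ifz .ans (decideSel 1) (block [.inc .top, .set .mode 0])]

/-- Leave the current node, or go to its sibling. -/
def backtrack : Stmt := .ifz .top (.set .go 0) (block [popSel, .ifz .val (decideSel 1) sibling])

/-- One step of the search. -/
def body : Stmt := block [.set .out 0, .ifz .mode descend backtrack]

end Stmt

open Stmt

variable {n B : ℕ} {σ : Mem}

theorem sem_ifz_of_eq {i : Var} {s t : Stmt} (h : σ.v i = 0) :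
    (Stmt.ifz i s t).sem B σ = s.sem B σ := by
  rw [Stmt.sem, if_pos h]

theorem sem_ifz_of_ne {i : Var} {s t : Stmt} (h : σ.v i ≠ 0) :
    (Stmt.ifz i s t).sem B σ = t.sem B σ := by
  rw [Stmt.sem, if_neg h]

/-- The worlds marked by `discover`. -/
def Disc (n : ℕ) (r : ℕ) (f : ℕ → ℕ) (i : ℕ) : Prop := i = r ∨ ∃ e < n * n, 2 ≤ f e ∧ e % n = i

open Classical in
theorem discover_spec (h : Graph n σ) : ∀ i < n, (discover.sem B σ).a .disc i =
    if Disc n (σ.v .root) (σ.a .stat) i then 1 else 0 := by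
  set s₁ : Stmt := .loop .row .num (block [.set .val 0, .store .disc .row .val])
  set s₂ : Stmt := .store .disc .root .one
  have h1 := h.sem (B := B) s₁ rfl
  have h2 := h1.sem (B := B) s₂ rfl
  have e1 : ∀ i < n, (s₁.sem B σ).a .disc i = 0 := by
    have := loop_rule (B := B) (c := .row) (i := .num) (σ := σ)
      (s := block [.set .val 0, .store .disc .row .val])
      (fun m τ => ∀ i < m, τ.a .disc i = 0) (by simp) (by
        intro m τ hm hc hv ha hb hP i hi
        by_cases him : i = m
        · simp [block, Stmt.sem, him, hc]
        · simpa [block, Stmt.sem, him, hc] using hP i (by omega))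
    rwa [h.num] at this
  have e2 : ∀ i < n, (s₂.sem B (s₁.sem B σ)).a .disc i = if i = σ.v .root then 1 else 0 := by
    intro i hi
    have := sem_v (B := B) (s := s₁) (σ := σ) (x := .root) rfl
    simp [s₂, Stmt.sem, h1.one, this, Function.update_apply, e1 i hi]
  have e3 : (s₂.sem B (s₁.sem B σ)).a .stat = σ.a .stat := (sem_a rfl).trans (sem_a rfl)
  intro i hi
  change ((loop .edge .sq _).sem B (s₂.sem B (s₁.sem B σ))).a .disc i = _
  rw [Disc, ← e3]
  generalize s₂.sem B (s₁.sem B σ) = τ at h2 e2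
  have key := loop_rule (B := B) (c := .edge) (i := .sq) (σ := τ)
    (s := block [.load .val .stat .edge, .sub .val .val .one,
      .ifz .val .skip (block [.load .aux .tgt .edge, .store .disc .aux .one])])
    (fun m ρ => ∀ i < n, ρ.a .disc i =
      if i = σ.v .root ∨ ∃ e < m, 2 ≤ τ.a .stat e ∧ e % n = i then 1 else 0)
    (by simpa using e2) ?_
  · rw [h2.sq] at key
    convert key i hi
  intro m ρ hm hc hv ha hb hP i hi
  rw [h2.sq] at hm
  have f2 := h2.tgt m hm
  have f3 := h2.one
  rw [← ha .tgt rfl] at f2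
  rw [← hv .one rfl] at f3
  rw [← ha .stat rfl] at hP ⊢
  have := hP i hi
  simp only [Nat.lt_succ_iff_lt_or_eq, or_and_right, exists_or, exists_eq_left, ← or_assoc]
  by_cases hs : 2 ≤ ρ.a .stat m
  · have hs' : ρ.a .stat m - 1 ≠ 0 := by omega
    by_cases him : m % n = i
    · simp [block, Stmt.sem, hc, f2, f3, hs, hs', him]
    · simp [block, Stmt.sem, hc, f2, f3, hs', him, this, Ne.symm him]
  · have hs' : ρ.a .stat m - 1 = 0 := by omega
    simp [block, Stmt.sem, hc, f3, hs, hs', this]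

theorem choose_spec (h : Graph n σ) :
    ((choose.sem B σ).v .found = 0 ↔ ¬ ∃ e < n * n, σ.a .stat e = 1 ∧ σ.a .disc (e / n) ≠ 0) ∧
    ((choose.sem B σ).v .found ≠ 0 → (choose.sem B σ).v .sel < n * n ∧
      σ.a .stat ((choose.sem B σ).v .sel) = 1 ∧
      σ.a .disc ((choose.sem B σ).v .sel / n) ≠ 0) := by
  have h1 := h.sem (B := B) (.set .found 0) rfl
  have key := loop_rule (B := B) (c := .edge) (i := .sq) (σ := (set .found 0).sem B σ)
    (s := block [.load .val .stat .edge, .load .aux .src .edge, .load .aux .disc .aux,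
    .dist .val .val .one,
    .ifz .val (.ifz .aux .skip (block [.copy .found .one, .copy .sel .edge])) .skip])
    (fun m ρ => (ρ.v .found = 0 ↔ ¬ ∃ e < m, σ.a .stat e = 1 ∧ σ.a .disc (e / n) ≠ 0) ∧
      (ρ.v .found ≠ 0 → ρ.v .sel < n * n ∧ σ.a .stat (ρ.v .sel) = 1 ∧
        σ.a .disc (ρ.v .sel / n) ≠ 0)) (by simp [Stmt.sem]) ?_
  · rwa [h1.sq] at key
  intro m ρ hm hc hv ha hb hP
  rw [h1.sq] at hm
  have f1 := h1.src m hm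
  have f3 := h1.one
  rw [← ha .src rfl] at f1
  rw [← hv .one rfl] at f3
  have g1 : σ.a .stat = ρ.a .stat := (ha .stat rfl).symm
  have g2 : σ.a .disc = ρ.a .disc := (ha .disc rfl).symm
  rw [g1, g2] at hP ⊢
  simp only [Nat.lt_succ_iff_lt_or_eq, or_and_right, exists_or, exists_eq_left, not_or]
  by_cases hs : ρ.a .stat m = 1
  · by_cases hd : ρ.a .disc (m / n) = 0
    · simpa [block, Stmt.sem, hc, f1, f3, hs, hd] using hP
    · simp [block, Stmt.sem, hc, f1, f3, hs, hd, hm]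
  · have hs' : ¬ (ρ.a .stat m - 1 = 0 ∧ 1 - ρ.a .stat m = 0) := by omega
    simpa [block, Stmt.sem, hc, f1, f3, hs, hs'] using hP

/-- Truncated subtraction turns status `2` into bit `1` and statuses `0` and `1` into bit `0`. An
edge still undecided at a leaf starts outside the submodel and is rightly printed as absent. -/
theorem printAll_spec (h : Graph n σ) : (printAll.sem B σ).buf =
    σ.buf ++ ((List.range n).map (σ.a .disc) ++
      (List.range (n * n)).map fun e => σ.a .stat e - 1) := by
  set s₁ : Stmt := .loop .row .num (block [.load .val .disc .row, .print .val])
  have h1 := h.sem (B := B) s₁ rfl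
  have e1 : (s₁.sem B σ).buf = σ.buf ++ (List.range n).map (σ.a .disc) := by
    have := loop_rule (B := B) (c := .row) (i := .num) (σ := σ)
      (s := block [.load .val .disc .row, .print .val])
      (fun m τ => τ.buf = σ.buf ++ (List.range m).map (σ.a .disc)) (by simp) (by
        intro m τ hm hc hv ha hb hP
        simp [block, Stmt.sem, hc, List.range_succ, hP, ha .disc rfl])
    rwa [h.num] at this
  have e2 : (s₁.sem B σ).a .stat = σ.a .stat := sem_a rfl
  rw [← List.append_assoc, ← e1, ← e2]
  change ((loop .edge .sq _).sem B (s₁.sem B σ)).buf = _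
  generalize s₁.sem B σ = τ at h1
  have := loop_rule (B := B) (c := .edge) (i := .sq) (σ := τ)
    (s := block [.load .val .stat .edge, .sub .val .val .one, .print .val])
    (fun m ρ => ρ.buf = τ.buf ++ (List.range m).map fun e => τ.a .stat e - 1) (by simp) (by
      intro m ρ hm hc hv ha hb hP
      simp [block, Stmt.sem, hc, List.range_succ, hP, ha .stat rfl, hv .one rfl, h1.one])
  rwa [h1.sq] at this

end RAM

/-! ### Nodes of the search tree and the effect of one step of the search -/

namespace RAM

open Stmt

/-- The data of the search: a structure, the worlds that satisfy the atom, and the kind of the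
formula. -/
structure Game (n : ℕ) where
  M : Kripke (Fin n)
  A : Set (Fin n)
  m : CTL.Mode

/-- The list, read backwards, is an initial segment of the array. -/
def Trail (a : ℕ → ℕ) : List ℕ → Prop
  | [] => True
  | e :: t => a t.length = e ∧ Trail a t

theorem Trail.update {a : ℕ → ℕ} {k x : ℕ} : ∀ {t : List ℕ}, t.length ≤ k → Trail a t →
    Trail (Function.update a k x) t
  | [], _, _ => trivial
  | e :: t, hk, ⟨h1, h2⟩ => by
    rw [List.length_cons] at hk
    exact ⟨by rw [Function.update_of_ne (by omega), h1], Trail.update (by omega) h2⟩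

/-- The memory describes the node of the search tree with status array `f` and trail `t`. -/
structure At {n : ℕ} (G : Game n) (f : ℕ → ℕ) (t : List ℕ) (σ : Mem) : Prop where
  graph : Graph n σ
  root : σ.v .root = G.M.r
  lab : toSet n (σ.a .lab) = G.A
  base : (if σ.v .glob = 0 then Set.univ else G.A) = Kripke.Mode.base G.A G.m
  inner : σ.v .inner = Kripke.Mode.inner n G.m
  outer : σ.v .outer = Kripke.Mode.outer n G.m
  stat : σ.a .stat = f
  top : σ.v .top = t.length
  trail : Trail (σ.a .trail) t
  buf : σ.buf = []
  go : σ.v .go ≠ 0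

/-- The scalars that describe a node. -/
def Var.isState : Var → Bool
  | .num | .sq | .one | .root | .glob | .inner | .outer | .top | .go => true
  | _ => false

namespace At

variable {n B : ℕ} {G : Game n} {f : ℕ → ℕ} {t : List ℕ} {σ : Mem}

theorem of_eq (h : At G f t σ) {τ : Mem} (hv : ∀ x : Var, x.isState → τ.v x = σ.v x)
    (ha : ∀ k, k = .src ∨ k = .tgt ∨ k = .lab ∨ k = .stat ∨ k = .trail → τ.a k = σ.a k)
    (hb : τ.buf = []) : At G f t τ where
  graph := ⟨by rw [hv _ rfl, h.graph.num], by rw [hv _ rfl, h.graph.sq],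
    by rw [hv _ rfl, h.graph.one], by rw [ha _ (by simp)]; exact h.graph.src,
    by rw [ha _ (by simp)]; exact h.graph.tgt⟩
  root := by rw [hv _ rfl, h.root]
  lab := by rw [ha _ (by simp), h.lab]
  base := by rw [hv _ rfl, h.base]
  inner := by rw [hv _ rfl, h.inner]
  outer := by rw [hv _ rfl, h.outer]
  stat := by rw [ha _ (by simp), h.stat]
  top := by rw [hv _ rfl, h.top]
  trail := by rw [ha _ (by simp)]; exact h.trail
  buf := hb
  go := by rw [hv _ rfl]; exact h.go

theorem setV (h : At G f t σ) {y : Var} (hy : y.isState = false) (c : ℕ) : At G f t (σ.setV y c) :=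
  h.of_eq (fun x hx => by
    rw [Mem.setV_v, if_neg]
    rintro rfl
    simp [hx] at hy) (fun _ _ => rfl) h.buf

theorem setStat (h : At G f t σ) (e x : ℕ) :
    At G (Function.update f e x) t (σ.setA .stat e x) where
  graph := ⟨h.graph.num, h.graph.sq, h.graph.one, by simpa using h.graph.src,
    by simpa using h.graph.tgt⟩
  root := h.root
  lab := by simpa using h.lab
  base := h.base
  inner := h.inner
  outer := h.outer
  stat := by simp [h.stat]
  top := h.top
  trail := by simpa using h.trail
  buf := h.buf
  go := h.go

theorem setTrail (h : At G f t σ) (e : ℕ) : At G f t (σ.setA .trail t.length e) where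
  graph := ⟨h.graph.num, h.graph.sq, h.graph.one, by simpa using h.graph.src,
    by simpa using h.graph.tgt⟩
  root := h.root
  lab := by simpa using h.lab
  base := h.base
  inner := h.inner
  outer := h.outer
  stat := by simp [h.stat]
  top := h.top
  trail := by simpa using h.trail.update le_rfl
  buf := h.buf
  go := h.go

theorem setTop (h : At G f t σ) {t' : List ℕ} (ht : Trail (σ.a .trail) t') :
    At G f t' (σ.setV .top t'.length) where
  graph := ⟨by simpa using h.graph.num, by simpa using h.graph.sq, by simpa using h.graph.one,
    h.graph.src, h.graph.tgt⟩
  root := by simpa using h.root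
  lab := h.lab
  base := by simpa using h.base
  inner := by simpa using h.inner
  outer := by simpa using h.outer
  stat := h.stat
  top := by simp
  trail := ht
  buf := h.buf
  go := by simpa using h.go

theorem sem (h : At G f t σ) (s : Stmt) (hv : ∀ x : Var, x.isState → s.writesV x = false)
    (ha : ∀ k, k = .src ∨ k = .tgt ∨ k = .lab ∨ k = .stat ∨ k = .trail → s.writesA k = false)
    (hb : s.prints = false) : At G f t (s.sem B σ) :=
  h.of_eq (fun x hx => sem_v (hv x hx)) (fun k hk => sem_a (ha k hk)) ((sem_buf hb).trans h.buf)

theorem test (h : At G f t σ) : At G f t (test.sem B σ) :=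
  h.sem _ (by rintro ⟨⟩ hx <;> first | rfl | cases hx) (by rintro _ (rfl | rfl | rfl | rfl | rfl) <;> rfl) rfl

theorem discover (h : At G f t σ) : At G f t (discover.sem B σ) :=
  h.sem _ (by rintro ⟨⟩ hx <;> first | rfl | cases hx) (by rintro _ (rfl | rfl | rfl | rfl | rfl) <;> rfl) rfl

theorem choose (h : At G f t σ) : At G f t (choose.sem B σ) :=
  h.sem _ (by rintro ⟨⟩ hx <;> first | rfl | cases hx) (by rintro _ (rfl | rfl | rfl | rfl | rfl) <;> rfl) rfl

end At

/-- The status array `f` describes a node of the search tree of `G`. -/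
structure Valid {n : ℕ} (G : Game n) (f : ℕ → ℕ) : Prop where
  le_two : ∀ e < n * n, f e ≤ 2
  rem : ∀ v w, remRel n f v w → G.M.R v w
  reach : ∀ v w, inRel n f v w → Relation.ReflTransGen (inRel n f) G.M.r v

/-- The solutions below a node of the search tree. -/
def sols {n : ℕ} (G : Game n) (f : ℕ → ℕ) : Set (Set (Fin n) × Set (Fin n × Fin n)) :=
  {p | G.M.IsConnectedSubmodel p.1 p.2 ∧ Kripke.Holds p.1 p.2 G.A G.M.r G.m ∧
    (∀ v w, inRel n f v w → (v, w) ∈ p.2) ∧ ∀ v w, (v, w) ∈ p.2 → remRel n f v w}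

variable {n B : ℕ} {G : Game n} {f : ℕ → ℕ} {t : List ℕ} {σ : Mem}

/-- At a valid node the sources of the chosen edges are reachable by chosen edges, which is the
hypothesis under which `mem_region_iff` decides the existence of a solution. -/
theorem At.test_iff (h : At G f t σ) (hf : Valid G f) :
    (Stmt.test.sem B σ).v .ans ≠ 0 ↔ (sols G f).Nonempty := by
  rw [test_spec h.graph h.root, h.stat, h.lab, h.base, h.inner, h.outer,
    Kripke.mem_region_iff G.M (fun v w hw => ?_) hf.rem hf.reach G.A G.m (by simp)]
  · exact ⟨fun ⟨V, S, h⟩ => ⟨(V, S), h⟩, fun ⟨⟨V, S⟩, h⟩ => ⟨V, S, h⟩⟩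
  · exact Nat.ne_of_gt (Nat.lt_of_lt_of_le Nat.zero_lt_two hw)

/-- The undecided edge `e` can be decided next. -/
def Open (n r : ℕ) (f : ℕ → ℕ) (e : ℕ) : Prop := e < n * n ∧ f e = 1 ∧ Disc n r f (e / n)

open Classical in
/-- The word printed at a leaf. -/
noncomputable def leafWord (n r : ℕ) (f : ℕ → ℕ) : List ℕ :=
  (List.range n).map (fun i => if Disc n r f i then 1 else 0) ++
    (List.range (n * n)).map fun e => f e - 1

theorem At.found_iff (h : At G f t σ) :
    ((Stmt.choose.sem B (Stmt.discover.sem B σ)).v .found = 0 ↔ ¬ ∃ e, Open n G.M.r f e) ∧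
    ((Stmt.choose.sem B (Stmt.discover.sem B σ)).v .found ≠ 0 →
      Open n G.M.r f ((Stmt.choose.sem B (Stmt.discover.sem B σ)).v .sel)) := by
  have h1 := choose_spec (B := B) (h.discover (B := B)).graph
  have h2 : ∀ e < n * n, (Stmt.discover.sem B σ).a .disc (e / n) ≠ 0 ↔
      Disc n G.M.r f (e / n) := fun e he => by
    rw [discover_spec h.graph _ (Nat.div_lt_of_lt_mul he), h.root, h.stat]
    split_ifs with hd <;> simp [hd]
  rw [(h.discover (B := B)).stat] at h1
  refine ⟨h1.1.trans (not_congr (exists_congr fun e => and_congr_right fun he =>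
    and_congr_right fun _ => h2 e he)), fun hf => ?_⟩
  obtain ⟨h3, h4, h5⟩ := h1.2 hf
  exact ⟨h3, h4, (h2 _ h3).1 h5⟩

theorem At.decideSel (h : At G f t σ) (c : ℕ) :
    At G (Function.update f (σ.v .sel) c) t ((Stmt.decideSel c).sem B σ) := by
  have := (h.setV (y := .val) rfl c).setStat (σ.v .sel) c
  convert this using 1
  simp [Stmt.decideSel, block, Stmt.sem]

theorem At.pushSel (h : At G f t σ) (ht : t.length + 1 ≤ B) :
    At G f (σ.v .sel :: t) (Stmt.pushSel.sem B σ) := by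
  have h1 := h.setTrail (σ.v .sel)
  have h2 := h1.setTop (t' := σ.v .sel :: t) ⟨by simp, h1.trail⟩
  convert h2 using 1
  simp [Stmt.pushSel, block, Stmt.sem, h.top, min_eq_left ht]

theorem At.popSel {e : ℕ} (h : At G f (e :: t) σ) : At G f t (Stmt.popSel.sem B σ) ∧
    (Stmt.popSel.sem B σ).v .sel = e ∧ (Stmt.popSel.sem B σ).v .val = f e := by
  have h1 := h.setTop h.trail.2
  have h2 := (h1.setV (y := .sel) rfl e).setV (y := .val) rfl (f e)
  have h3 : Stmt.popSel.sem B σ = ((σ.setV .top t.length).setV .sel e).setV .val (f e) := by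
    simp [Stmt.popSel, block, Stmt.sem, h.top, h.graph.one, h.trail.1, h.stat]
  rw [h3]
  exact ⟨h2, by simp, by simp⟩

theorem body_descend (hm : σ.v .mode = 0) : body.sem B σ =
    (ifz .found emitLeaf push).sem B (Stmt.choose.sem B (Stmt.discover.sem B (σ.setV .out 0))) :=
  sem_ifz_of_eq (σ := σ.setV .out 0) (by simpa using hm)

theorem body_backtrack (hm : σ.v .mode ≠ 0) : body.sem B σ = backtrack.sem B (σ.setV .out 0) :=
  sem_ifz_of_ne (σ := σ.setV .out 0) (by simpa using hm)

open Classical in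
theorem At.body_leaf (h : At G f t σ) (hm : σ.v .mode = 0) (ho : ¬ ∃ e, Open n G.M.r f e) :
    At G f t (body.sem B σ).flush ∧ (body.sem B σ).v .mode = 1 ∧ (body.sem B σ).v .out ≠ 0 ∧
      (body.sem B σ).v .go ≠ 0 ∧ (body.sem B σ).buf = leafWord n G.M.r f := by
  have h0 : At G f t (σ.setV .out 0) := h.setV rfl 0
  rw [body_descend hm, sem_ifz_of_eq (h0.found_iff.1.2 ho)]
  have h2 := (h0.discover (B := B)).choose (B := B)
  have hd : ∀ i < n, (Stmt.choose.sem B (Stmt.discover.sem B (σ.setV .out 0))).a .disc i =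
      if Disc n G.M.r f i then 1 else 0 := fun i hi => by
    rw [sem_a rfl, discover_spec h0.graph i hi, h0.root, h0.stat]
  generalize Stmt.choose.sem B (Stmt.discover.sem B (σ.setV .out 0)) = τ at *
  have hone : (printAll.sem B τ).v .one = 1 := (sem_v rfl).trans h2.graph.one
  have e : emitLeaf.sem B τ = ((printAll.sem B τ).setV .out 1).setV .mode 1 := by
    change ((printAll.sem B τ).setV .out ((printAll.sem B τ).v .one)).setV .mode
      (((printAll.sem B τ).setV .out ((printAll.sem B τ).v .one)).v .one) = _
    simp [hone]
  refine ⟨h2.of_eq (fun x hx => ?_) (fun k hk => ?_) rfl, ?_, ?_, ?_, ?_⟩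
  · rw [Mem.flush_v]
    refine sem_v ?_
    revert hx
    cases x <;> intro hx <;> first | rfl | cases hx
  · rw [Mem.flush_a]
    refine sem_a ?_
    rcases hk with (rfl | rfl | rfl | rfl | rfl) <;> rfl
  · simp [e]
  · simp [e]
  · rw [sem_v (s := emitLeaf) rfl]
    exact h2.go
  · refine (printAll_spec h2.graph).trans ?_
    rw [h2.buf, List.nil_append, h2.stat, leafWord]
    congr 1
    exact List.map_congr_left fun i hi => hd i (List.mem_range.1 hi)

/-- Only the child where the edge is chosen is tested. If it has no solution, the other child is
entered untested: the search visits only nodes with solutions, so that child must have one. -/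
theorem At.body_push (h : At G f t σ) (hf : ∀ e, Open n G.M.r f e → Valid G (Function.update f e 2))
    (hm : σ.v .mode = 0) (ho : ∃ e, Open n G.M.r f e) (ht : t.length + 1 ≤ B) :
    ∃ e, Open n G.M.r f e ∧ (body.sem B σ).v .mode = 0 ∧ (body.sem B σ).v .out = 0 ∧
      ((sols G (Function.update f e 2)).Nonempty →
        At G (Function.update f e 2) (e :: t) (body.sem B σ)) ∧
      (¬ (sols G (Function.update f e 2)).Nonempty →
        At G (Function.update f e 0) (e :: t) (body.sem B σ)) := by
  have h0 : At G f t (σ.setV .out 0) := h.setV rfl 0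
  have hfound := mt (h0.found_iff (B := B)).1.1 (not_not.2 ho)
  rw [body_descend hm, sem_ifz_of_ne hfound]
  have hopen := (h0.found_iff (B := B)).2 hfound
  have hmode : (Stmt.choose.sem B (Stmt.discover.sem B (σ.setV .out 0))).v .mode = 0 :=
    (sem_v rfl).trans ((sem_v rfl).trans (by simpa using hm))
  have hout : (Stmt.choose.sem B (Stmt.discover.sem B (σ.setV .out 0))).v .out = 0 :=
    (sem_v rfl).trans ((sem_v rfl).trans (by simp))
  have h2 := (h0.discover (B := B)).choose (B := B)
  generalize Stmt.choose.sem B (Stmt.discover.sem B (σ.setV .out 0)) = τ at *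
  have h3 := (h2.pushSel ht).decideSel (B := B) 2
  have hsel : (Stmt.test.sem B ((Stmt.decideSel 2).sem B (Stmt.pushSel.sem B τ))).v .sel = τ.v .sel :=
    (sem_v rfl).trans ((sem_v rfl).trans (sem_v rfl))
  rw [sem_v (s := Stmt.pushSel) rfl] at h3
  refine ⟨τ.v .sel, hopen, by rw [sem_v rfl, hmode], by rw [sem_v rfl, hout], fun hs => ?_,
    fun hs => ?_⟩
  · have hb : push.sem B τ =
        Stmt.test.sem B ((Stmt.decideSel 2).sem B (Stmt.pushSel.sem B τ)) :=
      sem_ifz_of_ne ((h3.test_iff (hf _ hopen)).2 hs)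
    rw [hb]
    exact h3.test
  · have hb : push.sem B τ = (Stmt.decideSel 0).sem B
        (Stmt.test.sem B ((Stmt.decideSel 2).sem B (Stmt.pushSel.sem B τ))) :=
      sem_ifz_of_eq (not_not.1 (mt (h3.test_iff (hf _ hopen)).1 hs))
    rw [hb]
    have h4 := (h3.test (B := B)).decideSel (B := B) 0
    rwa [hsel, Function.update_idem] at h4

/-- Deletion is the last alternative tried, so status `0` means that the parent is finished as well.
-/
theorem At.body_pop {e : ℕ} (h : At G f (e :: t) σ) (hm : σ.v .mode = 1) (he : f e = 0) :
    At G (Function.update f e 1) t (body.sem B σ) ∧ (body.sem B σ).v .mode = 1 ∧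
      (body.sem B σ).v .out = 0 := by
  have h0 : At G f (e :: t) (σ.setV .out 0) := h.setV rfl 0
  have htop : (σ.setV .out 0).v .top ≠ 0 := by rw [h0.top]; simp
  obtain ⟨h1, h2, h3⟩ := h0.popSel (B := B)
  have hb : body.sem B σ = (Stmt.decideSel 1).sem B (Stmt.popSel.sem B (σ.setV .out 0)) := by
    rw [body_backtrack (by simp [hm]), backtrack, sem_ifz_of_ne htop]
    exact sem_ifz_of_eq (h3.trans he)
  have h4 := h1.decideSel (B := B) 1
  rw [h2] at h4
  refine ⟨hb ▸ h4, ?_, ?_⟩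
  · rw [hb, sem_v rfl, sem_v rfl]
    simpa using hm
  · rw [hb, sem_v rfl, sem_v rfl]
    simp

/-- Status `2` means that only the first alternative has been explored. Unlike on the way down, the
second one has to be tested, because the solutions of the parent may all lie in the first. -/
theorem At.body_sibling {e : ℕ} (h : At G f (e :: t) σ) (hm : σ.v .mode = 1) (he : f e = 2)
    (hf : Valid G (Function.update f e 0)) (ht : t.length + 1 ≤ B) :
    (body.sem B σ).v .out = 0 ∧
      ((sols G (Function.update f e 0)).Nonempty →
        At G (Function.update f e 0) (e :: t) (body.sem B σ) ∧ (body.sem B σ).v .mode = 0) ∧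
      (¬ (sols G (Function.update f e 0)).Nonempty →
        At G (Function.update f e 1) t (body.sem B σ) ∧ (body.sem B σ).v .mode = 1) := by
  have h0 : At G f (e :: t) (σ.setV .out 0) := h.setV rfl 0
  have htop : (σ.setV .out 0).v .top ≠ 0 := by rw [h0.top]; simp
  have hmode : (Stmt.popSel.sem B (σ.setV .out 0)).v .mode = 1 := by
    rw [sem_v rfl]
    simpa using hm
  have hout : (Stmt.popSel.sem B (σ.setV .out 0)).v .out = 0 := by
    rw [sem_v rfl]
    simp
  have htr : Trail ((Stmt.popSel.sem B (σ.setV .out 0)).a .trail) (e :: t) := by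
    rw [sem_a rfl]
    exact h0.trail
  obtain ⟨h1, h2, h3⟩ := h0.popSel (B := B)
  have hb : body.sem B σ = sibling.sem B (Stmt.popSel.sem B (σ.setV .out 0)) := by
    rw [body_backtrack (by simp [hm]), backtrack, sem_ifz_of_ne htop]
    exact sem_ifz_of_ne (by rw [h3, he]; exact two_ne_zero)
  rw [hb]
  generalize Stmt.popSel.sem B (σ.setV .out 0) = τ at *
  have h4 := h1.decideSel (B := B) 0
  rw [h2] at h4
  have h5 := h4.test (B := B)
  have hsel : (Stmt.test.sem B ((Stmt.decideSel 0).sem B τ)).v .sel = e :=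
    (sem_v rfl).trans ((sem_v rfl).trans h2)
  have hmode' : (Stmt.test.sem B ((Stmt.decideSel 0).sem B τ)).v .mode = 1 :=
    (sem_v rfl).trans ((sem_v rfl).trans hmode)
  have htr' : Trail ((Stmt.test.sem B ((Stmt.decideSel 0).sem B τ)).a .trail) (e :: t) := by
    rw [sem_a rfl, sem_a rfl]
    exact htr
  refine ⟨(sem_v rfl).trans hout, fun hs => ?_, fun hs => ?_⟩
  · have hb : sibling.sem B τ = (block [.inc .top, .set .mode 0]).sem B
        (Stmt.test.sem B ((Stmt.decideSel 0).sem B τ)) :=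
      sem_ifz_of_ne ((h4.test_iff hf).2 hs)
    rw [hb]
    generalize Stmt.test.sem B ((Stmt.decideSel 0).sem B τ) = ρ at h5 htr'
    have h6 := (h5.setTop htr').setV (y := .mode) rfl 0
    constructor
    · convert h6 using 1
      simp [block, Stmt.sem, h5.top, min_eq_left ht]
    · simp [block, Stmt.sem]
  · have hb : sibling.sem B τ = (Stmt.decideSel 1).sem B
        (Stmt.test.sem B ((Stmt.decideSel 0).sem B τ)) :=
      sem_ifz_of_eq (not_not.1 (mt (h4.test_iff hf).1 hs))
    rw [hb]
    have h6 := h5.decideSel (B := B) 1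
    rw [hsel, Function.update_idem] at h6
    exact ⟨h6, (sem_v rfl).trans hmode'⟩

theorem At.body_halt (h : At G f [] σ) (hm : σ.v .mode = 1) :
    (body.sem B σ).v .out = 0 ∧ (body.sem B σ).v .go = 0 := by
  have h0 : At G f [] (σ.setV .out 0) := h.setV rfl 0
  rw [body_backtrack (by simp [hm]), backtrack, sem_ifz_of_eq (by rw [h0.top]; rfl)]
  simp [Stmt.sem]

end RAM

/-! ### Correctness and delay of the backtracking search -/

namespace RAM

open Stmt

variable {n B : ℕ} {G : Game n} {f : ℕ → ℕ} {t : List ℕ} {σ : Mem}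

theorem remRel_of_update {e x : ℕ} (he : f e = 1) {v w : Fin n}
    (h : remRel n (Function.update f e x) v w) : remRel n f v w := by
  unfold remRel at *
  by_cases hvw : (v : ℕ) * n + w = e
  · rw [hvw, he]
    exact one_ne_zero
  · rwa [Function.update_of_ne hvw] at h

theorem edge_inj {v w v' w' : Fin n} (h : (v : ℕ) * n + w = v' * n + w') : v = v' ∧ w = w' := by
  constructor
  · rw [Fin.ext_iff, ← edge_div v w, h, edge_div]
  · rw [Fin.ext_iff, ← edge_mod v w, h, edge_mod]

/-- At valid nodes a single look at the targets of the chosen edges replaces a graph search. -/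
theorem Disc.reach (hf : Valid G f) {v : Fin n} (h : Disc n G.M.r f v) :
    Relation.ReflTransGen (inRel n f) G.M.r v := by
  rcases h with h | ⟨e, he, h1, h2⟩
  · rw [Fin.ext h]
  · obtain ⟨a, b, rfl⟩ := exists_edge he
    rw [edge_mod] at h2
    rw [← Fin.ext h2]
    exact (hf.reach a b h1).tail h1

theorem Valid.update_zero (hf : Valid G f) {e : ℕ} (he : f e = 1) :
    Valid G (Function.update f e 0) := by
  have key : inRel n (Function.update f e 0) = inRel n f := by
    ext v w
    unfold inRel
    by_cases hvw : (v : ℕ) * n + w = e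
    · simp [hvw, he]
    · rw [Function.update_of_ne hvw]
  refine ⟨fun i hi => ?_, fun v w h => hf.rem v w (remRel_of_update he h), ?_⟩
  · rw [Function.update_apply]
    split_ifs
    exacts [Nat.zero_le _, hf.le_two i hi]
  · rw [key]
    exact hf.reach

/-- The source of an open edge is already discovered. This is the reason for branching on open edges
only. -/
theorem Valid.update_two (hf : Valid G f) {e : ℕ} (he : Open n G.M.r f e) :
    Valid G (Function.update f e 2) := by
  have key : ∀ v w, inRel n f v w → inRel n (Function.update f e 2) v w := by
    intro v w h
    unfold inRel at *
    rw [Function.update_apply]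
    split_ifs
    exacts [le_rfl, h]
  refine ⟨fun i hi => ?_, fun v w h => hf.rem v w (remRel_of_update he.2.1 h), fun v w h => ?_⟩
  · rw [Function.update_apply]
    split_ifs
    exacts [le_rfl, hf.le_two i hi]
  · by_cases hvw : (v : ℕ) * n + w = e
    · have h1 := he.2.2
      rw [← hvw, edge_div] at h1
      exact Relation.ReflTransGen.mono key _ _ (h1.reach hf)
    · unfold inRel at h
      rw [Function.update_of_ne hvw] at h
      exact Relation.ReflTransGen.mono key _ _ (hf.reach v w h)

theorem mem_sols_update_two {e : ℕ} {v w : Fin n} (he : (v : ℕ) * n + w = e) (h1 : f e = 1)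
    (p : Set (Fin n) × Set (Fin n × Fin n)) :
    p ∈ sols G (Function.update f e 2) ↔ p ∈ sols G f ∧ (v, w) ∈ p.2 := by
  constructor
  · rintro ⟨h2, h3, h4, h5⟩
    refine ⟨⟨h2, h3, fun a b hab => h4 a b ?_, fun a b hab => remRel_of_update h1 (h5 a b hab)⟩,
      h4 v w ?_⟩
    · unfold inRel at *
      rw [Function.update_apply]
      split_ifs
      exacts [le_rfl, hab]
    · simp [inRel, he]
  · rintro ⟨⟨h2, h3, h4, h5⟩, h6⟩
    refine ⟨h2, h3, fun a b hab => ?_, fun a b hab => ?_⟩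
    · by_cases hvw : (a : ℕ) * n + b = e
      · obtain ⟨rfl, rfl⟩ := edge_inj (hvw.trans he.symm)
        exact h6
      · refine h4 a b ?_
        unfold inRel at *
        rwa [Function.update_of_ne hvw] at hab
    · have := h5 a b hab
      unfold remRel at *
      rw [Function.update_apply]
      split_ifs
      exacts [two_ne_zero, this]

theorem mem_sols_update_zero {e : ℕ} {v w : Fin n} (he : (v : ℕ) * n + w = e) (h1 : f e = 1)
    (p : Set (Fin n) × Set (Fin n × Fin n)) :
    p ∈ sols G (Function.update f e 0) ↔ p ∈ sols G f ∧ (v, w) ∉ p.2 := by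
  constructor
  · rintro ⟨h2, h3, h4, h5⟩
    refine ⟨⟨h2, h3, fun a b hab => h4 a b ?_, fun a b hab => remRel_of_update h1 (h5 a b hab)⟩,
      fun hvw => h5 v w hvw ?_⟩
    · unfold inRel at *
      rw [Function.update_apply]
      split_ifs with hab'
      · rw [hab', h1] at hab
        omega
      · exact hab
    · simp [he]
  · rintro ⟨⟨h2, h3, h4, h5⟩, h6⟩
    refine ⟨h2, h3, fun a b hab => h4 a b ?_, fun a b hab => ?_⟩
    · unfold inRel at *
      rw [Function.update_apply] at hab
      split_ifs at hab
      · omega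
      · exact hab
    · have := h5 a b hab
      unfold remRel at *
      rw [Function.update_apply]
      split_ifs with hvw
      · obtain ⟨rfl, rfl⟩ := edge_inj (hvw.trans he.symm)
        exact absurd hab h6
      · exact this

/-- The output that describes a submodel. -/
noncomputable def word {n : ℕ} (p : Set (Fin n) × Set (Fin n × Fin n)) : List ℕ :=
  (Encoding.submodel p.1 p.2).map Fin.val

theorem exists_edge_eq {S : Set (Fin n × Fin n)} {v w : Fin n} :
    (∃ a b : Fin n, (a : ℕ) * n + b = v * n + w ∧ (a, b) ∈ S) ↔ (v, w) ∈ S := by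
  constructor
  · rintro ⟨a, b, h, h'⟩
    obtain ⟨rfl, rfl⟩ := edge_inj h
    exact h'
  · exact fun h => ⟨v, w, rfl, h⟩

theorem rels_eq_ofFn (S : Set (Fin n × Fin n)) : Encoding.rels S = List.ofFn fun e : Fin (n * n) =>
    Encoding.bit (∃ v w : Fin n, (v : ℕ) * n + w = e ∧ (v, w) ∈ S) := by
  rw [List.ofFn_mul, Encoding.rels]
  exact congrArg List.flatten (congrArg List.ofFn (funext fun i => congrArg List.ofFn
    (funext fun j => congrArg Encoding.bit (propext exists_edge_eq.symm))))

open Classical in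
theorem word_eq (p : Set (Fin n) × Set (Fin n × Fin n)) : word p =
    (List.range n).map (fun i => if ∃ h : i < n, (⟨i, h⟩ : Fin n) ∈ p.1 then 1 else 0) ++
    (List.range (n * n)).map fun e =>
      if ∃ v w : Fin n, (v : ℕ) * n + w = e ∧ (v, w) ∈ p.2 then 1 else 0 := by
  have hbit : ∀ q : Prop, ((Encoding.bit q : Encoding.Symb) : ℕ) = if q then 1 else 0 := by
    intro q
    unfold Encoding.bit
    split_ifs <;> rfl
  rw [word, Encoding.submodel, List.map_append]
  congr 1
  · refine List.ext_getElem (by simp [Encoding.worlds]) fun i h1 h2 => ?_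
    have hi : i < n := by simpa using h2
    simp [Encoding.worlds, hbit, hi]
  · rw [rels_eq_ofFn]
    refine List.ext_getElem (by simp) fun i h1 h2 => ?_
    simp [hbit]

/-- The two children of a node differ in the membership of one transition, so this makes their
outputs disjoint. -/
theorem mem_iff_of_word_eq {p q : Set (Fin n) × Set (Fin n × Fin n)} (h : word p = word q)
    (v w : Fin n) : (v, w) ∈ p.2 ↔ (v, w) ∈ q.2 := by
  classical
  rw [word_eq, word_eq] at h
  have h1 := (List.append_inj h (by simp)).2
  have h2 := List.map_inj_left.1 h1 (v * n + w) (List.mem_range.2 (edge_lt v w))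
  simp only [exists_edge_eq] at h2
  by_cases h3 : (v, w) ∈ p.2 <;> by_cases h4 : (v, w) ∈ q.2 <;> simp [h3, h4] at h2 ⊢

open Classical in
-- At a leaf each remaining edge with a discovered source is chosen. By connectedness a solution
-- cannot leave the discovered worlds, so its transitions are exactly the chosen ones and its worlds
-- exactly the discovered ones.
theorem word_of_leaf (hf : Valid G f) (ho : ¬ ∃ e, Open n G.M.r f e)
    {p : Set (Fin n) × Set (Fin n × Fin n)} (hp : p ∈ sols G f) :
    word p = leafWord n G.M.r f := by
  obtain ⟨h1, -, h3, h4⟩ := hp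
  have hin : ∀ v w : Fin n, Disc n G.M.r f v → (v, w) ∈ p.2 → inRel n f v w := by
    intro v w hd hvw
    have h5 := h4 v w hvw
    by_contra h6
    refine ho ⟨v * n + w, edge_lt v w, ?_, by rwa [edge_div]⟩
    unfold remRel at h5
    unfold inRel at h6
    omega
  have hd : ∀ v ∈ p.1, Disc n G.M.r f v := fun v hv =>
    h1.induction (p := fun v => Disc n G.M.r f v) (Or.inl rfl)
      (fun v w hvw hv => Or.inr ⟨v * n + w, edge_lt v w, hin v w hv hvw, edge_mod v w⟩) hv
  have hd' : ∀ v : Fin n, Disc n G.M.r f v → v ∈ p.1 := by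
    rintro v (h | ⟨e, he, h5, h6⟩)
    · rw [Fin.ext h]
      exact h1.root_mem
    · obtain ⟨a, b, rfl⟩ := exists_edge he
      rw [edge_mod] at h6
      rw [← Fin.ext h6]
      exact (h1.rel_on a b (h3 a b h5)).2
  rw [word_eq, leafWord]
  congr 1
  · refine List.map_congr_left fun i hi => ?_
    have hi' := List.mem_range.1 hi
    refine if_congr ⟨fun ⟨h, h'⟩ => hd _ h', fun h => ⟨hi', hd' ⟨i, hi'⟩ h⟩⟩ rfl rfl
  · refine List.map_congr_left fun e he => ?_
    obtain ⟨v, w, rfl⟩ := exists_edge (List.mem_range.1 he)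
    have h7 := hf.le_two (v * n + w) (edge_lt v w)
    by_cases h8 : inRel n f v w
    · rw [if_pos ⟨v, w, rfl, h3 v w h8⟩]
      unfold inRel at h8
      omega
    · rw [if_neg]
      · unfold inRel at h8
        omega
      · rintro ⟨a, b, h, h'⟩
        obtain ⟨rfl, rfl⟩ := edge_inj h
        exact h8 (hin _ _ (hd _ (h1.rel_on _ _ h').1) h')

/-- The number of undecided edges. -/
def undecided (n : ℕ) (f : ℕ → ℕ) : ℕ := ((Finset.range (n * n)).filter fun e => f e = 1).card

theorem undecided_update {e x : ℕ} (he : e < n * n) (h1 : f e = 1) (hx : x ≠ 1) :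
    undecided n (Function.update f e x) + 1 = undecided n f := by
  have : (Finset.range (n * n)).filter (fun i => Function.update f e x i = 1) =
      ((Finset.range (n * n)).filter fun i => f i = 1).erase e := by
    ext i
    by_cases hi : i = e
    · simp [hi, hx]
    · simp [hi]
  rw [undecided, this]
  exact Finset.card_erase_add_one (by simp [he, h1])

/-- The lists without repetition of the outputs for the solutions below a node. -/
def Outputs (G : Game n) (f : ℕ → ℕ) : Set (List (List ℕ)) :=
  {ws | ws.Nodup ∧ ∀ y, y ∈ ws ↔ ∃ p ∈ sols G f, y = word p}

/-- The set `Q` is a continuation: it collects what may be output once the node has been left in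
backtracking mode. A descent decides one edge per round and so meets a leaf within `k + 1` rounds. A
return takes at most one round per trail entry and is followed by a descent of at most `n * n + 1`
rounds or by a halt. As the trail is no longer than `n * n`, `D` covers both. -/
theorem loops_body {D : ℕ} (hD : 2 * (n * n) + 2 ≤ D) (hB : n * n ≤ B) : ∀ (k : ℕ) {f : ℕ → ℕ}
    {t : List ℕ}, undecided n f = k → k + t.length ≤ n * n → Valid G f → (sols G f).Nonempty →
    ∀ Q : Set (List (List ℕ)), (∀ σ, At G f t σ → σ.v .mode = 1 →
      ∃ ws' ∈ Q, Loops (body.sem B) D (t.length + n * n + 2) σ ws') →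
    ∀ σ, At G f t σ → σ.v .mode = 0 →
      ∃ ws ∈ Outputs G f, ∃ ws' ∈ Q, Loops (body.sem B) D (k + 1) σ (ws ++ ws') := by
  intro k
  induction k using Nat.strong_induction_on with | _ k ih
  intro f t hk ht hf hs Q hQ σ hσ hm
  by_cases ho : ¬ ∃ e, Open n G.M.r f e
  · obtain ⟨h1, h2, h3, h4, h5⟩ := hσ.body_leaf (B := B) hm ho
    obtain ⟨ws', hw, hL⟩ := hQ _ h1 h2
    refine ⟨[leafWord n G.M.r f], ⟨by simp, fun y => ?_⟩, ws', hw, ?_⟩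
    · rw [List.mem_singleton]
      obtain ⟨p, hp⟩ := hs
      refine ⟨fun h => ⟨p, hp, h.trans (word_of_leaf hf ho hp).symm⟩, ?_⟩
      rintro ⟨p, hp, rfl⟩
      exact word_of_leaf hf ho hp
    · rw [List.singleton_append, ← h5]
      exact .output h3 h4 (hL.mono (by omega))
  · rw [not_not] at ho
    have hk0 : 0 < k := by
      obtain ⟨e, h1, h2, -⟩ := ho
      have := undecided_update h1 h2 (x := 0) (by simp)
      omega
    obtain ⟨e, he, h1, h2, h3, h4⟩ := hσ.body_push (B := B) (fun e he => hf.update_two he) hm ho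
      (by omega)
    have hu2 := undecided_update he.1 he.2.1 (x := 2) (by simp)
    have hu0 := undecided_update he.1 he.2.1 (x := 0) (by simp)
    have hv0 := hf.update_zero he.2.1
    have hv2 := hf.update_two he
    obtain ⟨v, w, hvw⟩ := exists_edge he.1
    have m2 := mem_sols_update_two (G := G) hvw.symm he.2.1
    have m0 := mem_sols_update_zero (G := G) hvw.symm he.2.1
    obtain ⟨k, rfl⟩ : ∃ k', k = k' + 1 := ⟨_, hk.symm.trans hu0.symm⟩
    replace ih := @ih k (Nat.lt_succ_self k)
    have hgo : (body.sem B σ).v .go ≠ 0 := by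
      by_cases hs2 : (sols G (Function.update f e 2)).Nonempty
      exacts [(h3 hs2).go, (h4 hs2).go]
    -- Resetting the edge to undecided restores the status array of the parent, so no other record
    -- of it is needed.
    have hf1 : Function.update f e 1 = f := by rw [← he.2.1, Function.update_eq_self]
    -- leaving the second child
    have hback0 : ∀ σ, At G (Function.update f e 0) (e :: t) σ → σ.v .mode = 1 →
        ∃ ws' ∈ Q, Loops (body.sem B) D ((e :: t).length + n * n + 2) σ ws' := by
      intro σ hσ hm
      obtain ⟨g1, g2, g3⟩ := hσ.body_pop (B := B) hm (by simp)
      rw [Function.update_idem, hf1] at g1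
      obtain ⟨ws', hw, hL⟩ := hQ _ g1 g2
      exact ⟨ws', hw, (Loops.next g3 g1.go hL).mono (by rw [List.length_cons]; omega)⟩
    by_cases hs2 : (sols G (Function.update f e 2)).Nonempty
    · by_cases hs0 : (sols G (Function.update f e 0)).Nonempty
      · obtain ⟨ws, hws, ws', hw, hL⟩ := ih (f := Function.update f e 2) (t := e :: t) (by omega)
          (by rw [List.length_cons]; omega) hv2 hs2
          -- The continuation of the first child: all outputs of the second child, followed by what
          -- comes after the parent.
          {ws | ∃ a ∈ Outputs G (Function.update f e 0), ∃ b ∈ Q, ws = a ++ b} (by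
            intro τ hτ hτm
            obtain ⟨g1, g2, -⟩ := hτ.body_sibling (B := B) hτm (by simp)
              (by rwa [Function.update_idem]) (by omega)
            rw [Function.update_idem] at g2
            obtain ⟨g3, g4⟩ := g2 hs0
            obtain ⟨a, ha, b, hb, hL⟩ := ih (f := Function.update f e 0) (t := e :: t) (by omega)
              (by rw [List.length_cons]; omega) hv0 hs0 Q hback0 _ g3 g4
            exact ⟨a ++ b, ⟨a, ha, b, hb, rfl⟩, (Loops.next g1 g3.go hL).mono (by omega)⟩)
          _ (h3 hs2) h1
        obtain ⟨a, ha, b, hb, rfl⟩ := hw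
        refine ⟨ws ++ a, ⟨List.Nodup.append hws.1 ha.1 ?_, fun y => ?_⟩, b, hb, ?_⟩
        · intro y hy hy'
          obtain ⟨p, hp, rfl⟩ := (hws.2 y).1 hy
          obtain ⟨q, hq, hpq⟩ := (ha.2 _).1 hy'
          exact ((m0 q).1 hq).2 ((mem_iff_of_word_eq hpq v w).1 ((m2 p).1 hp).2)
        · rw [List.mem_append, hws.2, ha.2]
          constructor
          · rintro (⟨p, hp, rfl⟩ | ⟨p, hp, rfl⟩)
            exacts [⟨p, ((m2 p).1 hp).1, rfl⟩, ⟨p, ((m0 p).1 hp).1, rfl⟩]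
          · rintro ⟨p, hp, rfl⟩
            by_cases h : (v, w) ∈ p.2
            exacts [Or.inl ⟨p, (m2 p).2 ⟨hp, h⟩, rfl⟩, Or.inr ⟨p, (m0 p).2 ⟨hp, h⟩, rfl⟩]
        · rw [List.append_assoc]
          exact .next h2 hgo hL
      · obtain ⟨ws, hws, ws', hw, hL⟩ := ih (f := Function.update f e 2) (t := e :: t) (by omega)
          (by rw [List.length_cons]; omega) hv2 hs2 Q (by
            intro τ hτ hτm
            obtain ⟨g1, -, g2⟩ := hτ.body_sibling (B := B) hτm (by simp)
              (by rwa [Function.update_idem]) (by omega)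
            rw [Function.update_idem, Function.update_idem, hf1] at g2
            obtain ⟨g3, g4⟩ := g2 hs0
            obtain ⟨b, hb, hL⟩ := hQ _ g3 g4
            exact ⟨b, hb, (Loops.next g1 g3.go hL).mono (by rw [List.length_cons]; omega)⟩)
          _ (h3 hs2) h1
        refine ⟨ws, ⟨hws.1, fun y => (hws.2 y).trans (exists_congr fun p =>
          and_congr_left fun _ => (m2 p).trans (and_iff_left_of_imp fun hp => ?_))⟩, ws', hw,
          .next h2 hgo hL⟩
        by_contra h
        exact hs0 ⟨p, (m0 p).2 ⟨hp, h⟩⟩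
    -- The node has a solution and none contains the edge, so the untested second child is not
    -- empty.
    · have hs0 : (sols G (Function.update f e 0)).Nonempty := by
        obtain ⟨p, hp⟩ := hs
        exact ⟨p, (m0 p).2 ⟨hp, fun h => hs2 ⟨p, (m2 p).2 ⟨hp, h⟩⟩⟩⟩
      obtain ⟨ws, hws, ws', hw, hL⟩ := ih (f := Function.update f e 0) (t := e :: t) (by omega)
        (by rw [List.length_cons]; omega) hv0 hs0 Q hback0 _ (h4 hs2) h1
      refine ⟨ws, ⟨hws.1, fun y => (hws.2 y).trans (exists_congr fun p =>
        and_congr_left fun _ => (m0 p).trans (and_iff_left_of_imp fun hp h => ?_))⟩, ws', hw,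
        .next h2 hgo hL⟩
      exact hs2 ⟨p, (m2 p).2 ⟨hp, h⟩⟩

theorem loops_of_start {D : ℕ} (hD : 2 * (n * n) + 2 ≤ D) (hB : n * n ≤ B) (hσ : At G f [] σ)
    (hf : Valid G f) (hm : σ.v .mode = 0 ∧ (sols G f).Nonempty ∨
      σ.v .mode = 1 ∧ ¬ (sols G f).Nonempty) :
    ∃ ws ∈ Outputs G f, Loops (body.sem B) D D σ ws := by
  have hback : ∀ σ, At G f [] σ → σ.v .mode = 1 →
      ∃ ws' ∈ ({[]} : Set (List (List ℕ))), Loops (body.sem B) D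
        (([] : List ℕ).length + n * n + 2) σ ws' := by
    intro τ hτ hτm
    obtain ⟨h1, h2⟩ := hτ.body_halt (B := B) hτm
    exact ⟨[], rfl, (Loops.halt (r := 0) h1 h2).mono (by omega)⟩
  rcases hm with ⟨hm, hs⟩ | ⟨hm, hs⟩
  · have hu : undecided n f ≤ n * n := (Finset.card_filter_le _ _).trans (by simp)
    obtain ⟨ws, hws, ws', hw, hL⟩ := loops_body hD hB _ rfl (by simpa using hu) hf hs _ hback σ hσ hm
    rw [Set.mem_singleton_iff.1 hw, List.append_nil] at hL
    exact ⟨ws, hws, hL.mono (by omega)⟩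
  · obtain ⟨ws', hw, hL⟩ := hback σ hσ hm
    rw [Set.mem_singleton_iff.1 hw] at hL
    refine ⟨[], ⟨by simp, fun y => ?_⟩, hL.mono (by simp; omega)⟩
    simp only [List.not_mem_nil, false_iff, not_exists, not_and]
    exact fun p hp => absurd ⟨p, hp⟩ hs

end RAM

/-! ### The encoded instance as a word in an array -/

namespace RAM

open Encoding

/-- The array `a` contains the word `l` from position `p` on. -/
def Reads (a : ℕ → ℕ) (p : ℕ) (l : List Symb) : Prop :=
  ∀ (i : ℕ) (h : i < l.length), a (p + i) = (l[i] : ℕ)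

theorem reads_cons {a : ℕ → ℕ} {p : ℕ} {c : Symb} {l : List Symb} :
    Reads a p (c :: l) ↔ a p = c ∧ Reads a (p + 1) l := by
  constructor
  · refine fun h => ⟨h 0 (by simp), fun i hi => ?_⟩
    have := h (i + 1) (by simpa using hi)
    rwa [← add_assoc, add_right_comm] at this
  · rintro ⟨h1, h2⟩ (_ | i) hi
    · exact h1
    · have := h2 i (by simpa using hi)
      rwa [add_assoc, add_comm 1 i] at this

theorem reads_append {a : ℕ → ℕ} {p : ℕ} {l l' : List Symb} :
    Reads a p (l ++ l') ↔ Reads a p l ∧ Reads a (p + l.length) l' := by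
  induction l generalizing p with
  | nil => simp [Reads]
  | cons c l ih =>
    rw [List.cons_append, reads_cons, reads_cons, ih, and_assoc, List.length_cons, add_assoc p 1,
      add_comm 1]

theorem reads_start {x : List Symb} : Reads (fun i => if 1 ≤ i ∧ i ≤ x.length then (start x).reg i
    else 0) 1 x := by
  intro i hi
  simp only
  rw [if_pos (by omega), add_comm, start_reg]
  simp [hi]

theorem nat_injective : Function.Injective Encoding.nat := by
  have h1 : Function.Injective Nat.bits := by
    refine Function.LeftInverse.injective (g := List.foldr Nat.bit 0) fun p => ?_
    induction p using Nat.binaryRec' with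
    | zero => simp
    | bit b n h ih => rw [Nat.bits_append_bit n b h, List.foldr_cons, ih]
  refine fun p q h => h1 (List.map_injective_iff.2 ?_ h)
  decide

theorem lt_two_of_mem_nat {p : ℕ} {c : Symb} (h : c ∈ Encoding.nat p) : c < 2 := by
  obtain ⟨b, -, rfl⟩ := List.mem_map.1 h
  cases b <;> decide

/-- The words of bits at the positions `i` and `j`, ended by symbols other than bits, agree. -/
def MatchAt (a : ℕ → ℕ) (i j : ℕ) : Prop :=
  ∃ k, (∀ l < k, a (i + l) = a (j + l) ∧ a (i + l) < 2) ∧ 2 ≤ a (i + k) ∧ 2 ≤ a (j + k)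

theorem Reads.bits {a : ℕ → ℕ} {i : ℕ} {u : List Symb} {s : Symb} (h : Reads a i (u ++ [s]))
    (hu : ∀ c ∈ u, c < 2) (hs : 2 ≤ s) : (∀ l < u.length, a (i + l) < 2) ∧ 2 ≤ a (i + u.length) := by
  rw [reads_append, reads_cons] at h
  refine ⟨fun l hl => ?_, ?_⟩
  · rw [h.1 l hl]
    exact hu _ (List.getElem_mem hl)
  · rw [h.2.1]
    exact hs

/-- Bits are the only symbols below `2`, so the first symbol that is not a bit marks the length of
each word. The two terminators may differ: in a label, a proposition is ended by the next one or by
the end marker. -/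
theorem matchAt_iff {a : ℕ → ℕ} {i j : ℕ} {u v : List Symb} {s s' : Symb}
    (h : Reads a i (u ++ [s])) (h' : Reads a j (v ++ [s'])) (hu : ∀ c ∈ u, c < 2)
    (hv : ∀ c ∈ v, c < 2) (hs : 2 ≤ s) (hs' : 2 ≤ s') : MatchAt a i j ↔ u = v := by
  obtain ⟨h1, h2⟩ := h.bits hu hs
  obtain ⟨h3, h4⟩ := h'.bits hv hs'
  constructor
  · rintro ⟨k, hk, hk1, hk2⟩
    have e1 : k = u.length := by
      rcases lt_trichotomy k u.length with hlt | heq | hgt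
      · have := h1 k hlt
        omega
      · exact heq
      · have := (hk _ hgt).2
        omega
    have e2 : k = v.length := by
      rcases lt_trichotomy k v.length with hlt | heq | hgt
      · have := h3 k hlt
        omega
      · exact heq
      · have := hk _ hgt
        omega
    refine List.ext_getElem (e1.symm.trans e2) fun l hl hl' => ?_
    have := (hk l (by omega)).1
    rw [(reads_append.1 h).1 l hl, (reads_append.1 h').1 l hl'] at this
    exact Fin.ext this
  · rintro rfl
    refine ⟨u.length, fun l hl => ⟨?_, h1 l hl⟩, h2, h4⟩
    rw [(reads_append.1 h).1 l hl, (reads_append.1 h').1 l hl]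

/-- A proposition that matches the one at `q` is listed for the world `w`; the word is located at
`p`, and starts with the list for the world `w₀`. -/
def Listed (a : ℕ → ℕ) (q w : ℕ) : List Symb → ℕ → ℕ → Prop
  | [], _, _ => False
  | c :: l, p, w₀ => c = 4 ∧ w₀ = w ∧ MatchAt a (p + 1) q ∨
      Listed a q w l (p + 1) (if c = 2 then w₀ + 1 else w₀)

variable {a : ℕ → ℕ} {p q w w₀ : ℕ}

/-- Bits neither start a proposition nor end the list of a world, so a scan passes over them without
effect. -/
theorem listed_bits {u l : List Symb} (hu : ∀ c ∈ u, c < 2) :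
    Listed a q w (u ++ l) p w₀ ↔ Listed a q w l (p + u.length) w₀ := by
  induction u generalizing p with
  | nil => rfl
  | cons c u ih =>
    have hc := hu c (by simp)
    have h4 : c ≠ 4 := by rintro rfl; exact absurd hc (by decide)
    have h2 : c ≠ 2 := by rintro rfl; exact absurd hc (by decide)
    rw [List.cons_append, Listed, if_neg h2, ih fun c hc => hu c (List.mem_cons_of_mem _ hc),
      List.length_cons, add_assoc p 1, add_comm 1]
    simp [h4]

theorem label_nil : label [] = [2] := rfl

theorem label_cons (p : ℕ) (l : List ℕ) : label (p :: l) = 4 :: (Encoding.nat p ++ label l) := by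
  simp [label]

theorem exists_label_eq_cons (l : List ℕ) : ∃ s u, 2 ≤ s ∧ label l = s :: u := by
  cases l with
  | nil => exact ⟨2, [], le_rfl, rfl⟩
  | cons p l => exact ⟨4, _, by decide, label_cons p l⟩

theorem exists_label_eq_append (l : List ℕ) : ∃ u, (2 : Symb) ∉ u ∧ label l = u ++ [2] := by
  refine ⟨_, fun h => ?_, rfl⟩
  obtain ⟨v, hv, h⟩ := List.mem_flatten.1 h
  obtain ⟨p, -, rfl⟩ := List.mem_map.1 hv
  rcases List.mem_cons.1 h with h | h
  · exact absurd h (by decide)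
  · exact absurd (lt_two_of_mem_nat h) (by decide)

theorem listed_label {r : ℕ} (hq : Reads a q (Encoding.nat r ++ [2])) {l : List ℕ} {u : List Symb}
    (h : Reads a p (label l)) : Listed a q w (label l ++ u) p w₀ ↔
      w₀ = w ∧ r ∈ l ∨ Listed a q w u (p + (label l).length) (w₀ + 1) := by
  induction l generalizing p with
  | nil => simp [label_nil, Listed]
  | cons p' l ih =>
    -- The first symbol of the remaining label is the terminator of the bits of `p'`.
    obtain ⟨s, v, hs, hv⟩ := exists_label_eq_cons l
    rw [label_cons, reads_cons, reads_append] at h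
    have hm : MatchAt a (p + 1) q ↔ p' = r := by
      refine (matchAt_iff (s := s) ?_ hq (fun c => lt_two_of_mem_nat) (fun c => lt_two_of_mem_nat)
        hs le_rfl).trans nat_injective.eq_iff
      rw [reads_append, reads_cons]
      have := h.2.2
      rw [hv, reads_cons] at this
      exact ⟨h.2.1, this.1, by simp [Reads]⟩
    rw [label_cons, List.cons_append, Listed, List.append_assoc,
      listed_bits fun c => lt_two_of_mem_nat, if_neg (by decide), ih h.2.2, hm]
    simp only [List.mem_cons, List.length_cons, List.length_append, true_and, eq_comm (a := r)]
    rw [← or_assoc, ← and_or_left]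
    have : p + 1 + (Encoding.nat p').length + (label l).length =
      p + ((Encoding.nat p').length + (label l).length + 1) := by omega
    rw [this]

theorem listed_labels {r : ℕ} (hq : Reads a q (Encoding.nat r ++ [2])) {ls : List (List ℕ)}
    (h : Reads a p (ls.map label).flatten) : Listed a q w (ls.map label).flatten p w₀ ↔
      ∃ (j : ℕ) (hj : j < ls.length), w₀ + j = w ∧ r ∈ ls[j] := by
  induction ls generalizing p w₀ with
  | nil => simp [Listed]
  | cons l ls ih =>
    rw [List.map_cons, List.flatten_cons, reads_append] at h
    rw [List.map_cons, List.flatten_cons, listed_label hq h.1, ih h.2]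
    constructor
    · rintro (⟨rfl, h⟩ | ⟨j, hj, rfl, h⟩)
      · exact ⟨0, by simp, rfl, h⟩
      · exact ⟨j + 1, by simpa using hj, by omega, by simpa using h⟩
    · rintro ⟨_ | j, hj, rfl, h⟩
      · exact Or.inl ⟨rfl, h⟩
      · exact Or.inr ⟨j, by simpa using hj, by omega, by simpa using h⟩

/-- The mode reached from `m` by a sequence of operators; `true` stands for `AF`. -/
def modeOf (m : CTL.Mode) (ops : List Bool) : CTL.Mode :=
  ops.foldl (fun m b => if b then m.stepF else m.stepG) m

/-- The symbol of an operator. -/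
def opSymb (b : Bool) : Symb := if b then 11 else 13

/-- The syntactic form found by the parser and the normal form are tied to the same list of
operators, so folding over the symbols yields a mode with the right meaning. -/
theorem exists_ops (φ : CTL) (h : φ ∈ CTL.Fragment CTL.opsAFAG) : ∃ (ops : List Bool) (a : CTL),
    a.IsAtom ∧ formula φ = ops.map opSymb ++ formula a ∧
      ∀ {W : Type} (M : Kripke W) (m : CTL.Mode) (w : W),
        M.Sat (m.wrap φ) w ↔ M.Sat ((modeOf m ops).wrap a) w := by
  refine CTL.fragment_induction (p := fun φ => ∃ (ops : List Bool) (a : CTL),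
    a.IsAtom ∧ formula φ = ops.map opSymb ++ formula a ∧
      ∀ {W : Type} (M : Kripke W) (m : CTL.Mode) (w : W),
        M.Sat (m.wrap φ) w ↔ M.Sat ((modeOf m ops).wrap a) w) ?_ ?_ ?_ φ h
  · exact fun a ha => ⟨[], a, ha, rfl, fun M m w => Iff.rfl⟩
  · rintro φ ⟨ops, a, ha, h1, h2⟩
    exact ⟨true :: ops, a, ha, by simp [formula, h1, opSymb, unary],
      fun M m w => (M.sat_wrap_AF m φ w).trans (h2 M _ w)⟩
  · rintro φ ⟨ops, a, ha, h1, h2⟩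
    exact ⟨false :: ops, a, ha, by simp [formula, h1, opSymb, unary],
      fun M m w => (M.sat_wrap_AG m φ w).trans (h2 M _ w)⟩

end RAM

namespace RAM

open Encoding

/-! ### Reading the instance -/

namespace Stmt

/-- Move `pos` to the next occurrence of the symbol `c`. -/
def scanTo (c : ℕ) : Stmt := .loop .cnt .len (block [.load .sym .inp .pos, .set .tmp c,
  .dist .tmp .sym .tmp, .ifz .tmp .skip (.inc .pos)])

/-- Read the number of worlds. -/
def parseSize : Stmt := block [.set .one 1, .copy .pos .one, scanTo 0, .sub .num .pos .one,
  .inc .pos]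

/-- Read the root. -/
def parseRoot : Stmt := .loop .row .num (block [.load .sym .inp .pos,
  .ifz .sym .skip (.copy .root .row), .inc .pos])

/-- Read a row of the adjacency matrix. -/
def parseRow : Stmt := .loop .col .num (block [.load .sym .inp .pos, .store .src .edge .row,
  .store .tgt .edge .col, .store .stat .edge .sym, .inc .edge, .inc .pos])

/-- Read the adjacency matrix. -/
def parseEdges : Stmt := block [.set .edge 0, .loop .row .num parseRow, .copy .sq .edge]

/-- Move to the formula. -/
def skipLabels : Stmt := block [.copy .start .pos, .loop .row .num (block [scanTo 2, .inc .pos]),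
  .sub .rest .pos .start]

/-- Read the operators of the formula. -/
def parseOps : Stmt := block [.set .glob 0, .set .inner 0, .set .outer 0,
  .loop .cnt .len (block [.load .sym .inp .pos, .set .tmp 11, .dist .tmp .sym .tmp,
    .ifz .tmp (block [.copy .outer .num, .copy .inner .glob, .inc .pos]) (block [
      .set .tmp 13, .dist .tmp .sym .tmp,
      .ifz .tmp (block [.copy .glob .num, .set .inner 0, .inc .pos]) .skip])])]

/-- Advance `tmp` and `tpos` as long as they read the same bits. -/
def advance : Stmt := .loop .col .len (block [.load .val .inp .tmp, .load .aux .inp .tpos,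
  .dist .val .val .aux, .ifz .val (block [.sub .aux .aux .one,
    .ifz .aux (block [.inc .tmp, .inc .tpos]) .skip]) .skip])

/-- Compare the propositions at `pos` and at `sel`. -/
def compare : Stmt := block [.copy .tmp .pos, .inc .tmp, .copy .tpos .sel, .inc .tpos, advance,
  .load .val .inp .tmp, .sub .val .val .one, .load .aux .inp .tpos, .sub .aux .aux .one,
  .ifz .val .skip (.copy .val .aux)]

/-- Mark the world `wld` in `lab` if the proposition at `sel` is found at `pos`. -/
def checkProp : Stmt := block [.load .sym .inp .pos, .set .tmp 4, .dist .tmp .sym .tmp,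
  .ifz .tmp (block [compare, .ifz .val .skip (.store .lab .wld .one)]) .skip]

/-- Move to the next symbol. -/
def nextSymbol : Stmt := block [.set .tmp 2, .dist .tmp .sym .tmp, .ifz .tmp (.inc .wld) .skip,
  .inc .pos]

/-- Mark in `lab` the worlds that list the proposition at `sel`. -/
def searchLabels : Stmt := block [.set .wld 0, .copy .pos .start,
  .loop .cnt .rest (block [checkProp, nextSymbol])]

/-- Read the atom of the formula. -/
def parseAtom : Stmt := block [.copy .sel .pos, .load .sym .inp .pos, .set .tmp 3,
  .dist .tmp .sym .tmp, .ifz .tmp (.loop .row .num (.store .lab .row .one)) searchLabels]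

/-- Start the search. -/
def startSearch : Stmt := block [.set .top 0, .set .go 1, .set .mode 0, test,
  .ifz .ans (.copy .mode .one) .skip]

/-- Read the instance and start the search. -/
def init : Stmt := block [parseSize, parseRoot, parseEdges, skipLabels, parseOps, parseAtom,
  startSearch]

end Stmt

open Stmt

variable {n B : ℕ} {σ : Mem}

/-- The language has bounded loops only. A search is therefore a loop over the input length whose
surplus rounds do nothing. -/
theorem scanTo_spec {c : Symb} {u : List Symb} (h : Reads (σ.a .inp) (σ.v .pos) (u ++ [c]))
    (hu : c ∉ u) (hlen : u.length ≤ σ.v .len) (hB : σ.v .pos + u.length ≤ B) :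
    ((scanTo c).sem B σ).v .pos = σ.v .pos + u.length := by
  have key := loop_rule (B := B) (c := .cnt) (i := .len) (σ := σ)
    (s := block [.load .sym .inp .pos, .set .tmp c, .dist .tmp .sym .tmp,
      .ifz .tmp .skip (.inc .pos)])
    (fun m τ => τ.v .pos = σ.v .pos + min m u.length) (by simp) ?_
  · rw [min_eq_right hlen] at key
    exact key
  intro m τ hm hc hv ha hb hP
  rw [reads_append, reads_cons, ← ha .inp rfl] at h
  rcases Nat.lt_or_ge m u.length with hmu | hmu
  · rw [min_eq_left hmu.le] at hP
    have h1 := h.1 m hmu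
    have h2 : ¬ ((u[m] : ℕ) - c = 0 ∧ (c : ℕ) - u[m] = 0) := by
      rintro ⟨h3, h4⟩
      exact hu (by
        rw [← Fin.ext (show (u[m] : ℕ) = c by omega)]
        exact List.getElem_mem hmu)
    have h3 : min (σ.v .pos + m + 1) B = σ.v .pos + (m + 1) := by omega
    simp [block, Stmt.sem, hP, h1, h2, min_eq_left (show m + 1 ≤ u.length from hmu), h3]
  · rw [min_eq_right hmu] at hP
    simp [block, Stmt.sem, hP, h.2.1, min_eq_right (hmu.trans (Nat.le_succ m))]

theorem parseSize_spec {l : List Symb} (h : Reads (σ.a .inp) 1 (List.replicate n 1 ++ [0] ++ l))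
    (hlen : n ≤ σ.v .len) (hB : n + 2 ≤ B) :
    (parseSize.sem B σ).v .num = n ∧ (parseSize.sem B σ).v .pos = n + 2 ∧
      (parseSize.sem B σ).v .one = 1 := by
  have h1 := scanTo_spec (B := B) (σ := (block [.set .one 1, .copy .pos .one]).sem B σ) (c := 0)
    (u := List.replicate n 1) (by simpa [block, Stmt.sem] using (reads_append.1 h).1)
    (fun h => absurd (List.eq_of_mem_replicate h) (by decide))
    (by simpa [block, Stmt.sem] using hlen) (by simp [block, Stmt.sem]; omega)
  have h2 : ((scanTo 0).sem B ((block [.set .one 1, .copy .pos .one]).sem B σ)).v .one = 1 := by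
    rw [sem_v rfl]
    simp [block, Stmt.sem]
  change ((scanTo 0).sem B ((block [.set .one 1, .copy .pos .one]).sem B σ)).v .pos = _ at h1
  have e : parseSize.sem B σ = (block [.sub .num .pos .one, .inc .pos]).sem B
    ((scanTo 0).sem B ((block [.set .one 1, .copy .pos .one]).sem B σ)) := rfl
  have h3 : ((block [.set .one 1, .copy .pos .one]).sem B σ).v .pos = 1 := by
    simp [block, Stmt.sem]
  rw [h3, List.length_replicate] at h1
  rw [e]
  generalize (scanTo 0).sem B ((block [.set .one 1, .copy .pos .one]).sem B σ) = τ at *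
  have : min (1 + n + 1) B = n + 2 := by omega
  simp [block, Stmt.sem, h1, h2, this]

open Classical in
theorem parseRoot_spec {r : Fin n} (hn : σ.v .num = n)
    (h : Reads (σ.a .inp) (σ.v .pos) (worlds {r})) (hB : σ.v .pos + n ≤ B) :
    (parseRoot.sem B σ).v .root = r ∧ (parseRoot.sem B σ).v .pos = σ.v .pos + n := by
  have key := loop_rule (B := B) (c := .row) (i := .num) (σ := σ)
    (s := block [.load .sym .inp .pos, .ifz .sym .skip (.copy .root .row), .inc .pos])
    (fun m τ => (r < m → τ.v .root = r) ∧ τ.v .pos = σ.v .pos + m) (by simp) ?_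
  · rw [hn] at key
    exact ⟨key.1 r.2, key.2⟩
  rintro m τ hm hc hv ha hb ⟨h1, h2⟩
  rw [hn] at hm
  have h3 := h m (by simpa [worlds] using hm)
  have h4 : min (σ.v .pos + m + 1) B = σ.v .pos + (m + 1) := by omega
  rw [← ha .inp rfl, ← h2] at h3
  by_cases hr : m = r
  · have h5 : τ.a .inp (τ.v .pos) = 1 := by
      rw [h3]
      simp [worlds, bit, hr]
    rw [h2] at h5
    subst hr
    simp [block, Stmt.sem, h2, h4, h5, hc]
  · have h5 : τ.a .inp (τ.v .pos) = 0 := by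
      rw [h3]
      simp [worlds, bit, Fin.ext_iff, hr]
    rw [h2] at h5
    have h6 : (r : ℕ) ≤ m → τ.v .root = r := fun h => h1 (by omega)
    simpa [block, Stmt.sem, h2, h4, h5, Nat.lt_succ_iff] using h6

theorem mul_add_div_mod {i j : ℕ} (hj : j < n) : (i * n + j) / n = i ∧ (i * n + j) % n = j := by
  constructor
  · rw [Nat.mul_comm, Nat.mul_add_div (by omega), Nat.div_eq_of_lt hj, add_zero]
  · rw [Nat.mul_comm, Nat.mul_add_mod, Nat.mod_eq_of_lt hj]

/-- The first `k` edges have been read; the matrix starts at position `p`. -/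
def EdgesRead (n p k : ℕ) (σ : Mem) : Prop :=
  σ.v .edge = k ∧ σ.v .pos = p + k ∧
    ∀ e < k, σ.a .src e = e / n ∧ σ.a .tgt e = e % n ∧ σ.a .stat e = σ.a .inp (p + e)

theorem parseRow_spec {p i : ℕ} (hn : σ.v .num = n) (hi : σ.v .row = i)
    (h : EdgesRead n p (i * n) σ) (hB : p + (i * n + n) ≤ B) :
    EdgesRead n p (i * n + n) (parseRow.sem B σ) := by
  have key := loop_rule (B := B) (c := .col) (i := .num) (σ := σ)
    (s := block [.load .sym .inp .pos, .store .src .edge .row,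
      .store .tgt .edge .col, .store .stat .edge .sym, .inc .edge, .inc .pos])
    (fun j τ => EdgesRead n p (i * n + j) τ) (by simpa [EdgesRead] using h) ?_
  · rwa [hn] at key
  rintro j τ hj hc hv ha hb ⟨h1, h2, h3⟩
  rw [hn] at hj
  obtain ⟨h4, h5⟩ := mul_add_div_mod (i := i) hj
  have h6 : min (i * n + j + 1) B = i * n + (j + 1) := by omega
  have h7 : min (p + (i * n + j) + 1) B = p + (i * n + (j + 1)) := by omega
  have h8 : τ.v .row = i := by rw [hv _ rfl, hi]
  refine ⟨by simp [block, Stmt.sem, h1, h6], by simp [block, Stmt.sem, h2, h7], fun e he => ?_⟩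
  by_cases hej : e = i * n + j
  · simp [block, Stmt.sem, h1, h2, h8, hc, hej, h4, h5]
  · simpa [block, Stmt.sem, h1, h2, hej] using h3 e (by omega)

theorem parseEdges_spec {p : ℕ} (hn : σ.v .num = n) (hp : σ.v .pos = p) (hB : p + n * n ≤ B) :
    EdgesRead n p (n * n) (parseEdges.sem B σ) ∧ (parseEdges.sem B σ).v .sq = n * n := by
  have key := loop_rule (B := B) (c := .row) (i := .num) (σ := (set .edge 0).sem B σ)
    (s := parseRow) (fun i τ => EdgesRead n p (i * n) τ) (by simp [EdgesRead, Stmt.sem, hp]) ?_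
  · have e : parseEdges.sem B σ =
      (copy .sq .edge).sem B ((loop .row .num parseRow).sem B ((set .edge 0).sem B σ)) := rfl
    rw [sem_v (s := set .edge 0) rfl, hn] at key
    rw [e]
    exact ⟨by simpa [EdgesRead, Stmt.sem] using key, by simpa [Stmt.sem] using key.1⟩
  intro i τ hi hc hv ha hb hP
  have hn' : τ.v .num = n := by rw [hv _ rfl, sem_v rfl, hn]
  rw [sem_v rfl, hn] at hi
  have h1 := Nat.mul_le_mul_right n (Nat.succ_le_of_lt hi)
  rw [Nat.succ_mul] at h1
  have := parseRow_spec (B := B) hn' hc hP (by omega)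
  rw [Nat.add_mul, one_mul]
  simpa [EdgesRead] using this

theorem skipLabels_spec {ls : List (List ℕ)} (hn : σ.v .num = ls.length)
    (h : Reads (σ.a .inp) (σ.v .pos) (ls.map label).flatten)
    (hlen : (ls.map label).flatten.length ≤ σ.v .len)
    (hB : σ.v .pos + (ls.map label).flatten.length ≤ B) :
    (skipLabels.sem B σ).v .start = σ.v .pos ∧
    (skipLabels.sem B σ).v .pos = σ.v .pos + (ls.map label).flatten.length ∧
    (skipLabels.sem B σ).v .rest = (ls.map label).flatten.length := by
  have key := loop_rule (B := B) (c := .row) (i := .num) (σ := (copy .start .pos).sem B σ)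
    (s := block [scanTo 2, .inc .pos])
    (fun m τ => Reads (σ.a .inp) (τ.v .pos) ((ls.drop m).map label).flatten ∧
      τ.v .pos + ((ls.drop m).map label).flatten.length =
        σ.v .pos + (ls.map label).flatten.length ∧ σ.v .pos ≤ τ.v .pos) (by simpa [Stmt.sem] using h) ?_
  · have h1 : ((loop .row .num (block [scanTo 2, .inc .pos])).sem B
        ((copy .start .pos).sem B σ)).v .start = σ.v .pos := by
      rw [sem_v rfl]
      simp [Stmt.sem]
    have e : skipLabels.sem B σ = (sub .rest .pos .start).sem B
      ((loop .row .num (block [scanTo 2, .inc .pos])).sem B ((copy .start .pos).sem B σ)) := rfl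
    rw [e]
    rw [sem_v (s := copy .start .pos) rfl, hn] at key
    generalize (loop .row .num (block [scanTo 2, .inc .pos])).sem B
        ((copy .start .pos).sem B σ) = τ at *
    have h2 := key.2.1
    simp only [List.drop_length, List.map_nil, List.flatten_nil, List.length_nil, add_zero] at h2
    simp [Stmt.sem, h1, h2]
  rintro m τ hm hc hv ha hb ⟨h1, h2, h5⟩
  rw [sem_v rfl, hn] at hm
  obtain ⟨u, hu, hl⟩ := exists_label_eq_append ls[m]
  rw [List.drop_eq_getElem_cons hm, List.map_cons, List.flatten_cons, hl] at h1 h2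
  rw [reads_append] at h1
  simp only [List.length_append, List.length_cons, List.length_nil, zero_add] at h1 h2
  have ha' : τ.a .inp = σ.a .inp := ha _ rfl
  have hlen' : τ.v .len = σ.v .len := by
    rw [hv _ rfl, sem_v rfl]
  have h3 := scanTo_spec (B := B) (σ := τ) (c := 2) (u := u) (by rw [ha']; exact h1.1) hu
    (by omega) (by omega)
  have h4 : ((block [scanTo 2, .inc .pos]).sem B τ).v .pos = τ.v .pos + (u.length + 1) := by
    change min (((scanTo ((2 : Symb) : ℕ)).sem B τ).v .pos + 1) B = _
    rw [h3]
    omega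
  simp only [Mem.setV_v, reduceCtorEq, if_false, h4]
  exact ⟨h1.2, by omega, by omega⟩

/-- The value of `glob` for a mode. -/
def globOf (n : ℕ) : CTL.Mode → ℕ
  | .id => 0
  | .F => 0
  | .G => n
  | .FG => n
  | .GF => n

/-- The scalars `glob`, `inner`, `outer` represent the mode, each being `0` or `n`. Reading `AF`
switches `outer` on and copies `glob` to `inner`; reading `AG` switches `glob` on and `inner` off.
These are the transitions `stepF` and `stepG`. -/
theorem parseOps_spec {ops : List Bool} {c : Symb} (hc3 : c = 3 ∨ c = 4) (hn : σ.v .num = n)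
    (h : Reads (σ.a .inp) (σ.v .pos) (ops.map opSymb ++ [c])) (hlen : ops.length ≤ σ.v .len)
    (hB : σ.v .pos + ops.length ≤ B) :
    (parseOps.sem B σ).v .pos = σ.v .pos + ops.length ∧
    (parseOps.sem B σ).v .glob = globOf n (modeOf .id ops) ∧
    (parseOps.sem B σ).v .inner = Kripke.Mode.inner n (modeOf .id ops) ∧
    (parseOps.sem B σ).v .outer = Kripke.Mode.outer n (modeOf .id ops) := by
  set s₀ := block [.set .glob 0, .set .inner 0, .set .outer 0]
  have hl : (s₀.sem B σ).v .len = σ.v .len := sem_v rfl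
  have hp : (s₀.sem B σ).v .pos = σ.v .pos := sem_v rfl
  have hn0 : (s₀.sem B σ).v .num = n := (sem_v rfl).trans hn
  have ha0 : (s₀.sem B σ).a .inp = σ.a .inp := sem_a rfl
  have hg : (s₀.sem B σ).v .glob = 0 ∧ (s₀.sem B σ).v .inner = 0 ∧ (s₀.sem B σ).v .outer = 0 := by
    simp [s₀, block, Stmt.sem]
  have key := loop_rule (B := B) (c := .cnt) (i := .len) (σ := s₀.sem B σ)
    (s := block [.load .sym .inp .pos, .set .tmp 11, .dist .tmp .sym .tmp,
    .ifz .tmp (block [.copy .outer .num, .copy .inner .glob, .inc .pos]) (block [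
      .set .tmp 13, .dist .tmp .sym .tmp,
      .ifz .tmp (block [.copy .glob .num, .set .inner 0, .inc .pos]) .skip])])
    (fun m τ => τ.v .pos = σ.v .pos + min m ops.length ∧
      τ.v .glob = globOf n (modeOf .id (ops.take m)) ∧
      τ.v .inner = Kripke.Mode.inner n (modeOf .id (ops.take m)) ∧
      τ.v .outer = Kripke.Mode.outer n (modeOf .id (ops.take m)))
    ⟨by simp [hp], hg⟩ ?_
  · rw [hl, min_eq_right hlen, List.take_of_length_le hlen] at key
    exact key
  rintro m τ hm hc hv ha hb ⟨h1, h2, h3, h4⟩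
  rw [reads_append, reads_cons, ← ha0, ← ha .inp rfl, List.length_map] at h
  have hn' : τ.v .num = n := by rw [hv _ rfl, hn0]
  rcases Nat.lt_or_ge m ops.length with hmu | hmu
  · rw [min_eq_left hmu.le] at h1
    have h5 := h.1 m (by simpa using hmu)
    rw [List.getElem_map] at h5
    have h6 : min (σ.v .pos + m + 1) B = σ.v .pos + (m + 1) := by omega
    have h7 : modeOf .id (ops.take (m + 1)) =
        if ops[m] then (modeOf .id (ops.take m)).stepF else (modeOf .id (ops.take m)).stepG := by
      rw [List.take_succ_eq_append_getElem hmu, modeOf, List.foldl_append]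
      rfl
    rw [h7]
    generalize modeOf .id (ops.take m) = md at *
    cases hop : ops[m]
    · have h8 : τ.a .inp (σ.v .pos + m) = 13 := by
        rw [h5, hop]
        rfl
      cases md <;> simp [block, Stmt.sem, h1, h4, h8, h6, hn', CTL.Mode.stepG, globOf,
        Kripke.Mode.inner, Kripke.Mode.outer, min_eq_left (show m + 1 ≤ ops.length from hmu)]
    · have h8 : τ.a .inp (σ.v .pos + m) = 11 := by
        rw [h5, hop]
        rfl
      cases md <;> simp [block, Stmt.sem, h1, h2, h8, h6, hn', CTL.Mode.stepF, globOf,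
        Kripke.Mode.inner, Kripke.Mode.outer, min_eq_left (show m + 1 ≤ ops.length from hmu)]
  · rw [min_eq_right hmu] at h1
    rw [List.take_of_length_le hmu] at h2 h3 h4
    rw [List.take_of_length_le (hmu.trans (Nat.le_succ m))]
    have h8 := h.2.1
    rcases hc3 with rfl | rfl <;>
      simp [block, Stmt.sem, h1, h2, h3, h4, h8, min_eq_right (hmu.trans (Nat.le_succ m))]

theorem compare_spec {q : ℕ} {u v : List Symb} {s s' : Symb} (hsel : σ.v .sel = q)
    (h : Reads (σ.a .inp) (σ.v .pos + 1) (u ++ [s])) (h' : Reads (σ.a .inp) (q + 1) (v ++ [s']))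
    (hu : ∀ c ∈ u, c < 2) (hv : ∀ c ∈ v, c < 2) (hs : 2 ≤ s) (hs' : 2 ≤ s')
    (hone : σ.v .one = 1)
    (hlen : u.length < σ.v .len) (hB : σ.v .pos + u.length + 1 ≤ B) (hB' : q + v.length + 1 ≤ B) :
    (compare.sem B σ).v .val ≠ 0 ↔ MatchAt (σ.a .inp) (σ.v .pos + 1) (q + 1) := by
  obtain ⟨g1, g2⟩ := h.bits hu hs
  obtain ⟨g3, g4⟩ := h'.bits hv hs'
  set p := σ.v .pos
  set s₀ := block [.copy .tmp .pos, .inc .tmp, .copy .tpos .sel, .inc .tpos]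
  set a := σ.a .inp
  have hl : (s₀.sem B σ).v .len = σ.v .len := sem_v rfl
  have hp : (s₀.sem B σ).v .tmp = p + 1 ∧ (s₀.sem B σ).v .tpos = q + 1 := by
    have e1 : min (p + 1) B = p + 1 := by omega
    have e2 : min (q + 1) B = q + 1 := by omega
    simp [s₀, block, Stmt.sem, hsel, p, e1, e2]
  have hone0 : (s₀.sem B σ).v .one = 1 := (sem_v rfl).trans hone
  have ha0 : (s₀.sem B σ).a .inp = a := sem_a rfl
  -- In the invariant `k` counts the agreeing bits. It keeps pace with the rounds until the first
  -- position that disagrees or holds no bit, and then stays fixed.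
  have key := loop_rule (B := B) (c := .col) (i := .len) (σ := s₀.sem B σ)
    (s := block [.load .val .inp .tmp, .load .aux .inp .tpos, .dist .val .val .aux,
      .ifz .val (block [.sub .aux .aux .one, .ifz .aux (block [.inc .tmp, .inc .tpos]) .skip])
      .skip])
    (fun m τ => ∃ k, τ.v .tmp = p + 1 + k ∧ τ.v .tpos = q + 1 + k ∧
      (∀ l < k, a (p + 1 + l) = a (q + 1 + l) ∧ a (p + 1 + l) < 2) ∧
      (k = m ∨ ¬ (a (p + 1 + k) = a (q + 1 + k) ∧ a (p + 1 + k) < 2)))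
    ⟨0, by simpa using hp.1, by simpa using hp.2, by simp, Or.inl rfl⟩ ?_
  · change ∃ k, (advance.sem B (s₀.sem B σ)).v .tmp = p + 1 + k ∧
      (advance.sem B (s₀.sem B σ)).v .tpos = q + 1 + k ∧ _ at key
    rw [hl] at key
    obtain ⟨k, k1, k2, k3, k4⟩ := key
    have e : compare.sem B σ = (block [.load .val .inp .tmp, .sub .val .val .one,
      .load .aux .inp .tpos, .sub .aux .aux .one, .ifz .val .skip (.copy .val .aux)]).sem B
        (advance.sem B (s₀.sem B σ)) := rfl
    have e1 : (advance.sem B (s₀.sem B σ)).v .one = 1 := (sem_v rfl).trans hone0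
    have e2 : (advance.sem B (s₀.sem B σ)).a .inp = a := (sem_a rfl).trans ha0
    have e3 : (compare.sem B σ).v .val ≠ 0 ↔ 2 ≤ a (p + 1 + k) ∧ 2 ≤ a (q + 1 + k) := by
      rw [e]
      generalize advance.sem B (s₀.sem B σ) = τ at *
      by_cases e4 : a (p + 1 + k) - 1 = 0
      · simp [block, Stmt.sem, e1, e2, k1, k2, e4]
        omega
      · simp [block, Stmt.sem, e1, e2, k1, k2, e4]
        omega
    rw [e3]
    refine ⟨fun h => ⟨k, k3, h⟩, ?_⟩
    rintro ⟨k', k5, k6⟩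
    have hkk : k = k' := by
      rcases lt_trichotomy k k' with hlt | heq | hgt
      -- If `k` equalled the number of rounds, the common run of bits would be longer than the word
      -- `u`.
      · rcases k4 with rfl | k4
        · have := k5 u.length (by omega)
          omega
        · exact absurd (k5 k hlt) k4
      · exact heq
      · have := k3 k' hgt
        omega
    rw [hkk]
    exact k6
  rintro m τ hm hc hvv ha hb ⟨k, k1, k2, k3, k4⟩
  have f1 : τ.v .one = 1 := by rw [hvv _ rfl, hone0]
  have f2 : τ.a .inp = a := by rw [ha _ rfl, ha0]
  by_cases hk : a (p + 1 + k) = a (q + 1 + k) ∧ a (p + 1 + k) < 2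
  · have hku : k < u.length := by
      by_contra hku
      rcases Nat.lt_or_ge u.length k with h6 | h6
      · have := k3 _ h6
        omega
      · have : k = u.length := by omega
        subst this
        omega
    have hkv : k < v.length := by
      by_contra hkv
      rcases Nat.lt_or_ge v.length k with h6 | h6
      · have := k3 _ h6
        omega
      · have : k = v.length := by omega
        subst this
        omega
    have e1 : min (p + 1 + k + 1) B = p + 1 + (k + 1) := by omega
    have e2 : min (q + 1 + k + 1) B = q + 1 + (k + 1) := by omega
    have e3 : a (q + 1 + k) - 1 = 0 := by omega
    refine ⟨k + 1, ?_, ?_, fun l hl => ?_, ?_⟩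
    · simp [block, Stmt.sem, f1, f2, k1, k2, hk.1, e3, e1]
    · simp [block, Stmt.sem, f1, f2, k1, k2, hk.1, e3, e2]
    · rcases Nat.lt_succ_iff_lt_or_eq.1 hl with hl | rfl
      exacts [k3 l hl, hk]
    · rcases k4 with rfl | k4
      exacts [Or.inl rfl, absurd hk k4]
  · refine ⟨k, ?_, ?_, k3, Or.inr hk⟩
    · by_cases e4 : a (p + 1 + k) - a (q + 1 + k) = 0 ∧ a (q + 1 + k) - a (p + 1 + k) = 0
      · have e5 : ¬ a (q + 1 + k) - 1 = 0 := by omega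
        simp [block, Stmt.sem, f1, f2, k1, k2, e4, e5]
      · simp [block, Stmt.sem, f2, k1, k2, e4]
    · by_cases e4 : a (p + 1 + k) - a (q + 1 + k) = 0 ∧ a (q + 1 + k) - a (p + 1 + k) = 0
      · have e5 : ¬ a (q + 1 + k) - 1 = 0 := by omega
        simp [block, Stmt.sem, f1, f2, k1, k2, e4, e5]
      · simp [block, Stmt.sem, f2, k1, k2, e4]

end RAM

/-! ### Marking the worlds that satisfy the atom -/

namespace RAM

open Encoding Stmt

variable {n B : ℕ} {σ : Mem}

theorem exists_eq_bits_append {l : List Symb} (h : (2 : Symb) ∈ l) :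
    ∃ u s v, l = u ++ s :: v ∧ (∀ c ∈ u, c < 2) ∧ 2 ≤ s := by
  induction l with
  | nil => simp at h
  | cons c l ih =>
    by_cases hc : 2 ≤ c
    · exact ⟨[], c, l, rfl, by simp, hc⟩
    · rcases List.mem_cons.1 h with rfl | h
      · exact absurd le_rfl hc
      · obtain ⟨u, s, v, rfl, hu, hs⟩ := ih h
        refine ⟨c :: u, s, v, rfl, ?_, hs⟩
        rintro d (_ | ⟨_, hd⟩)
        exacts [not_le.1 hc, hu d hd]

/-- The labels end with the end marker. So a proposition found inside them is terminated before the
formula begins, and the comparison does not run beyond the labels. -/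
theorem two_mem_of_suffix {ls : List (List ℕ)} {l : List Symb}
    (h : (4 :: l) <:+ (ls.map label).flatten) : (2 : Symb) ∈ l := by
  have key : ∀ ls : List (List ℕ), (ls.map label).flatten = [] ∨
      ∃ u, (ls.map label).flatten = u ++ [2] := by
    intro ls
    induction ls with
    | nil => exact Or.inl rfl
    | cons l ls ih =>
      right
      rw [List.map_cons, List.flatten_cons]
      rcases ih with ih | ⟨u, ih⟩
      · obtain ⟨u, -, hu⟩ := exists_label_eq_append l
        exact ⟨u, by rw [ih, hu, List.append_nil]⟩
      · exact ⟨label l ++ u, by rw [ih, List.append_assoc]⟩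
  rcases key ls with h' | ⟨u, h'⟩
  · rw [h'] at h
    simp at h
  · rw [h'] at h
    have h2 := h.getLast (by simp)
    rw [List.getLast_append_singleton] at h2
    have h3 := List.getLast_mem (l := 4 :: l) (by simp)
    rw [h2] at h3
    rcases List.mem_cons.1 h3 with h3 | h3
    exacts [absurd h3 (by decide), h3]

theorem checkProp_spec {r : ℕ} (hone : σ.v .one = 1)
    (h' : Reads (σ.a .inp) (σ.v .sel + 1) (Encoding.nat r ++ [2]))
    (h : σ.a .inp (σ.v .pos) = 4 → ∃ u s, Reads (σ.a .inp) (σ.v .pos + 1) (u ++ [s]) ∧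
      (∀ c ∈ u, c < 2) ∧ 2 ≤ s ∧ u.length < σ.v .len ∧ σ.v .pos + u.length + 1 ≤ B)
    (hB : σ.v .sel + (Encoding.nat r).length + 1 ≤ B) (w : ℕ) :
    (checkProp.sem B σ).v .sym = σ.a .inp (σ.v .pos) ∧
    ((checkProp.sem B σ).a .lab w ≠ 0 ↔ σ.a .lab w ≠ 0 ∨ σ.a .inp (σ.v .pos) = 4 ∧ σ.v .wld = w ∧
      MatchAt (σ.a .inp) (σ.v .pos + 1) (σ.v .sel + 1)) := by
  set s₀ := block [.load .sym .inp .pos, .set .tmp 4, .dist .tmp .sym .tmp]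
  have hsym : (s₀.sem B σ).v .sym = σ.a .inp (σ.v .pos) := by simp [s₀, block, Stmt.sem]
  have htmp : (s₀.sem B σ).v .tmp = 0 ↔ σ.a .inp (σ.v .pos) = 4 := by
    simp [s₀, block, Stmt.sem]
    omega
  have e : checkProp.sem B σ = (ifz .tmp (block [compare, .ifz .val .skip (.store .lab .wld .one)])
    .skip).sem B (s₀.sem B σ) := rfl
  constructor
  · rw [e, sem_v rfl, hsym]
  by_cases h4 : σ.a .inp (σ.v .pos) = 4
  · obtain ⟨u, s, h1, h2, h3, h5, h6⟩ := h h4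
    have hpos : (s₀.sem B σ).v .pos = σ.v .pos := sem_v rfl
    have hlen : (s₀.sem B σ).v .len = σ.v .len := sem_v rfl
    have hsel : (s₀.sem B σ).v .sel = σ.v .sel := sem_v rfl
    have hinp : (s₀.sem B σ).a .inp = σ.a .inp := sem_a rfl
    have hone' : (s₀.sem B σ).v .one = 1 := (sem_v rfl).trans hone
    have hlab : (s₀.sem B σ).a .lab = σ.a .lab := sem_a rfl
    have hwld : (s₀.sem B σ).v .wld = σ.v .wld := sem_v rfl
    have hc := compare_spec (B := B) (σ := s₀.sem B σ) hsel (by rwa [hinp, hpos])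
      (by rwa [hinp]) h2 (fun c => lt_two_of_mem_nat) h3 le_rfl hone' (by rwa [hlen])
      (by rwa [hpos]) hB
    rw [hinp, hpos] at hc
    have hlab' : (compare.sem B (s₀.sem B σ)).a .lab = σ.a .lab := (sem_a rfl).trans hlab
    have hwld' : (compare.sem B (s₀.sem B σ)).v .wld = σ.v .wld := (sem_v rfl).trans hwld
    have hone'' : (compare.sem B (s₀.sem B σ)).v .one = 1 := (sem_v rfl).trans hone'
    have e' : checkProp.sem B σ = (ifz .val .skip (.store .lab .wld .one)).sem B
        (compare.sem B (s₀.sem B σ)) := by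
      rw [e, sem_ifz_of_eq (htmp.2 h4)]
      rfl
    rw [e', ← hc]
    generalize compare.sem B (s₀.sem B σ) = τ at *
    by_cases hval : τ.v .val = 0
    · rw [sem_ifz_of_eq hval]
      simp [Stmt.sem, hlab', hval]
    · rw [sem_ifz_of_ne hval]
      by_cases hw : w = σ.v .wld
      · simp [Stmt.sem, hwld', hone'', hw, hval, h4]
      · simp [Stmt.sem, hwld', hw, hlab', Ne.symm hw]
  · rw [e, sem_ifz_of_ne (mt htmp.1 h4)]
    have : (s₀.sem B σ).a .lab = σ.a .lab := sem_a rfl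
    simp [Stmt.sem, h4, this]

/-- One scan over the labels with the current world in `wld`. Invariant: the marks set so far
together with what `Listed` still finds in the rest amount to `Listed` on the whole word. -/
theorem searchLabels_spec {r : ℕ} {ls : List (List ℕ)} (hone : σ.v .one = 1)
    (hlab : ∀ w, σ.a .lab w = 0)
    (h' : Reads (σ.a .inp) (σ.v .sel + 1) (Encoding.nat r ++ [2]))
    (hB : σ.v .sel + (Encoding.nat r).length + 1 ≤ B)
    (h : Reads (σ.a .inp) (σ.v .start) (ls.map label).flatten)
    (hrest : σ.v .rest = (ls.map label).flatten.length)
    (hlen : (ls.map label).flatten.length ≤ σ.v .len)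
    (hB' : σ.v .start + (ls.map label).flatten.length ≤ B) (w : ℕ) :
    (searchLabels.sem B σ).a .lab w ≠ 0 ↔ ∃ hw : w < ls.length, r ∈ ls[w] := by
  set R := (ls.map label).flatten with hR
  set s₀ := block [.set .wld 0, .copy .pos .start]
  set p := σ.v .start
  set q := σ.v .sel
  set a := σ.a .inp
  have hrest0 : (s₀.sem B σ).v .rest = R.length := (sem_v rfl).trans hrest
  have hone0 : (s₀.sem B σ).v .one = 1 := (sem_v rfl).trans hone
  have hsel0 : (s₀.sem B σ).v .sel = q := sem_v rfl
  have hlen0 : (s₀.sem B σ).v .len = σ.v .len := sem_v rfl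
  have hinp0 : (s₀.sem B σ).a .inp = a := sem_a rfl
  have h0 : (s₀.sem B σ).v .wld = 0 ∧ (s₀.sem B σ).v .pos = p := by
    simp [s₀, block, Stmt.sem, p]
  have hlab0 : (s₀.sem B σ).a .lab = σ.a .lab := sem_a rfl
  have key := loop_rule (B := B) (c := .cnt) (i := .rest) (σ := s₀.sem B σ)
    (s := block [checkProp, nextSymbol])
    (fun m τ => τ.v .pos = p + m ∧ τ.v .wld ≤ m ∧
      ∀ w, (τ.a .lab w ≠ 0 ∨ Listed a (q + 1) w (R.drop m) (p + m) (τ.v .wld)) ↔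
        Listed a (q + 1) w R p 0) (by simp [h0, hlab0, hlab]) ?_
  · rw [hrest0] at key
    have e : searchLabels.sem B σ = (loop .cnt .rest (block [checkProp, nextSymbol])).sem B
      (s₀.sem B σ) := rfl
    have h2 := key.2.2 w
    rw [List.drop_length, listed_labels h' h] at h2
    rw [e]
    simpa [Listed] using h2
  rintro m τ hm hc hv ha hb ⟨h1, h2, h3⟩
  rw [hrest0] at hm
  have f1 : τ.v .one = 1 := by rw [hv _ rfl, hone0]
  have f2 : τ.v .sel = q := by rw [hv _ rfl, hsel0]
  have f3 : τ.v .len = σ.v .len := by rw [hv _ rfl, hlen0]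
  have f4 : τ.a .inp = a := by rw [ha _ rfl, hinp0]
  have hdrop := List.drop_eq_getElem_cons hm
  have hRm := h m hm
  have hcheck := fun w => checkProp_spec (B := B) (σ := τ) (r := r) f1
    (by rwa [f2, f4]) (by
      intro h4
      rw [h1, f4] at h4
      have h5 : R[m] = 4 := Fin.ext (hRm.symm.trans h4)
      rw [h5] at hdrop
      obtain ⟨u, s, v, h6, h7, h8⟩ := exists_eq_bits_append
        (two_mem_of_suffix (hdrop ▸ List.drop_suffix m R))
      have h9 : R = R.take m ++ (4 :: (u ++ s :: v)) := by
        rw [← h6, ← hdrop, List.take_append_drop]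
      have h10 := congrArg List.length h9
      simp only [List.length_append, List.length_cons, List.length_take, min_eq_left hm.le] at h10
      rw [h9, reads_append, List.length_take, min_eq_left hm.le, reads_cons] at h
      refine ⟨u, s, ?_, h7, h8, by omega, by omega⟩
      have h11 := h.2.2
      rw [List.append_cons, reads_append] at h11
      rw [f4, h1]
      exact h11.1) (by rwa [f2]) w
  rw [h1, f2, f4] at hcheck
  have g1 : (checkProp.sem B τ).v .pos = p + m := (sem_v rfl).trans h1
  have g2 : (checkProp.sem B τ).v .wld = τ.v .wld := sem_v rfl
  have e : (block [checkProp, nextSymbol]).sem B τ = nextSymbol.sem B (checkProp.sem B τ) := rfl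
  rw [e]
  generalize checkProp.sem B τ = ρ at *
  have e1 : min (p + m + 1) B = p + (m + 1) := by omega
  have e2 : min (τ.v .wld + 1) B = τ.v .wld + 1 := by omega
  have e3 : (nextSymbol.sem B ρ).v .pos = p + (m + 1) := by
    change min (((block [.set .tmp 2, .dist .tmp .sym .tmp, .ifz .tmp (.inc .wld) .skip]).sem B
      ρ).v .pos + 1) B = _
    rw [sem_v rfl, g1, e1]
  have e4 : (nextSymbol.sem B ρ).v .wld = if R[m] = 2 then τ.v .wld + 1 else τ.v .wld := by
    have h5 := (hcheck 0).1
    rw [hRm] at h5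
    by_cases hR2 : R[m] = 2
    · rw [hR2] at h5
      simp [nextSymbol, block, Stmt.sem, g2, h5, hR2, e2]
    · have h6 : ¬ ((R[m] : ℕ) - 2 = 0 ∧ 2 - (R[m] : ℕ) = 0) := fun h6 =>
        hR2 (Fin.ext (show (R[m] : ℕ) = 2 by omega))
      simp [nextSymbol, block, Stmt.sem, g2, h5, hR2, h6]
  have e5 : (nextSymbol.sem B ρ).a .lab = ρ.a .lab := sem_a rfl
  refine ⟨by simpa using e3, ?_, fun w => ?_⟩
  · simp only [Mem.setV_v, reduceCtorEq, if_false, e4]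
    split_ifs <;> omega
  · rw [← h3 w, hdrop, Listed]
    simp only [Mem.setV_v, Mem.setV_a, reduceCtorEq, if_false, e4, e5, (hcheck w).2, or_assoc]
    rw [hRm, add_assoc p m 1]
    have : (R[m] : ℕ) = 4 ↔ R[m] = 4 := ⟨fun h => Fin.ext h, fun h => by rw [h]; rfl⟩
    rw [this]

end RAM

/-! ### From the input to the root of the search tree -/

namespace RAM

open Encoding Stmt

variable {n B : ℕ} {σ : Mem}

theorem parseAtom_spec {M : Kripke (Fin n)} {lab : Fin n → List ℕ}
    (hη : ∀ w p, p ∈ M.η w ↔ p ∈ lab w) {a : CTL} (ha : a.IsAtom) (hn : σ.v .num = n)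
    (hone : σ.v .one = 1) (hlab : ∀ w, σ.a .lab w = 0)
    (h' : Reads (σ.a .inp) (σ.v .pos) (formula a)) (hB : σ.v .pos + (formula a).length ≤ B)
    (h : Reads (σ.a .inp) (σ.v .start) ((List.ofFn lab).map label).flatten)
    (hrest : σ.v .rest = ((List.ofFn lab).map label).flatten.length)
    (hlen : ((List.ofFn lab).map label).flatten.length ≤ σ.v .len)
    (hB' : σ.v .start + ((List.ofFn lab).map label).flatten.length ≤ B) (w : Fin n) :
    (parseAtom.sem B σ).a .lab w ≠ 0 ↔ M.Sat a w := by
  set s₀ := block [.copy .sel .pos, .load .sym .inp .pos, .set .tmp 3, .dist .tmp .sym .tmp]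
  have e : parseAtom.sem B σ = (ifz .tmp (.loop .row .num (.store .lab .row .one))
    searchLabels).sem B (s₀.sem B σ) := rfl
  have htmp : (s₀.sem B σ).v .tmp = 0 ↔ σ.a .inp (σ.v .pos) = 3 := by
    simp [s₀, block, Stmt.sem]
    omega
  have hone0 : (s₀.sem B σ).v .one = 1 := (sem_v rfl).trans hone
  have hn0 : (s₀.sem B σ).v .num = n := (sem_v rfl).trans hn
  have hinp0 : (s₀.sem B σ).a .inp = σ.a .inp := sem_a rfl
  have hlab0 : (s₀.sem B σ).a .lab = σ.a .lab := sem_a rfl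
  have hstart0 : (s₀.sem B σ).v .start = σ.v .start := sem_v rfl
  have hrest0 : (s₀.sem B σ).v .rest = σ.v .rest := sem_v rfl
  have hlen0 : (s₀.sem B σ).v .len = σ.v .len := sem_v rfl
  have hsel0 : (s₀.sem B σ).v .sel = σ.v .pos := by simp [s₀, block, Stmt.sem]
  rcases ha with rfl | ⟨p, rfl⟩
  · have h3 : σ.a .inp (σ.v .pos) = 3 := h' 0 (by simp [formula])
    rw [e, sem_ifz_of_eq (htmp.2 h3)]
    generalize s₀.sem B σ = τ at *
    have key := loop_rule (B := B) (c := .row) (i := .num) (σ := τ) (s := .store .lab .row .one)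
      (fun m ρ => ∀ i < m, ρ.a .lab i ≠ 0) (by simp) (by
        intro m ρ hm hc hv ha hb hP i hi
        by_cases him : i = m
        · simp [Stmt.sem, him, hc, hv .one rfl, hone0]
        · simpa [Stmt.sem, him, hc] using hP i (by omega))
    rw [hn0] at key
    exact iff_of_true (key w w.2) trivial
  · rw [formula, reads_cons] at h'
    have h3 : σ.a .inp (σ.v .pos) ≠ 3 := by
      rw [h'.1]
      decide
    rw [e, sem_ifz_of_ne (mt htmp.1 h3)]
    simp only [formula, List.length_cons, List.length_append, List.length_nil] at hB
    rw [searchLabels_spec (r := p) (ls := List.ofFn lab) hone0 (by rwa [hlab0])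
      (by rw [hinp0, hsel0]; exact h'.2) (by rw [hsel0]; omega) (by rwa [hinp0, hstart0])
      (by rw [hrest0, hrest]) (by rwa [hlen0]) (by rwa [hstart0])]
    simp [Kripke.Sat, hη]

theorem length_inst (M : Kripke (Fin n)) (lab : Fin n → List ℕ) (φ : CTL) :
    (inst M lab φ).length = n + 1 + n + n * n + ((List.ofFn lab).map label).flatten.length +
      (formula φ).length := by
  simp only [inst, worlds, rels, List.length_append, List.length_replicate, List.length_cons,
    List.length_nil, List.length_ofFn, List.length_flatten, List.map_ofFn, Function.comp_def,
    List.ofFn_const, List.sum_replicate, smul_eq_mul]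

theorem length_rels (S : Set (Fin n × Fin n)) : (rels S).length = n * n := by
  simp [rels, List.length_flatten, Function.comp_def, List.map_ofFn]

open Classical in
theorem rels_getElem (S : Set (Fin n × Fin n)) (v w : Fin n)
    (h : (v : ℕ) * n + w < (rels S).length) :
    ((rels S)[(v : ℕ) * n + w] : ℕ) = if (v, w) ∈ S then 1 else 0 := by
  simp only [rels_eq_ofFn, List.getElem_ofFn, bit]
  simp only [exists_edge_eq]
  split_ifs <;> rfl

theorem base_globOf (hn : n ≠ 0) {W : Type*} (A : Set W) (m : CTL.Mode) :
    (if globOf n m = 0 then Set.univ else A) = Kripke.Mode.base A m := by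
  cases m <;> simp [globOf, Kripke.Mode.base, hn]

theorem startSearch_spec {G : Game n} {f : ℕ → ℕ} (hr : σ.v .root = G.M.r) (hg : Graph n σ)
    (hlab : toSet n (σ.a .lab) = G.A) (hglob : σ.v .glob = globOf n G.m)
    (hinner : σ.v .inner = Kripke.Mode.inner n G.m) (houter : σ.v .outer = Kripke.Mode.outer n G.m)
    (hstat : σ.a .stat = f) (hbuf : σ.buf = []) (hf : Valid G f) :
    At G f [] (startSearch.sem B σ) ∧
      ((startSearch.sem B σ).v .mode = 0 ∧ (sols G f).Nonempty ∨
        (startSearch.sem B σ).v .mode = 1 ∧ ¬ (sols G f).Nonempty) := by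
  have h1 : At G f [] (((σ.setV .top 0).setV .go 1).setV .mode 0) :=
    { graph := ⟨by simpa using hg.num, by simpa using hg.sq, by simpa using hg.one, hg.src, hg.tgt⟩
      root := by simpa using hr
      lab := hlab
      base := by
        have := G.M.r.2
        simpa [hglob] using base_globOf (by omega) G.A G.m
      inner := by simpa using hinner
      outer := by simpa using houter
      stat := hstat
      top := by simp
      trail := trivial
      buf := hbuf
      go := by simp }
  have e : startSearch.sem B σ = (ifz .ans (.copy .mode .one) .skip).sem B
      (test.sem B (((σ.setV .top 0).setV .go 1).setV .mode 0)) := rfl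
  have h2 := h1.test (B := B)
  have h3 := h1.test_iff (B := B) hf
  have h4 : (test.sem B (((σ.setV .top 0).setV .go 1).setV .mode 0)).v .mode = 0 := by
    rw [sem_v rfl]
    simp
  rw [e]
  generalize test.sem B (((σ.setV .top 0).setV .go 1).setV .mode 0) = τ at *
  by_cases hs : (sols G f).Nonempty
  · rw [sem_ifz_of_ne (h3.2 hs)]
    exact ⟨h2, Or.inl ⟨h4, hs⟩⟩
  · rw [sem_ifz_of_eq (not_not.1 (mt h3.1 hs))]
    exact ⟨h2.setV rfl _, Or.inr ⟨by simp [Stmt.sem, h2.graph.one], hs⟩⟩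

/-- The adjacency bits serve directly as statuses: transitions of `M` are undecided, all other pairs
deleted, and nothing is chosen. The reachability condition of `Valid` is then vacuous, and the
solutions below the root are all satisfying submodels. -/
theorem init_spec {M : Kripke (Fin n)} {lab : Fin n → List ℕ} (hη : ∀ w p, p ∈ M.η w ↔ p ∈ lab w)
    {φ a : CTL} {ops : List Bool} (ha : a.IsAtom) (hφ : formula φ = ops.map opSymb ++ formula a)
    (hσ : Initial (inst M lab φ).length (start (inst M lab φ)).reg σ)
    (hB : (inst M lab φ).length + 1 ≤ B) :
    ∃ f, At ⟨M, {w | M.Sat a w}, modeOf .id ops⟩ f [] (init.sem B σ) ∧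
      Valid ⟨M, {w | M.Sat a w}, modeOf .id ops⟩ f ∧
      ((init.sem B σ).v .mode = 0 ∧
          (sols ⟨M, {w | M.Sat a w}, modeOf .id ops⟩ f).Nonempty ∨
        (init.sem B σ).v .mode = 1 ∧
          ¬ (sols ⟨M, {w | M.Sat a w}, modeOf .id ops⟩ f).Nonempty) ∧
      ∀ v w, ¬ inRel n f v w ∧ (remRel n f v w ↔ M.R v w) := by
  classical
  set x := inst M lab φ with hx
  set R := ((List.ofFn lab).map label).flatten with hR
  have hL := length_inst M lab φ
  rw [← hx, ← hR, hφ, List.length_append, List.length_map] at hL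
  have hinp : σ.a .inp = fun i => if 1 ≤ i ∧ i ≤ x.length then (start x).reg i else 0 :=
    funext hσ.inp
  have hreads : Reads (σ.a .inp) 1 (List.replicate n 1 ++ [0] ++
      (worlds {M.r} ++ (rels {e | M.R e.1 e.2} ++ (R ++ (ops.map opSymb ++ formula a))))) := by
    have := reads_start (x := x)
    rw [← hinp, hx, inst, hφ] at this
    simpa only [List.append_assoc, hR, List.map_ofFn, Function.comp_def] using this
  have hlenσ := hσ.len
  have hlab0 := fun i => hσ.arr .lab i (by simp)
  -- the number of worlds
  obtain ⟨n1, p1, o1⟩ := parseSize_spec (B := B) hreads (by omega) (by omega)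
  have hr1 := (reads_append.1 hreads).2
  simp only [List.length_append, List.length_replicate, List.length_cons, List.length_nil] at hr1
  -- Positions count from `1`; `n` ones and the separator `0` precede the root.
  rw [show 1 + (n + (0 + 1)) = n + 2 by omega, ← sem_a (B := B) (s := parseSize) rfl] at hr1
  have l1 : (parseSize.sem B σ).v .len = x.length := (sem_v rfl).trans hlenσ
  have z1 : (parseSize.sem B σ).a .lab = σ.a .lab := sem_a rfl
  have b1 : (parseSize.sem B σ).buf = [] := (sem_buf rfl).trans hσ.buf
  have e : init.sem B σ = startSearch.sem B (parseAtom.sem B (parseOps.sem B (skipLabels.sem B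
    (parseEdges.sem B (parseRoot.sem B (parseSize.sem B σ)))))) := rfl
  rw [e]
  generalize parseSize.sem B σ = σ₁ at *
  -- the root
  obtain ⟨hr2, hr1⟩ := reads_append.1 hr1
  rw [← p1] at hr2
  obtain ⟨r2, p2⟩ := parseRoot_spec (B := B) n1 hr2 (by omega)
  have n2 : (parseRoot.sem B σ₁).v .num = n := (sem_v rfl).trans n1
  have o2 : (parseRoot.sem B σ₁).v .one = 1 := (sem_v rfl).trans o1
  have l2 : (parseRoot.sem B σ₁).v .len = x.length := (sem_v rfl).trans l1
  have z2 : (parseRoot.sem B σ₁).a .lab = σ.a .lab := (sem_a rfl).trans z1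
  have b2 : (parseRoot.sem B σ₁).buf = [] := (sem_buf rfl).trans b1
  rw [← sem_a (B := B) (s := parseRoot) rfl, show (worlds {M.r}).length = n by simp [worlds]] at hr1
  generalize parseRoot.sem B σ₁ = σ₂ at *
  -- the matrix
  rw [p1] at p2
  obtain ⟨hr3, hr1⟩ := reads_append.1 hr1
  obtain ⟨⟨-, p3, E3⟩, q3⟩ := parseEdges_spec (B := B) n2 p2 (by omega)
  have i3 : (parseEdges.sem B σ₂).a .inp = σ₂.a .inp := sem_a rfl
  have r3 : (parseEdges.sem B σ₂).v .root = M.r := (sem_v rfl).trans r2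
  have n3 : (parseEdges.sem B σ₂).v .num = n := (sem_v rfl).trans n2
  have o3 : (parseEdges.sem B σ₂).v .one = 1 := (sem_v rfl).trans o2
  have l3 : (parseEdges.sem B σ₂).v .len = x.length := (sem_v rfl).trans l2
  have z3 : (parseEdges.sem B σ₂).a .lab = σ.a .lab := (sem_a rfl).trans z2
  have b3 : (parseEdges.sem B σ₂).buf = [] := (sem_buf rfl).trans b2
  rw [← i3, length_rels] at hr1
  rw [← i3] at hr3
  generalize parseEdges.sem B σ₂ = σ₃ at *
  have hstat : ∀ v w : Fin n, σ₃.a .stat (v * n + w) = if M.R v w then 1 else 0 := by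
    intro v w
    have hvw := edge_lt v w
    rw [(E3 _ hvw).2.2, hr3 _ (by rwa [length_rels]), rels_getElem]
    rfl
  have g3 : Graph n σ₃ := ⟨n3, q3, o3, fun e he => (E3 e he).1, fun e he => (E3 e he).2.1⟩
  -- the labels
  obtain ⟨hr4, hr1⟩ := reads_append.1 hr1
  rw [← p3] at hr4
  obtain ⟨s4, p4, t4⟩ := skipLabels_spec (B := B) (ls := List.ofFn lab) (by simpa using n3) hr4
    (by rw [l3, ← hR]; omega) (by rw [← hR]; omega)
  rw [← hR] at p4 t4
  have i4 : (skipLabels.sem B σ₃).a .inp = σ₃.a .inp := sem_a rfl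
  have g4 := g3.sem (B := B) skipLabels rfl
  have r4 : (skipLabels.sem B σ₃).v .root = M.r := (sem_v rfl).trans r3
  have l4 : (skipLabels.sem B σ₃).v .len = x.length := (sem_v rfl).trans l3
  have z4 : (skipLabels.sem B σ₃).a .lab = σ.a .lab := (sem_a rfl).trans z3
  have f4 : (skipLabels.sem B σ₃).a .stat = σ₃.a .stat := sem_a rfl
  have b4 : (skipLabels.sem B σ₃).buf = [] := (sem_buf rfl).trans b3
  rw [← i4, ← p3, ← p4] at hr1
  rw [← i4, ← s4] at hr4
  rw [p3] at p4 s4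
  generalize skipLabels.sem B σ₃ = σ₄ at *
  -- the operators
  obtain ⟨hr5, hr1⟩ := reads_append.1 hr1
  obtain ⟨c, u, hc, hcu⟩ : ∃ (c : Symb) (u : List Symb), (c = 3 ∨ c = 4) ∧ formula a = c :: u := by
    rcases ha with rfl | ⟨p, rfl⟩
    exacts [⟨3, [], Or.inl rfl, rfl⟩, ⟨4, _, Or.inr rfl, rfl⟩]
  have hcu' := congrArg List.length hcu
  rw [List.length_cons] at hcu'
  obtain ⟨p5, gl5, in5, ou5⟩ := parseOps_spec (B := B) hc g4.num (by
    rw [reads_append, reads_cons]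
    rw [hcu, reads_cons] at hr1
    exact ⟨hr5, hr1.1, by simp [Reads]⟩) (by rw [l4]; omega) (by omega)
  have i5 : (parseOps.sem B σ₄).a .inp = σ₄.a .inp := sem_a rfl
  have g5 := g4.sem (B := B) parseOps rfl
  have r5 : (parseOps.sem B σ₄).v .root = M.r := (sem_v rfl).trans r4
  have l5 : (parseOps.sem B σ₄).v .len = x.length := (sem_v rfl).trans l4
  have z5 : (parseOps.sem B σ₄).a .lab = σ.a .lab := (sem_a rfl).trans z4
  have f5 : (parseOps.sem B σ₄).a .stat = σ₃.a .stat := (sem_a rfl).trans f4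
  have s5 : (parseOps.sem B σ₄).v .start = σ₄.v .start := sem_v rfl
  have t5 : (parseOps.sem B σ₄).v .rest = σ₄.v .rest := sem_v rfl
  have b5 : (parseOps.sem B σ₄).buf = [] := (sem_buf rfl).trans b4
  rw [List.length_map, ← p5, ← i5] at hr1
  rw [← i5, ← s5] at hr4
  rw [t4] at t5
  generalize parseOps.sem B σ₄ = σ₅ at *
  -- the atom
  have hatom := parseAtom_spec (B := B) hη ha g5.num g5.one (fun w => by rw [z5, hlab0]) hr1
    (by omega) hr4 t5 (by rw [l5, ← hR]; omega) (by rw [← hR]; omega)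
  have g6 := g5.sem (B := B) parseAtom rfl
  have r6 : (parseAtom.sem B σ₅).v .root = M.r := (sem_v rfl).trans r5
  have f6 : (parseAtom.sem B σ₅).a .stat = σ₃.a .stat := (sem_a rfl).trans f5
  have gl6 := (sem_v (B := B) (s := parseAtom) rfl).trans gl5
  have in6 := (sem_v (B := B) (s := parseAtom) rfl).trans in5
  have ou6 := (sem_v (B := B) (s := parseAtom) rfl).trans ou5
  have b6 : (parseAtom.sem B σ₅).buf = [] := (sem_buf rfl).trans b5
  have hrel : ∀ v w, ¬ inRel n (σ₃.a .stat) v w ∧ (remRel n (σ₃.a .stat) v w ↔ M.R v w) := by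
    intro v w
    unfold inRel remRel
    rw [hstat]
    split_ifs with h <;> simp [h]
  have hf : Valid (⟨M, {w | M.Sat a w}, modeOf .id ops⟩ : Game n) (σ₃.a .stat) := by
    refine ⟨fun e he => ?_, fun v w h => (hrel v w).2.1 h, fun v w h => absurd h (hrel v w).1⟩
    obtain ⟨v, w, rfl⟩ := exists_edge he
    rw [hstat]
    split_ifs <;> simp
  obtain ⟨h1, h2⟩ := startSearch_spec (B := B) (G := ⟨M, {w | M.Sat a w}, modeOf .id ops⟩) r6 g6
    (Set.ext hatom) gl6 in6 ou6 f6 b6 hf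
  exact ⟨_, h1, hf, h2, hrel⟩

end RAM

/-! ### Polynomial delay -/

namespace RAM

open Encoding Stmt

variable {n : ℕ}

theorem mem_sols_iff {M : Kripke (Fin n)} {φ a : CTL} {m : CTL.Mode} (ha : a.IsAtom)
    (h : ∀ {W : Type} (M : Kripke W) (w : W), M.Sat φ w ↔ M.Sat (m.wrap a) w) {f : ℕ → ℕ}
    (hf : ∀ v w, ¬ inRel n f v w ∧ (remRel n f v w ↔ M.R v w))
    (p : Set (Fin n) × Set (Fin n × Fin n)) :
    p ∈ sols ⟨M, {w | M.Sat a w}, m⟩ f ↔ M.IsSatisfyingSubmodel φ p.1 p.2 := by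
  constructor
  · rintro ⟨h1, h2, -, -⟩
    exact ⟨h1, (h _ _).2 ((Kripke.sat_sub_wrap ha m _).2 h2)⟩
  · rintro ⟨h1, h2⟩
    exact ⟨h1, (Kripke.sat_sub_wrap (h := h1.root_mem) ha m ⟨M.r, h1.root_mem⟩).1 ((h _ _).1 h2),
      fun v w hvw => absurd hvw (hf v w).1, fun v w hvw => (hf v w).2.2 (h1.rel_subset v w hvw)⟩

theorem length_formula_pos (φ : CTL) : 0 < (formula φ).length := by
  cases φ <;> simp [formula]

/-- The adjacency matrix is part of the input, so `n * n` is at most the input length; hence `2 *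
x.length + 3` rounds exceed the `2 * (n * n) + 2` needed between outputs. The input starts with `1`
because a root exists, and it has the five symbols that `prelude` presupposes. -/
theorem exists_run {x : List Symb} {M : Kripke (Fin n)} {φ : CTL}
    (hφ : φ ∈ CTL.Fragment CTL.opsAFAG) (hx : Encodes x M φ) :
    ∃ c, HaltsWith (machine init body) (∅ : Set (List (Fin 0))) x c ∧
      (c.outs.map Prod.snd).Nodup ∧
      (∀ y, y ∈ c.outs.map Prod.snd ↔
        ∃ V S, M.IsSatisfyingSubmodel φ V S ∧ y = (submodel V S).map Fin.val) ∧
      List.IsChain (fun s t => t ≤ s + delay init body (2 * x.length + 3) x.length)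
        (0 :: (c.outs.map Prod.fst ++ [c.time])) ∧ c.querySize = 0 := by
  obtain ⟨-, lab, hη, rfl⟩ := hx
  have hL := length_inst M lab φ
  have hn := M.r.2
  have hformula := length_formula_pos φ
  have hlabels : 0 < ((List.ofFn lab).map label).flatten.length := by
    refine List.length_pos_of_mem (a := 2) (List.mem_flatten.2 ⟨label (lab M.r), ?_, ?_⟩)
    · exact List.mem_map.2 ⟨_, List.mem_ofFn.2 ⟨M.r, rfl⟩, rfl⟩
    · simp [label]
  have hnn : 1 ≤ n * n := Nat.mul_pos (by omega) (by omega)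
  obtain ⟨ops, a, ha, hformula, hsat⟩ := exists_ops φ hφ
  obtain ⟨c, h1, h2, h3, h4⟩ := machine_run (k := 18) (∅ : Set (List (Fin 0))) (init := init)
    (body := body) rfl rfl
    (x := inst M lab φ) (by omega) (by omega) (by
      obtain ⟨k, rfl⟩ : ∃ k, n = k + 1 := ⟨n - 1, by omega⟩
      rw [start_reg, inst, List.replicate_succ]
      simp)
    (D := 2 * (inst M lab φ).length + 3)
    (Q := {ws | ws.Nodup ∧ ∀ y, y ∈ ws ↔
        ∃ V S, M.IsSatisfyingSubmodel φ V S ∧ y = (submodel V S).map Fin.val})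
    (by
      intro σ hσ hσB
      obtain ⟨f, g1, g2, g3, g4⟩ := init_spec hη ha hformula hσ
        (B := (inst M lab φ).length + 20) (by omega)
      obtain ⟨ws, hws, hloops⟩ := loops_of_start (D := 2 * (inst M lab φ).length + 3)
        (B := (inst M lab φ).length + 20) (by omega) (by omega) g1 g2 g3
      refine ⟨g1.buf, ws, ⟨hws.1, fun y => (hws.2 y).trans ?_⟩, hloops⟩
      have key := mem_sols_iff (M := M) ha (fun M w => hsat M .id w) g4
      exact ⟨fun ⟨p, hp, hy⟩ => ⟨p.1, p.2, (key p).1 hp, hy⟩,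
        fun ⟨V, S, hp, hy⟩ => ⟨(V, S), (key (V, S)).2 hp, hy⟩⟩)
  exact ⟨c, h1, h2.1, h2.2, h3, h4⟩

/-- The only word over the empty alphabet has length `0`, so the empty program halts with `0` in
register `0` and rejects. -/
theorem empty_mem_PTime : (∅ : Set (List (Fin 0))) ∈ PTime 0 := by
  refine ⟨[], 0, fun x => ⟨start x, ⟨Nat.zero_le _, 0, rfl⟩, Nat.zero_le _, ?_⟩⟩
  obtain rfl : x = [] := List.eq_nil_of_length_eq_zero (by
    rcases x with _ | ⟨i, x⟩
    exacts [rfl, i.elim0])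
  simp [start]

theorem eSubmodels_mem_DelP : ESubmodels CTL.opsAFAG ∈ DelP 18 := by
  obtain ⟨p, hp⟩ := delay_eq_eval init body
  refine ⟨0, ∅, empty_mem_PTime, machine init body, p, ?_⟩
  rintro x ⟨n, M, φ, hφ, hx⟩
  obtain ⟨c, h1, h2, h3, h4, h5⟩ := exists_run hφ hx
  refine ⟨c, h1, h2, Set.ext fun y => ?_, by rwa [← hp], by rw [h5]; exact Nat.zero_le _⟩
  constructor
  · intro hy
    obtain ⟨V, S, hVS, rfl⟩ := (h3 y).1 hy
    exact ⟨submodel V S, ⟨n, M, φ, hφ, hx, V, S, hVS, rfl⟩, rfl⟩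
  · rintro ⟨_, ⟨n', M', φ', hφ', hx', V, S, hVS, rfl⟩, rfl⟩
    obtain ⟨c', h1', -, h3', -, -⟩ := exists_run hφ' hx'
    -- A word might encode several pairs of model and formula. Uniqueness of the final configuration
    -- shows that they share the same solutions, so injectivity of the encoding is not needed.
    rw [h1.unique h1']
    exact (h3' _).2 ⟨V, S, hVS, rfl⟩

end RAM

theorem mainTheorem10 :
    -- submodel enumeration for formulas built from AF and AG only has polynomial delay
    ESubmodels CTL.opsAFAG ∈ DelP 18 ∧
    -- every such formula with at least one operator is equivalent to one of four forms
    (∀ φ ∈ CTL.Fragment CTL.opsAFAG, φ.IsAtom ∨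
      ∃ a : CTL, a.IsAtom ∧
        (CTL.Equivalent.{u} φ a.AF ∨ CTL.Equivalent.{u} φ a.AG ∨
          CTL.Equivalent.{u} φ a.AG.AF ∨ CTL.Equivalent.{u} φ a.AF.AG)) ∧
    -- for each form, the extension problem amounts to model checking the existential analogue
    (∀ (W : Type u) [Finite W] (M : Kripke W), M.Total →
      ∀ (D : Kripke.Deletions W) (hD : M.r ∉ D.worlds) (a : CTL), a.IsAtom →
        (M.ExtendSubmodel a.AF D ↔ (M.delete D hD).Models a.EF) ∧
        (M.ExtendSubmodel a.AG D ↔ (M.delete D hD).Models a.EG) ∧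
        (M.ExtendSubmodel a.AG.AF D ↔ (M.delete D hD).Models a.EG.EF) ∧
        (M.ExtendSubmodel a.AF.AG D ↔
          ∃ w, Relation.ReflTransGen (M.delete D hD).R (M.delete D hD).r w ∧
            (M.delete D hD).Sat a w ∧ Relation.TransGen (M.delete D hD).R w w)) :=
  ⟨RAM.eSubmodels_mem_DelP, fun φ h => CTL.isAtom_or_equivalent φ h,
    fun _ _ M _ D hD a ha => Kripke.extend_iff M D hD a ha⟩
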